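/- All graphs are finite, simple and undirected, and a graph class is a class of graphs closed under isomorphism. It is monotone if it is closed under taking (not necessarily induced) subgraphs. For $r\in\mathbb N$, a graph $H$ is an $r$-shallow topological minor of a graph $G$ if $G$ contains as a subgraph some graph obtained from $H$ by replacing every edge by a path with at most $r$ internal vertices. The depth of a rooted tree is the maximal number of vertices on a root-to-leaf path. The tree rank of a graph class $\mathcal C$ is the maximal $d\in\mathbb N$ for which there is $r\in\mathbb N$ such that every rooted tree of depth $d$ (as an unrooted graph) is an $r$-shallow topological minor of some graph in $\mathcal C$; if this maximum exists, then $\mathcal C$ has bounded tree rank. Formulas are first-order formulas, possibly with free variables, over the adjacency relation and equality. The alternation rank of a formula is the maximal number of alternations (consecutive quantifiers, ignoring $\wedge$ and $\vee$, of the form $\exists\forall$ or $\forall\exists$) on a branch of the syntax tree of its negation normal form. Two formulas with the same free variables are equivalent on $\mathcal C$ if they are satisfied by the same tuples of vertices in every graph of $\mathcal C$. **Theorem.** Let $\mathcal C$ be a monotone graph class. Then $\mathcal C$ has bounded tree rank if and only if there is $k\in\mathbb N$ such that every formula is equivalent on $\mathcal C$ to a formula of alternation rank at most $k$. -/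

import Mathlib

namespace TreeRank

open FirstOrder

/-! ### Graph classes -/

/-- A class of finite simple graphs, closed under isomorphism. -/
structure GraphClass where
  Mem : ∀ {V : Type}, SimpleGraph V → Prop
  finite_of_mem : ∀ {V : Type} {G : SimpleGraph V}, Mem G → Finite V
  mem_of_iso : ∀ {V W : Type} {G : SimpleGraph V} {H : SimpleGraph W},
    Mem G → Nonempty (G ≃g H) → Mem H

/-- A graph class is monotone if it is closed under taking (not necessarily induced) subgraphs.
Here `H.IsContained G` says that `H` is isomorphic to a subgraph of `G`. -/
def GraphClass.Monotone (C : GraphClass) : Prop :=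
  ∀ {V W : Type} (G : SimpleGraph V) (H : SimpleGraph W), C.Mem G → H.IsContained G → C.Mem H

/-! ### Shallow topological minors -/

/-- A `≤ r`-subdivision of `H` inside `G`: the vertices of `H` are sent to distinct (branch)
vertices of `G`, and every edge of `H` is replaced by a path of `G` with at most `r` internal
vertices (that is, with at most `r + 1` edges), where the internal vertices are not branch vertices
and are not shared by the paths of two different edges. -/
structure SubdivisionIn (r : ℕ) {V W : Type} (H : SimpleGraph V) (G : SimpleGraph W) where
  branch : V → W
  branch_injective : Function.Injective branch
  path : ∀ {u v : V}, H.Adj u v → G.Walk (branch u) (branch v)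
  path_isPath : ∀ {u v : V} (h : H.Adj u v), (path h).IsPath
  path_symm : ∀ {u v : V} (h : H.Adj u v), path h.symm = (path h).reverse
  path_length_le : ∀ {u v : V} (h : H.Adj u v), (path h).length ≤ r + 1
  branch_mem_path : ∀ {u v : V} (h : H.Adj u v) (w : V),
    branch w ∈ (path h).support → w = u ∨ w = v
  path_disjoint : ∀ {u v u' v' : V} (h : H.Adj u v) (h' : H.Adj u' v') (x : W),
    s(u, v) ≠ s(u', v') → x ∈ (path h).support → x ∈ (path h').support → x ∈ Set.range branch

/-- `H` is an `r`-shallow topological minor of `G`: some `≤ r`-subdivision of `H` is a subgraph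
of `G`. -/
def IsShallowTopMinor (r : ℕ) {V W : Type} (H : SimpleGraph V) (G : SimpleGraph W) : Prop :=
  Nonempty (SubdivisionIn r H G)

/-- `H` belongs to `TopMinors_r(C)`. -/
def GraphClass.HasShallowTopMinor (C : GraphClass) (r : ℕ) {V : Type} (H : SimpleGraph V) : Prop :=
  ∃ (W : Type) (G : SimpleGraph W), C.Mem G ∧ IsShallowTopMinor r H G

/-! ### Tree rank -/

/-- The tree `T` rooted at `root` has depth `d`: the maximal number of vertices on a path
starting in the root (equivalently, on a root-to-leaf path) is `d`. -/
def HasDepth {V : Type} (T : SimpleGraph V) (root : V) (d : ℕ) : Prop :=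
  IsGreatest {n : ℕ | ∃ (v : V) (p : T.Walk root v), p.IsPath ∧ p.support.length = n} d

/-- Those `d` for which there is an `r` such that all finite trees of depth `d` are
`r`-shallow topological minors of graphs from `C`. -/
def GraphClass.treeDepths (C : GraphClass) : Set ℕ :=
  {d | ∃ r : ℕ, ∀ (V : Type) (T : SimpleGraph V) (root : V), Finite V → T.IsTree →
    HasDepth T root d → C.HasShallowTopMinor r T}

/-- The tree rank of `C` is the number `d`. -/
def GraphClass.IsTreeRank (C : GraphClass) (d : ℕ) : Prop :=
  IsGreatest C.treeDepths d

/-- The maximum defining the tree rank exists. -/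
def GraphClass.HasBoundedTreeRank (C : GraphClass) : Prop :=
  ∃ d : ℕ, C.IsTreeRank d

/-! ### Alternation rank -/

inductive Quantifier where
  | all
  | ex

/-- The number of subwords `∀∃` or `∃∀` (of two consecutive letters) of a word of quantifiers. -/
def alternations : List Quantifier → ℕ
  | .all :: .ex :: w => alternations (.ex :: w) + 1
  | .ex :: .all :: w => alternations (.all :: w) + 1
  | _ :: w => alternations w
  | [] => 0

/-- The words of quantifiers read, from the root to the leaves, on the branches of the syntax tree
of the negation normal form of `φ` (for `positive = true`) or of `¬ φ` (for `positive = false`).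
The formulas of Mathlib are built from `⊥`, atoms, `→` and `∀`; the other connectives and `∃` are
abbreviations. The negation normal form of `φ → ψ` is the disjunction of those of `¬ φ` and `ψ`, that
of `¬ (φ → ψ)` is the conjunction of those of `φ` and `¬ ψ`, and that of `¬ ∀ x, φ` is `∃ x` followed
by that of `¬ φ`. -/
def branchWords {L : Language} {α : Type} :
    ∀ {n : ℕ}, (positive : Bool) → L.BoundedFormula α n → List (List Quantifier)
  | _, _, .falsum => [ [] ]
  | _, _, .equal _ _ => [ [] ]
  | _, _, .rel _ _ => [ [] ]
  | _, b, .imp φ ψ => branchWords (!b) φ ++ branchWords b ψ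
  | _, true, .all φ => (branchWords true φ).map (Quantifier.all :: ·)
  | _, false, .all φ => (branchWords false φ).map (Quantifier.ex :: ·)

/-- The alternation rank of a formula: the maximal number of quantifier alternations on a branch
of its negation normal form. -/
def alternationRank {L : Language} {α : Type} {n : ℕ} (φ : L.BoundedFormula α n) : ℕ :=
  ((branchWords true φ).map alternations).foldr max 0

/-! ### Equivalence on a class -/

/-- `G ⊨ φ(v)`, for a first-order formula in the language of graphs (adjacency and equality). -/
def Holds {V : Type} (G : SimpleGraph V) {m : ℕ} (φ : Language.graph.Formula (Fin m))
    (v : Fin m → V) : Prop :=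
  letI := G.structure
  φ.Realize v

/-- Two formulas with the same free variables are equivalent on `C` if they are satisfied
by the same tuples in every graph of `C`. -/
def GraphClass.EquivalentOn (C : GraphClass) {m : ℕ} (φ ψ : Language.graph.Formula (Fin m)) : Prop :=
  ∀ {V : Type} (G : SimpleGraph V), C.Mem G → ∀ v : Fin m → V, Holds G φ v ↔ Holds G ψ v

end TreeRank

/-! Bounded tree rank gives bounded alternation. Consider games with k rounds in which Spoiler plays
blocks of N vertices. Their outcome is determined by finitely many formulas of alternation rank at
most k (`exists_formulas`). So it suffices to find k such that, for all q and m, some N makes the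
k-round block game decide the ordinary q-round game on m-tuples of graphs of the class
(`exists_equivalent_formula`). If depth d + 1 is not attained, then for every radius r some tree of
depth d + 1 is no r-shallow topological minor in the class. By greedy embedding, no vertex then has
robust rank d, for a robustness M computed from that tree (`isShallowTopMinor_of_hasRank`).

The number k is found by induction on d (`exists_rounds`). A Gaifman-style locality argument
(`exists_locality`) reduces the ordinary game to games on balls of bounded radius, plus the transfer
of scattered tuples. If no vertex has rank d + 1, a ball contains boundedly many vertices of rank d
(`encard_rank_le`). Deleting their edges and recording these edges by colors leaves a graph without
vertices of rank d, to which the induction hypothesis applies. Each step costs three block rounds,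
independently of q. In the base case the graphs are edgeless.

Conversely, if large depths are attained, subdivided complete trees give vertices of large robust
rank. By pigeonhole, one fixed pattern of branching and non-branching levels occurs with arbitrarily
large branching (`exists_hasLevels`). By monotonicity the class contains two trees with this
pattern, a winning and a losing position of a game along the levels. A fixed formula tells them
apart. The inclusion of the losing tree into the winning one preserves formulas of low alternation
rank (`Preserving.sat`): each branching level provides a sandwich, where the smaller tree agrees
with a larger third tree up to the given number of variables, because surplus copies of a subtree
can be swapped. -/

namespace TreeRank

/-! ### Block Ehrenfeucht–Fraïssé games on colored graphs -/

/-- A graph with a distinguished domain `D`, that contains all edges, and a vertex coloring. -/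
@[ext]
structure ColoredGraph (V κ : Type) where
  G : SimpleGraph V
  D : Set V
  col : V → κ
  mem_of_adj : ∀ {x y : V}, G.Adj x y → x ∈ D

variable {V W X κ : Type}

/-- The tuples `a` and `b` have the same atomic type. -/
def AtomEquiv (A : ColoredGraph V κ) (B : ColoredGraph W κ) {ι : Type} (a : ι → V) (b : ι → W) :
    Prop :=
  (∀ i j, (a i = a j ↔ b i = b j) ∧ (A.G.Adj (a i) (a j) ↔ B.G.Adj (b i) (b j))) ∧
    ∀ i, A.col (a i) = B.col (b i)

/-- Duplicator wins the `k`-round game where in each round Spoiler picks a block of `N` vertices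
of one of the two domains, and Duplicator answers in the other one. -/
def BlockEquiv (N : ℕ) (A : ColoredGraph V κ) (B : ColoredGraph W κ) :
    ℕ → ∀ {ι : Type}, (ι → V) → (ι → W) → Prop
  | 0, _, a, b => AtomEquiv A B a b
  | k + 1, _, a, b => AtomEquiv A B a b ∧
      (∀ c : Fin N → V, (∀ j, c j ∈ A.D) → ∃ c' : Fin N → W, (∀ j, c' j ∈ B.D) ∧
        BlockEquiv N A B k (Sum.elim a c) (Sum.elim b c')) ∧
      (∀ c' : Fin N → W, (∀ j, c' j ∈ B.D) → ∃ c : Fin N → V, (∀ j, c j ∈ A.D) ∧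
        BlockEquiv N A B k (Sum.elim a c) (Sum.elim b c'))

section

variable {A : ColoredGraph V κ} {B : ColoredGraph W κ} {C : ColoredGraph X κ}
  {ι ι' : Type} {a : ι → V} {b : ι → W} {N k : ℕ}

theorem AtomEquiv.comp (h : AtomEquiv A B a b) (f : ι' → ι) : AtomEquiv A B (a ∘ f) (b ∘ f) :=
  ⟨fun i j => h.1 (f i) (f j), fun i => h.2 (f i)⟩

theorem AtomEquiv.symm (h : AtomEquiv A B a b) : AtomEquiv B A b a :=
  ⟨fun i j => ⟨(h.1 i j).1.symm, (h.1 i j).2.symm⟩, fun i => (h.2 i).symm⟩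

theorem AtomEquiv.trans {c : ι → X} (h : AtomEquiv A B a b) (h' : AtomEquiv B C b c) :
    AtomEquiv A C a c :=
  ⟨fun i j => ⟨(h.1 i j).1.trans (h'.1 i j).1, (h.1 i j).2.trans (h'.1 i j).2⟩,
    fun i => (h.2 i).trans (h'.2 i)⟩

theorem BlockEquiv.atom (h : BlockEquiv N A B k a b) : AtomEquiv A B a b := by
  cases k with
  | zero => exact h
  | succ k => exact h.1

theorem BlockEquiv.comp (h : BlockEquiv N A B k a b) (f : ι' → ι) :
    BlockEquiv N A B k (a ∘ f) (b ∘ f) := by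
  induction k generalizing ι ι' with
  | zero => exact AtomEquiv.comp h f
  | succ k ih =>
    refine ⟨h.1.comp f, fun c hc => ?_, fun c' hc' => ?_⟩
    · obtain ⟨c', hc', e⟩ := h.2.1 c hc
      exact ⟨c', hc', by simpa [Sum.elim_comp_map] using ih e (Sum.map f id)⟩
    · obtain ⟨c, hc, e⟩ := h.2.2 c' hc'
      exact ⟨c, hc, by simpa [Sum.elim_comp_map] using ih e (Sum.map f id)⟩

theorem BlockEquiv.symm (h : BlockEquiv N A B k a b) : BlockEquiv N B A k b a := by
  induction k generalizing ι with
  | zero => exact AtomEquiv.symm h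
  | succ k ih =>
    refine ⟨h.1.symm, fun c hc => ?_, fun c' hc' => ?_⟩
    · obtain ⟨c', hc', e⟩ := h.2.2 c hc
      exact ⟨c', hc', ih e⟩
    · obtain ⟨c, hc, e⟩ := h.2.1 c' hc'
      exact ⟨c, hc, ih e⟩

theorem BlockEquiv.trans {c : ι → X} (h : BlockEquiv N A B k a b) (h' : BlockEquiv N B C k b c) :
    BlockEquiv N A C k a c := by
  induction k generalizing ι with
  | zero => exact AtomEquiv.trans h h'
  | succ k ih =>
    refine ⟨h.1.trans h'.1, fun x hx => ?_, fun z hz => ?_⟩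
    · obtain ⟨y, hy, e⟩ := h.2.1 x hx
      obtain ⟨z, hz, e'⟩ := h'.2.1 y hy
      exact ⟨z, hz, ih e e'⟩
    · obtain ⟨y, hy, e⟩ := h'.2.2 z hz
      obtain ⟨x, hx, e'⟩ := h.2.2 y hy
      exact ⟨x, hx, ih e' e⟩

theorem BlockEquiv.of_succ (h : BlockEquiv N A B (k + 1) a b) : BlockEquiv N A B k a b := by
  induction k generalizing ι with
  | zero => exact h.1
  | succ k ih =>
    refine ⟨h.1, fun c hc => ?_, fun c' hc' => ?_⟩
    · obtain ⟨c', hc', e⟩ := h.2.1 c hc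
      exact ⟨c', hc', ih e⟩
    · obtain ⟨c, hc, e⟩ := h.2.2 c' hc'
      exact ⟨c, hc, ih e⟩

theorem BlockEquiv.mono_rounds {l : ℕ} (h : BlockEquiv N A B k a b) (hl : l ≤ k) :
    BlockEquiv N A B l a b := by
  induction hl with
  | refl => exact h
  | step _ ih => exact ih h.of_succ

/-- A shorter block is padded to length `N` by repeating vertices. An empty block cannot be padded,
but there a round is simply skipped. -/
theorem BlockEquiv.forth {β : Type} [Fintype β] (h : BlockEquiv N A B (k + 1) a b)
    (hN : Fintype.card β ≤ N) (c : β → V) (hc : ∀ j, c j ∈ A.D) :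
    ∃ c' : β → W, (∀ j, c' j ∈ B.D) ∧ BlockEquiv N A B k (Sum.elim a c) (Sum.elim b c') := by
  rcases isEmpty_or_nonempty β with hβ | hβ
  · refine ⟨isEmptyElim, isEmptyElim, ?_⟩
    have := h.of_succ.comp (Sum.elim id isEmptyElim : ι ⊕ β → ι)
    convert this using 1 <;> ext (i | i) <;> first | rfl | exact isEmptyElim i
  · obtain ⟨g⟩ : Nonempty (β ↪ Fin N) :=
      Function.Embedding.nonempty_of_card_le (by simpa using hN)
    have hg : ∀ x, Function.invFun g (g x) = x := Function.leftInverse_invFun g.injective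
    obtain ⟨c', hc', e⟩ := h.2.1 (c ∘ Function.invFun g) (fun j => hc _)
    refine ⟨c' ∘ g, fun j => hc' _, ?_⟩
    have := e.comp (Sum.map id g)
    convert this using 1 <;> ext (i | i) <;> simp [hg]

theorem BlockEquiv.back {β : Type} [Fintype β] (h : BlockEquiv N A B (k + 1) a b)
    (hN : Fintype.card β ≤ N) (c' : β → W) (hc' : ∀ j, c' j ∈ B.D) :
    ∃ c : β → V, (∀ j, c j ∈ A.D) ∧ BlockEquiv N A B k (Sum.elim a c) (Sum.elim b c') := by
  obtain ⟨c, hc, e⟩ := h.symm.forth hN c' hc'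
  exact ⟨c, hc, e.symm⟩

theorem BlockEquiv.mono_block {N' : ℕ} (h : BlockEquiv N A B k a b) (hN : N' ≤ N) :
    BlockEquiv N' A B k a b := by
  induction k generalizing ι with
  | zero => exact h
  | succ k ih =>
    refine ⟨h.1, fun c hc => ?_, fun c' hc' => ?_⟩
    · obtain ⟨c', hc', e⟩ := h.forth (by simpa using hN) c hc
      exact ⟨c', hc', ih e⟩
    · obtain ⟨c, hc, e⟩ := h.back (by simpa using hN) c' hc'
      exact ⟨c, hc, ih e⟩

theorem BlockEquiv.forth_single {n : ℕ} (h : BlockEquiv 1 A B (k + n) a b) (c : Fin n → V)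
    (hc : ∀ j, c j ∈ A.D) :
    ∃ c' : Fin n → W, (∀ j, c' j ∈ B.D) ∧ BlockEquiv 1 A B k (Sum.elim a c) (Sum.elim b c') := by
  induction n generalizing k with
  | zero =>
    rw [Nat.add_zero] at h
    refine ⟨isEmptyElim, isEmptyElim, ?_⟩
    have := h.comp (Sum.elim id isEmptyElim : ι ⊕ Fin 0 → ι)
    convert this using 1 <;> ext (i | i) <;> first | rfl | exact isEmptyElim i
  | succ n ih =>
    obtain ⟨c', hc', e⟩ := ih (k := k + 1) (by convert h using 1; omega) (fun j => c j.castSucc)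
      (fun j => hc _)
    obtain ⟨z, hz, e'⟩ := e.2.1 (fun _ => c (Fin.last n)) (fun _ => hc _)
    refine ⟨Fin.snoc c' (z 0), fun j => ?_, ?_⟩
    · refine Fin.lastCases ?_ (fun j => ?_) j
      · simpa using hz 0
      · simpa using hc' j
    · have := e'.comp (Sum.elim (Sum.inl ∘ Sum.inl)
        (Fin.snoc (α := fun _ => (ι ⊕ Fin n) ⊕ Fin 1) (Sum.inl ∘ Sum.inr) (Sum.inr 0)))
      convert this using 1
      · ext (i | i)
        · rfl
        · refine Fin.lastCases ?_ (fun j => ?_) i <;> simp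
      · ext (i | i)
        · rfl
        · refine Fin.lastCases ?_ (fun j => ?_) i <;> simp

/-- A block is played one vertex at a time. Local equivalence is stated with single moves, and this
recovers the blocks needed to name walks and tuples inside balls. -/
theorem BlockEquiv.block_of_single (h : BlockEquiv 1 A B (k * N) a b) :
    BlockEquiv N A B k a b := by
  induction k generalizing ι with
  | zero => exact h.atom
  | succ k ih =>
    rw [Nat.succ_mul] at h
    refine ⟨h.atom, fun c hc => ?_, fun c' hc' => ?_⟩
    · obtain ⟨c', hc', e⟩ := h.forth_single c hc
      exact ⟨c', hc', ih e⟩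
    · obtain ⟨c, hc, e⟩ := h.symm.forth_single c' hc'
      exact ⟨c, hc, ih e.symm⟩

/-- Games on structures that are interpreted in other structures by means of a tuple, where one
extra round is needed to evaluate the interpretation. -/
theorem BlockEquiv.interpret {κ' : Type} {A' : ColoredGraph V κ'} {B' : ColoredGraph W κ'}
    (hA : A'.D ⊆ A.D) (hB : B'.D ⊆ B.D)
    (hE : ∀ {J : Type} (x : J → V) (y : J → W),
      BlockEquiv N A B 1 (Sum.elim a x) (Sum.elim b y) →
        AtomEquiv A' B' x y ∧ ∀ j, x j ∈ A'.D ↔ y j ∈ B'.D)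
    {J : Type} {x : J → V} {y : J → W}
    (h : BlockEquiv N A B (k + 1) (Sum.elim a x) (Sum.elim b y)) :
    BlockEquiv N A' B' k x y := by
  induction k generalizing J with
  | zero => exact (hE x y h).1
  | succ k ih =>
    refine ⟨(hE x y (h.mono_rounds (by omega))).1, fun c hc => ?_, fun c' hc' => ?_⟩
    · obtain ⟨c', hc', e⟩ := h.2.1 c (fun j => hA (hc j))
      have e' := e.comp (Sum.elim (Sum.inl ∘ Sum.inl) (Sum.map Sum.inr id) :
        ι ⊕ (J ⊕ Fin N) → (ι ⊕ J) ⊕ Fin N)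
      have e'' : BlockEquiv N A B (k + 1) (Sum.elim a (Sum.elim x c))
          (Sum.elim b (Sum.elim y c')) := by
        convert e' using 1 <;> ext (i | i | i) <;> rfl
      refine ⟨c', fun j => ?_, ih e''⟩
      exact ((hE _ _ (e''.mono_rounds (by omega))).2 (Sum.inr j)).1 (hc j)
    · obtain ⟨c, hc, e⟩ := h.2.2 c' (fun j => hB (hc' j))
      have e' := e.comp (Sum.elim (Sum.inl ∘ Sum.inl) (Sum.map Sum.inr id) :
        ι ⊕ (J ⊕ Fin N) → (ι ⊕ J) ⊕ Fin N)
      have e'' : BlockEquiv N A B (k + 1) (Sum.elim a (Sum.elim x c))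
          (Sum.elim b (Sum.elim y c')) := by
        convert e' using 1 <;> ext (i | i | i) <;> rfl
      refine ⟨c, fun j => ?_, ih e''⟩
      exact ((hE _ _ (e''.mono_rounds (by omega))).2 (Sum.inr j)).2 (hc' j)

theorem BlockEquiv.of_atom {κ' : Type} {A' : ColoredGraph V κ'} {B' : ColoredGraph W κ'}
    (hA : A'.D = A.D) (hB : B'.D = B.D)
    (hE : ∀ {J : Type} (x : J → V) (y : J → W), AtomEquiv A B x y → AtomEquiv A' B' x y)
    (h : BlockEquiv N A B k a b) : BlockEquiv N A' B' k a b := by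
  induction k generalizing ι with
  | zero => exact hE _ _ h
  | succ k ih =>
    refine ⟨hE _ _ h.1, fun c hc => ?_, fun c' hc' => ?_⟩
    · obtain ⟨c', hc', e⟩ := h.2.1 c (fun j => hA ▸ hc j)
      exact ⟨c', fun j => hB ▸ hc' j, ih e⟩
    · obtain ⟨c, hc, e⟩ := h.2.2 c' (fun j => hB ▸ hc' j)
      exact ⟨c, fun j => hA ▸ hc j, ih e⟩

/-- Games on disjoint unions. -/
theorem BlockEquiv.disjoint_union {A₁ A₂ A₃ : ColoredGraph V κ} {B₁ B₂ B₃ : ColoredGraph W κ}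
    (hA : A₃.D = A₁.D ∪ A₂.D) (hB : B₃.D = B₁.D ∪ B₂.D)
    (hAd : Disjoint A₁.D A₂.D) (hBd : Disjoint B₁.D B₂.D)
    (hAG : ∀ u v, A₃.G.Adj u v ↔ A₁.G.Adj u v ∨ A₂.G.Adj u v)
    (hBG : ∀ u v, B₃.G.Adj u v ↔ B₁.G.Adj u v ∨ B₂.G.Adj u v)
    (hA₁ : A₃.col = A₁.col) (hA₂ : A₃.col = A₂.col) (hB₁ : B₃.col = B₁.col) (hB₂ : B₃.col = B₂.col)
    {z : ι' → V} {w : ι' → W}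
    (ha : ∀ i, a i ∈ A₁.D) (hb : ∀ i, b i ∈ B₁.D) (hz : ∀ i, z i ∈ A₂.D) (hw : ∀ i, w i ∈ B₂.D)
    (h₁ : BlockEquiv 1 A₁ B₁ k a b) (h₂ : BlockEquiv 1 A₂ B₂ k z w) :
    BlockEquiv 1 A₃ B₃ k (Sum.elim a z) (Sum.elim b w) := by
  have atom : ∀ {ι ι' : Type} {a : ι → V} {b : ι → W} {z : ι' → V} {w : ι' → W},
      (∀ i, a i ∈ A₁.D) → (∀ i, b i ∈ B₁.D) → (∀ i, z i ∈ A₂.D) → (∀ i, w i ∈ B₂.D) →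
      AtomEquiv A₁ B₁ a b → AtomEquiv A₂ B₂ z w →
      AtomEquiv A₃ B₃ (Sum.elim a z) (Sum.elim b w) := by
    intro ι ι' a b z w ha hb hz hw h₁ h₂
    have nA : ∀ {x}, x ∈ A₁.D → x ∈ A₂.D → False := fun h h' => Set.disjoint_left.1 hAd h h'
    have nB : ∀ {x}, x ∈ B₁.D → x ∈ B₂.D → False := fun h h' => Set.disjoint_left.1 hBd h h'
    refine ⟨?_, ?_⟩
    · rintro (i | i) (j | j)
      · refine ⟨(h₁.1 i j).1, ?_⟩
        simp only [Sum.elim_inl, hAG, hBG, (h₁.1 i j).2]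
        exact or_congr_right ⟨fun h => (nA (ha i) (A₂.mem_of_adj h)).elim,
          fun h => (nB (hb i) (B₂.mem_of_adj h)).elim⟩
      · refine ⟨⟨fun h => (nA (ha i) ?_).elim, fun h => (nB (hb i) ?_).elim⟩, ?_⟩
        · simp only [Sum.elim_inl, Sum.elim_inr] at h; rw [h]; exact hz j
        · simp only [Sum.elim_inl, Sum.elim_inr] at h; rw [h]; exact hw j
        · simp only [Sum.elim_inl, Sum.elim_inr, hAG, hBG]
          constructor
          · rintro (h | h)
            · exact (nA (A₁.mem_of_adj h.symm) (hz j)).elim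
            · exact (nA (ha i) (A₂.mem_of_adj h)).elim
          · rintro (h | h)
            · exact (nB (B₁.mem_of_adj h.symm) (hw j)).elim
            · exact (nB (hb i) (B₂.mem_of_adj h)).elim
      · refine ⟨⟨fun h => (nA (ha j) ?_).elim, fun h => (nB (hb j) ?_).elim⟩, ?_⟩
        · simp only [Sum.elim_inl, Sum.elim_inr] at h; rw [← h]; exact hz i
        · simp only [Sum.elim_inl, Sum.elim_inr] at h; rw [← h]; exact hw i
        · simp only [Sum.elim_inl, Sum.elim_inr, hAG, hBG]
          constructor
          · rintro (h | h)
            · exact (nA (A₁.mem_of_adj h) (hz i)).elim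
            · exact (nA (ha j) (A₂.mem_of_adj h.symm)).elim
          · rintro (h | h)
            · exact (nB (B₁.mem_of_adj h) (hw i)).elim
            · exact (nB (hb j) (B₂.mem_of_adj h.symm)).elim
      · refine ⟨(h₂.1 i j).1, ?_⟩
        simp only [Sum.elim_inr, hAG, hBG, (h₂.1 i j).2]
        exact or_congr_left ⟨fun h => (nA (A₁.mem_of_adj h) (hz i)).elim,
          fun h => (nB (B₁.mem_of_adj h) (hw i)).elim⟩
    · rintro (i | i)
      · simp only [Sum.elim_inl, hA₁, hB₁, h₁.2 i]
      · simp only [Sum.elim_inr, hA₂, hB₂, h₂.2 i]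
  induction k generalizing ι ι' with
  | zero => exact atom ha hb hz hw h₁ h₂
  | succ k ih =>
    refine ⟨atom ha hb hz hw h₁.1 h₂.1, fun c hc => ?_, fun c' hc' => ?_⟩
    · rcases (hA ▸ hc 0 : c 0 ∈ A₁.D ∪ A₂.D) with h | h
      · obtain ⟨c', hc', e⟩ := h₁.2.1 c (by simpa [Fin.forall_fin_one] using h)
        refine ⟨c', fun j => hB ▸ Or.inl (hc' j), ?_⟩
        have := (ih (Sum.forall.2 ⟨ha, by simpa [Fin.forall_fin_one] using h⟩)
          (Sum.forall.2 ⟨hb, hc'⟩) hz hw e h₂.of_succ).comp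
          (Sum.elim (Sum.map Sum.inl id) (Sum.inl ∘ Sum.inr) :
            (ι ⊕ ι') ⊕ Fin 1 → (ι ⊕ Fin 1) ⊕ ι')
        convert this using 1 <;> ext ((i | i) | i) <;> rfl
      · obtain ⟨c', hc', e⟩ := h₂.2.1 c (by simpa [Fin.forall_fin_one] using h)
        refine ⟨c', fun j => hB ▸ Or.inr (hc' j), ?_⟩
        have := (ih ha hb (Sum.forall.2 ⟨hz, by simpa [Fin.forall_fin_one] using h⟩)
          (Sum.forall.2 ⟨hw, hc'⟩) h₁.of_succ e).comp
          (Sum.elim (Sum.map id Sum.inl) (Sum.inr ∘ Sum.inr) :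
            (ι ⊕ ι') ⊕ Fin 1 → ι ⊕ (ι' ⊕ Fin 1))
        convert this using 1 <;> ext ((i | i) | i) <;> rfl
    · rcases (hB ▸ hc' 0 : c' 0 ∈ B₁.D ∪ B₂.D) with h | h
      · obtain ⟨c, hc, e⟩ := h₁.2.2 c' (by simpa [Fin.forall_fin_one] using h)
        refine ⟨c, fun j => hA ▸ Or.inl (hc j), ?_⟩
        have := (ih (Sum.forall.2 ⟨ha, hc⟩)
          (Sum.forall.2 ⟨hb, by simpa [Fin.forall_fin_one] using h⟩) hz hw e h₂.of_succ).comp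
          (Sum.elim (Sum.map Sum.inl id) (Sum.inl ∘ Sum.inr) :
            (ι ⊕ ι') ⊕ Fin 1 → (ι ⊕ Fin 1) ⊕ ι')
        convert this using 1 <;> ext ((i | i) | i) <;> rfl
      · obtain ⟨c, hc, e⟩ := h₂.2.2 c' (by simpa [Fin.forall_fin_one] using h)
        refine ⟨c, fun j => hA ▸ Or.inr (hc j), ?_⟩
        have := (ih ha hb (Sum.forall.2 ⟨hz, hc⟩)
          (Sum.forall.2 ⟨hw, by simpa [Fin.forall_fin_one] using h⟩) h₁.of_succ e).comp
          (Sum.elim (Sum.map id Sum.inl) (Sum.inr ∘ Sum.inr) :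
            (ι ⊕ ι') ⊕ Fin 1 → ι ⊕ (ι' ⊕ Fin 1))
        convert this using 1 <;> ext ((i | i) | i) <;> rfl

end

end TreeRank

namespace TreeRank

/-! ### Distances and balls in colored graphs -/

section Distance

variable {V W : Type}

/-- The vertices `x` and `y` are at distance at most `n`. -/
def Within (G : SimpleGraph V) (n : ℕ) (x y : V) : Prop :=
  ∃ p : G.Walk x y, p.length ≤ n

variable {G H : SimpleGraph V} {m n : ℕ} {x y z : V}

theorem Within.refl (G : SimpleGraph V) (n : ℕ) (x : V) : Within G n x x :=
  ⟨.nil, Nat.zero_le _⟩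

theorem Within.symm (h : Within G n x y) : Within G n y x := by
  obtain ⟨p, hp⟩ := h
  exact ⟨p.reverse, by simpa using hp⟩

theorem Within.trans (h : Within G m x y) (h' : Within G n y z) : Within G (m + n) x z := by
  obtain ⟨p, hp⟩ := h
  obtain ⟨q, hq⟩ := h'
  exact ⟨p.append q, by rw [SimpleGraph.Walk.length_append]; omega⟩

theorem Within.mono (h : Within G m x y) (hn : m ≤ n) : Within G n x y := by
  obtain ⟨p, hp⟩ := h
  exact ⟨p, hp.trans hn⟩

theorem Within.mono_graph (h : Within G n x y) (hH : G ≤ H) : Within H n x y := by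
  obtain ⟨p, hp⟩ := h
  exact ⟨p.mapLe hH, by simpa using hp⟩

/-- Walks of length at most `n` are played as blocks of exactly `n + 1` vertices that may stand
still; this turns the answer to such a block into a walk again. -/
theorem exists_walk_of_lazy_sequence (s : ℕ → V) (n : ℕ)
    (h : ∀ l < n, s l = s (l + 1) ∨ G.Adj (s l) (s (l + 1))) :
    ∃ p : G.Walk (s 0) (s n), p.length ≤ n ∧ ∀ v ∈ p.support, ∃ l ≤ n, v = s l := by
  induction n with
  | zero => exact ⟨.nil, le_rfl, fun v hv => ⟨0, le_rfl, by simpa using hv⟩⟩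
  | succ n ih =>
    obtain ⟨p, hp, hs⟩ := ih (fun l hl => h l (by omega))
    rcases h n (by omega) with e | e
    · refine ⟨p.copy rfl e, by simp; omega, fun v hv => ?_⟩
      obtain ⟨l, hl, rfl⟩ := hs v (by simpa using hv)
      exact ⟨l, by omega, rfl⟩
    · refine ⟨p.concat e, by simp; omega, fun v hv => ?_⟩
      rw [SimpleGraph.Walk.support_concat, List.mem_append,
        List.mem_singleton] at hv
      rcases hv with hv | rfl
      · obtain ⟨l, hl, rfl⟩ := hs v hv
        exact ⟨l, by omega, rfl⟩
      · exact ⟨n + 1, le_rfl, rfl⟩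

end Distance

variable {V W X κ : Type}

theorem ColoredGraph.mem_of_mem_support (A : ColoredGraph V κ) {x y : V} (p : A.G.Walk x y)
    (hx : x ∈ A.D) : ∀ v ∈ p.support, v ∈ A.D := by
  induction p with
  | nil => intro v hv; simp at hv; exact hv ▸ hx
  | cons h p ih =>
    intro v hv
    rw [SimpleGraph.Walk.support_cons, List.mem_cons] at hv
    rcases hv with rfl | hv
    · exact hx
    · exact ih (A.mem_of_adj h.symm) v hv

theorem ColoredGraph.mem_of_within (A : ColoredGraph V κ) {x y : V} {n : ℕ}
    (h : Within A.G n x y) (hx : x ∈ A.D) : y ∈ A.D := by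
  obtain ⟨p, -⟩ := h
  exact A.mem_of_mem_support p hx _ p.end_mem_support

/-- The ball around a tuple. -/
def ColoredGraph.ball (A : ColoredGraph V κ) (R : ℕ) {ι : Type} (a : ι → V) :
    ColoredGraph V κ where
  G := { Adj := fun x y => A.G.Adj x y ∧ (∃ i, Within A.G R (a i) x) ∧ ∃ i, Within A.G R (a i) y
         symm := ⟨fun _ _ h => ⟨h.1.symm, h.2.2, h.2.1⟩⟩
         loopless := ⟨fun _ h => h.1.ne rfl⟩ }
  D := {x | ∃ i, Within A.G R (a i) x}
  col := A.col
  mem_of_adj h := h.2.1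

section

variable {A : ColoredGraph V κ} {B : ColoredGraph W κ} {C : ColoredGraph X κ}
  {ι ι' : Type} {a : ι → V} {b : ι → W} {N k R : ℕ}

theorem ColoredGraph.ball_le (A : ColoredGraph V κ) (R : ℕ) (a : ι → V) :
    (A.ball R a).G ≤ A.G := fun _ _ h => h.1

theorem ColoredGraph.ball_subset (ha : ∀ i, a i ∈ A.D) : (A.ball R a).D ⊆ A.D := by
  rintro x ⟨i, hi⟩
  exact A.mem_of_within hi (ha i)

theorem ColoredGraph.mem_ball_self (A : ColoredGraph V κ) (R : ℕ) (a : ι → V) (i : ι) :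
    a i ∈ (A.ball R a).D := ⟨i, Within.refl _ _ _⟩

/-- A walk of length `n` that starts at distance `m` from the center never leaves the ball, so short
distances deep inside a ball are the true ones. -/
theorem Within.ball {m n : ℕ} {i : ι} {x y : V} (h : Within A.G n x y)
    (hx : Within A.G m (a i) x) (hR : m + n ≤ R) : Within (A.ball R a).G n x y := by
  obtain ⟨p, hp⟩ := h
  induction p generalizing m n with
  | nil => exact Within.refl _ _ _
  | @cons u v w e p ih =>
    rw [SimpleGraph.Walk.length_cons] at hp
    have huv : Within A.G (m + 1) (a i) v := hx.trans ⟨.cons e .nil, le_rfl⟩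
    obtain ⟨q, hq⟩ := ih (m := m + 1) (n := n - 1) huv (by omega) (by omega)
    have e' : (A.ball R a).G.Adj u v := ⟨e, ⟨i, hx.mono (by omega)⟩, ⟨i, huv.mono (by omega)⟩⟩
    exact ⟨.cons e' q, by rw [SimpleGraph.Walk.length_cons]; omega⟩

theorem ColoredGraph.ball_ball {ρ : ℕ} {x : ι' → V}
    (h : ∀ j, ∃ i m, Within A.G m (a i) (x j) ∧ m + ρ ≤ R) :
    (A.ball R a).ball ρ x = A.ball ρ x := by
  have key : ∀ v, (∃ j, Within (A.ball R a).G ρ (x j) v) ↔ ∃ j, Within A.G ρ (x j) v := by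
    refine fun v => exists_congr fun j => ⟨fun h => h.mono_graph (A.ball_le R a), fun h' => ?_⟩
    obtain ⟨i, m, hm, hR⟩ := h j
    exact h'.ball hm hR
  have key' : ∀ v, (∃ j, Within A.G ρ (x j) v) → ∃ i, Within A.G R (a i) v := by
    rintro v ⟨j, hj⟩
    obtain ⟨i, m, hm, hR⟩ := h j
    exact ⟨i, (hm.trans hj).mono hR⟩
  ext u v
  · constructor
    · rintro ⟨h₁, h₂, h₃⟩
      exact ⟨h₁.1, (key u).1 h₂, (key v).1 h₃⟩
    · rintro ⟨h₁, h₂, h₃⟩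
      exact ⟨⟨h₁, key' _ h₂, key' _ h₃⟩, (key u).2 h₂, (key v).2 h₃⟩
  · exact key u
  · rfl

/-- Duplicator's answer to a walk. -/
theorem BlockEquiv.forth_walk (h : BlockEquiv N A B (k + 1) a b) {n : ℕ} (hN : n + 1 ≤ N) {i : ι}
    (hi : a i ∈ A.D) {v : V} (p : A.G.Walk (a i) v) (hp : p.length ≤ n) :
    ∃ (s : Fin (n + 1) → V) (s' : Fin (n + 1) → W) (p' : B.G.Walk (b i) (s' (Fin.last n))),
      BlockEquiv N A B k (Sum.elim a s) (Sum.elim b s') ∧ (∀ l, s' l ∈ B.D) ∧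
      s (Fin.last n) = v ∧ (∀ l, s l ∈ p.support) ∧ p'.length ≤ n ∧
      ∀ w ∈ p'.support, ∃ l, w = s' l := by
  obtain ⟨s', hs', e⟩ := h.forth (β := Fin (n + 1)) (by simpa using hN)
    (fun l => p.getVert l) (fun l => A.mem_of_mem_support p hi _ (p.getVert_mem_support _))
  have at1 := e.atom
  have h0 : b i = s' 0 := by
    have := (at1.1 (Sum.inl i) (Sum.inr 0)).1
    simpa using this
  obtain ⟨p', hp', hs⟩ := exists_walk_of_lazy_sequence (G := B.G)
    (fun l => s' (Fin.ofNat (n + 1) l)) n (by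
      intro l hl
      have e1 : (Fin.ofNat (n + 1) l : ℕ) = l := by simp; omega
      have e2 : (Fin.ofNat (n + 1) (l + 1) : ℕ) = l + 1 := by simp; omega
      have := at1.1 (Sum.inr (Fin.ofNat (n + 1) l)) (Sum.inr (Fin.ofNat (n + 1) (l + 1)))
      simp only [Sum.elim_inr, e1, e2] at this
      rcases Nat.lt_or_ge l p.length with hl' | hl'
      · exact Or.inr (this.2.1 (p.adj_getVert_succ hl'))
      · refine Or.inl (this.1.1 ?_)
        rw [p.getVert_of_length_le hl', p.getVert_of_length_le (by omega)])
  have e0 : s' (Fin.ofNat (n + 1) 0) = b i := by rw [h0]; congr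
  have en : s' (Fin.ofNat (n + 1) n) = s' (Fin.last n) := by
    congr 1; ext; simp
  refine ⟨_, s', p'.copy e0 en, e, hs', ?_, fun l => p.getVert_mem_support _, by simpa using hp',
    fun w hw => ?_⟩
  · exact p.getVert_of_length_le (by simpa using hp)
  · obtain ⟨l, -, rfl⟩ := hs w (by simpa using hw)
    exact ⟨_, rfl⟩

/-- A single block names a whole walk, so distances cost one round whatever their size. Games with
single moves would need more rounds for larger distances. -/
theorem BlockEquiv.within (h : BlockEquiv N A B (k + 1) a b) {n : ℕ} (hN : n + 1 ≤ N) {i j : ι}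
    (hi : a i ∈ A.D) (hw : Within A.G n (a i) (a j)) : Within B.G n (b i) (b j) := by
  obtain ⟨p, hp⟩ := hw
  obtain ⟨s, s', p', e, -, hl, -, hp', -⟩ := h.forth_walk hN hi p hp
  have : s' (Fin.last n) = b j := by
    have := (e.atom.1 (Sum.inr (Fin.last n)) (Sum.inl j)).1
    simpa [hl] using this
  exact ⟨p'.copy rfl this, by simpa using hp'⟩

theorem BlockEquiv.within_iff (h : BlockEquiv N A B (k + 1) a b) {n : ℕ} (hN : n + 1 ≤ N) {i j : ι}
    (hi : a i ∈ A.D) (hi' : b i ∈ B.D) :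
    Within A.G n (a i) (a j) ↔ Within B.G n (b i) (b j) :=
  ⟨h.within hN hi, h.symm.within hN hi'⟩

theorem BlockEquiv.ball {J : Type} {x : J → V} {y : J → W} (hx : ∀ j, x j ∈ A.D)
    (hy : ∀ j, y j ∈ B.D) (hR : R + 1 ≤ N) (h : BlockEquiv N A B (k + 1) x y) :
    BlockEquiv N (A.ball R x) (B.ball R y) k x y := by
  refine BlockEquiv.interpret (A := A) (B := B) (a := x) (b := y)
    (ColoredGraph.ball_subset hx) (ColoredGraph.ball_subset hy) ?_ ?_
  · intro J' z w e
    have mem : ∀ j, z j ∈ (A.ball R x).D ↔ w j ∈ (B.ball R y).D := by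
      intro j
      refine exists_congr fun i => ?_
      exact e.within_iff hR (i := Sum.inl i) (j := Sum.inr j) (hx i) (hy i)
    refine ⟨⟨fun i j => ⟨(e.atom.1 (Sum.inr i) (Sum.inr j)).1, ?_⟩, fun i => e.atom.2 (Sum.inr i)⟩,
      mem⟩
    exact and_congr (e.atom.1 (Sum.inr i) (Sum.inr j)).2 (and_congr (mem i) (mem j))
  · have := h.comp (Sum.elim id id : J ⊕ J → J)
    convert this using 1 <;> ext (i | i) <;> rfl

/-- The balls around two tuples are equivalent for `q` rounds. -/
def LocalEquiv (R q : ℕ) (A : ColoredGraph V κ) (B : ColoredGraph W κ) {ι : Type} (a : ι → V)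
    (b : ι → W) : Prop :=
  BlockEquiv 1 (A.ball R a) (B.ball R b) q a b

theorem LocalEquiv.symm {q : ℕ} (h : LocalEquiv R q A B a b) : LocalEquiv R q B A b a :=
  BlockEquiv.symm h

theorem LocalEquiv.trans {q : ℕ} {c : ι → X} (h : LocalEquiv R q A B a b)
    (h' : LocalEquiv R q B C b c) : LocalEquiv R q A C a c :=
  BlockEquiv.trans h h'

/-- Smaller balls around new tuples are equivalent too. -/
theorem BlockEquiv.localEquiv_of_ball {J : Type} {x : J → V} {y : J → W} {ρ : ℕ}
    (h : BlockEquiv N (A.ball R a) (B.ball R b) (k + 1) x y) (hN : ρ + 1 ≤ N)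
    (hx : ∀ j, ∃ i m, Within A.G m (a i) (x j) ∧ m + ρ ≤ R)
    (hy : ∀ j, ∃ i m, Within B.G m (b i) (y j) ∧ m + ρ ≤ R) :
    LocalEquiv ρ k A B x y := by
  have := BlockEquiv.ball (R := ρ) (fun j => ?_) (fun j => ?_) hN h
  · rw [ColoredGraph.ball_ball hx, ColoredGraph.ball_ball hy] at this
    exact this.mono_block (by omega)
  · obtain ⟨i, m, hm, hR⟩ := hx j
    exact ⟨i, hm.mono (by omega)⟩
  · obtain ⟨i, m, hm, hR⟩ := hy j
    exact ⟨i, hm.mono (by omega)⟩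

/-- Beyond distance 2ρ + 1 the balls of radius ρ are disjoint and no edge joins them. The ball
around both tuples is then a disjoint union, and the strategies combine. -/
theorem LocalEquiv.sumElim {ρ q : ℕ} {c : ι' → V} {d : ι' → W} (h : LocalEquiv ρ q A B a b)
    (h' : LocalEquiv ρ q A B c d)
    (hA : ∀ i j, ¬ Within A.G (2 * ρ + 1) (a i) (c j))
    (hB : ∀ i j, ¬ Within B.G (2 * ρ + 1) (b i) (d j)) :
    LocalEquiv ρ q A B (Sum.elim a c) (Sum.elim b d) := by
  have key : ∀ {V : Type} {A : ColoredGraph V κ} {a : ι → V} {c : ι' → V},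
      (∀ i j, ¬ Within A.G (2 * ρ + 1) (a i) (c j)) →
      (A.ball ρ (Sum.elim a c)).D = (A.ball ρ a).D ∪ (A.ball ρ c).D ∧
      Disjoint (A.ball ρ a).D (A.ball ρ c).D ∧
      ∀ u v, (A.ball ρ (Sum.elim a c)).G.Adj u v ↔
        (A.ball ρ a).G.Adj u v ∨ (A.ball ρ c).G.Adj u v := by
    intro V A a c hA
    refine ⟨?_, ?_, fun u v => ⟨?_, ?_⟩⟩
    · ext x
      simp [ColoredGraph.ball]
    · rw [Set.disjoint_left]
      rintro x ⟨i, hi⟩ ⟨j, hj⟩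
      exact hA i j ((hi.trans hj.symm).mono (by omega))
    · rintro ⟨h, ⟨i | i, hi⟩, ⟨j | j, hj⟩⟩
      · exact Or.inl ⟨h, ⟨i, hi⟩, ⟨j, hj⟩⟩
      · exact (hA i j (((hi.trans (⟨.cons h .nil, le_rfl⟩ : Within A.G 1 u v)).trans
          hj.symm).mono (by omega))).elim
      · exact (hA j i (((hj.trans (⟨.cons h.symm .nil, le_rfl⟩ : Within A.G 1 v u)).trans
          hi.symm).mono (by omega))).elim
      · exact Or.inr ⟨h, ⟨i, hi⟩, ⟨j, hj⟩⟩
    · rintro (⟨h, ⟨i, hi⟩, ⟨j, hj⟩⟩ | ⟨h, ⟨i, hi⟩, ⟨j, hj⟩⟩)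
      · exact ⟨h, ⟨Sum.inl i, hi⟩, ⟨Sum.inl j, hj⟩⟩
      · exact ⟨h, ⟨Sum.inr i, hi⟩, ⟨Sum.inr j, hj⟩⟩
  obtain ⟨h1, h2, h3⟩ := key hA
  obtain ⟨h1', h2', h3'⟩ := key hB
  exact BlockEquiv.disjoint_union h1 h1' h2 h2' h3 h3' rfl rfl rfl rfl
    (A.mem_ball_self _ _) (B.mem_ball_self _ _) (A.mem_ball_self _ _) (B.mem_ball_self _ _) h h'

/-- Tuples of vertices of `A` have counterparts in `B` with the same small distances and equivalent
balls around each vertex. -/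
def Scattered (P : ℕ) (A : ColoredGraph V κ) (B : ColoredGraph W κ) : Prop :=
  ∀ ρ ≤ P, ∀ q ≤ P, ∀ l ≤ P, ∀ y : Fin l → V, (∀ i, y i ∈ A.D) → ∃ y' : Fin l → W,
    (∀ i, y' i ∈ B.D) ∧ (∀ n ≤ P, ∀ i j, Within A.G n (y i) (y j) ↔ Within B.G n (y' i) (y' j)) ∧
    ∀ i, LocalEquiv ρ q A B (fun _ : Fin 1 => y i) (fun _ => y' i)

theorem Scattered.mono {P P' : ℕ} (h : Scattered P A B) (hP : P' ≤ P) : Scattered P' A B := by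
  intro ρ hρ q hq l hl y hy
  obtain ⟨y', h1, h2, h3⟩ := h ρ (hρ.trans hP) q (hq.trans hP) l (hl.trans hP) y hy
  exact ⟨y', h1, fun n hn => h2 n (hn.trans hP), h3⟩

/-- A vertex far from `a` has a counterpart far from `b`. -/
theorem exists_far_counterpart [Fintype ι] (ha : ∀ i, a i ∈ A.D)
    {ρ q M K P : ℕ} (hM : ρ + Fintype.card ι + 2 * (2 * ρ + 1) + 3 * (2 * ρ + 1) + 2 ≤ M)
    (hP : M + q ≤ P) (hR : 4 * (2 * ρ + 1) ≤ R) (hK : (q + 2) * M ≤ K)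
    (hL : LocalEquiv R K A B a b) (hS : Scattered P A B) {x : V} (hx : x ∈ A.D)
    (hfar : ∀ i, ¬ Within A.G (3 * (2 * ρ + 1)) (a i) x) :
    ∃ x' ∈ B.D, LocalEquiv ρ q A B (fun _ : Fin 1 => x) (fun _ => x') ∧
      ∀ i, ¬ Within B.G (2 * ρ + 1) (b i) x' := by
  by_contra! hcon
  set σ := 2 * ρ + 1 with hσ
  have hE : BlockEquiv M (A.ball R a) (B.ball R b) (q + 2) a b :=
    (BlockEquiv.mono_rounds hL hK).block_of_single
  -- If every counterpart of `x` is near `b`, then arbitrarily many (up to one more than the length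
  -- of `a`) pairwise distant vertices that look like `x` lie near `a`. Each induction step adds the
  -- far vertex `x` to the ones found so far, moves all of them to `B`, where they must be near `b`,
  -- and brings them back into the ball around `a`.
  have key : ∀ j ≤ Fintype.card ι + 1, ∃ y : Fin j → V, (∀ i, ∃ i₀, Within A.G σ (a i₀) (y i)) ∧
      (∀ i i', i ≠ i' → ¬ Within A.G (2 * σ) (y i) (y i')) ∧
      ∀ i, LocalEquiv ρ q A A (fun _ : Fin 1 => x) (fun _ => y i) := by
    intro j
    induction j with
    | zero => exact fun _ => ⟨isEmptyElim, isEmptyElim, isEmptyElim, isEmptyElim⟩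
    | succ j ih =>
      intro hj
      obtain ⟨y, h1, h2, h3⟩ := ih (by omega)
      have hyD : ∀ i, y i ∈ A.D := fun i => by
        obtain ⟨i₀, h⟩ := h1 i
        exact A.mem_of_within h (ha i₀)
      have hyx : ∀ i, ¬ Within A.G (2 * σ) (y i) x := fun i h => by
        obtain ⟨i₀, h'⟩ := h1 i
        exact hfar i₀ ((h'.trans h).mono (by omega))
      let z : Fin (j + 1) → V := Fin.snoc y x
      have hzD : ∀ i, z i ∈ A.D := fun i => by
        refine Fin.lastCases ?_ (fun i => ?_) i
        · simpa [z] using hx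
        · simpa [z] using hyD i
      have hz : ∀ i i', i ≠ i' → ¬ Within A.G (2 * σ) (z i) (z i') := by
        intro i i'
        refine Fin.lastCases ?_ (fun i => ?_) i <;> refine Fin.lastCases ?_ (fun i' => ?_) i'
        · simp
        · intro _ h
          simp only [z, Fin.snoc_last, Fin.snoc_castSucc] at h
          exact hyx _ h.symm
        · intro _ h
          simp only [z, Fin.snoc_last, Fin.snoc_castSucc] at h
          exact hyx _ h
        · intro hne h
          simp only [z, Fin.snoc_castSucc] at h
          exact h2 _ _ (fun e => hne (by rw [e])) h
      obtain ⟨z', hz', hd, hl⟩ := hS ρ (by omega) q (by omega) (j + 1) (by omega) z hzD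
      have hxz : ∀ i, LocalEquiv ρ q A B (fun _ : Fin 1 => x) (fun _ => z' i) := by
        intro i
        refine LocalEquiv.trans (B := A) (b := fun _ => z i) ?_ (hl i)
        refine Fin.lastCases ?_ (fun i => ?_) i
        · have := (hl (Fin.last j)).trans (hl (Fin.last j)).symm
          simpa [z] using this
        · simpa [z] using h3 i
      have hnear : ∀ i, ∃ i₀, Within B.G σ (b i₀) (z' i) := fun i => hcon _ (hz' i) (hxz i)
      obtain ⟨w, hw, e⟩ := hE.back (β := Fin (j + 1)) (by simp; omega) z' (fun i => by
        obtain ⟨i₀, h⟩ := hnear i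
        exact ⟨i₀, h.mono (by omega)⟩)
      have hwa : ∀ i, ∃ i₀, Within A.G σ (a i₀) (w i) := fun i => by
        obtain ⟨i₀, h⟩ := hnear i
        have h' := h.ball (R := R) (Within.refl _ 0 _) (by omega)
        exact ⟨i₀, (e.symm.within (i := Sum.inl i₀) (j := Sum.inr i) (n := σ) (by omega)
          (B.mem_ball_self _ _ _) h').mono_graph (A.ball_le _ _)⟩
      refine ⟨w, hwa, fun i i' hne h => ?_, fun i => ?_⟩
      · obtain ⟨i₀, h₀⟩ := hwa i
        have h' := h.ball (R := R) h₀ (by omega)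
        have h'' := (e.within (i := Sum.inr i) (j := Sum.inr i') (n := 2 * σ) (by omega)
          ⟨i₀, h₀.mono (by omega)⟩ h').mono_graph (B.ball_le _ _)
        exact hz i i' hne ((hd (2 * σ) (by omega) i i').2 h'')
      · refine (hxz i).trans (LocalEquiv.symm ?_)
        have e' := e.comp (fun _ : Fin 1 => Sum.inr i)
        refine BlockEquiv.localEquiv_of_ball (ρ := ρ) e' (by omega) (fun _ => ?_) (fun _ => ?_)
        · obtain ⟨i₀, h₀⟩ := hwa i
          exact ⟨i₀, σ, h₀, by omega⟩
        · obtain ⟨i₀, h₀⟩ := hnear i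
          exact ⟨i₀, σ, h₀, by omega⟩
  obtain ⟨y, h1, h2, -⟩ := key _ le_rfl
  choose f hf using h1
  -- Two of these vertices are within σ of the same entry of `a`, hence within 2σ of each other.
  obtain ⟨i, i', hne, he⟩ := Fintype.exists_ne_map_eq_of_card_lt f (by simp)
  exact h2 i i' hne (((hf i).symm.trans (he ▸ hf i')).mono (by omega))

end

/-- Locality: the equivalence of two tuples for `q` rounds follows from that of large enough balls
around them, and from the existence of counterparts for scattered tuples. -/
theorem exists_locality (q : ℕ) : ∀ t : ℕ, ∃ R K P : ℕ,
    ∀ {κ V W ι : Type} [Fintype ι] (A : ColoredGraph V κ) (B : ColoredGraph W κ)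
      (a : ι → V) (b : ι → W), Fintype.card ι = t → (∀ i, a i ∈ A.D) → (∀ i, b i ∈ B.D) →
      LocalEquiv R K A B a b → Scattered P A B → Scattered P B A → BlockEquiv 1 A B q a b := by
  have atom : ∀ {κ V W ι : Type} (A : ColoredGraph V κ) (B : ColoredGraph W κ)
      (a : ι → V) (b : ι → W) (R K : ℕ), LocalEquiv R K A B a b → AtomEquiv A B a b := by
    intro κ V W ι A B a b R K h
    refine ⟨fun i j => ⟨(h.atom.1 i j).1, ?_⟩, h.atom.2⟩
    have := (h.atom.1 i j).2
    have hA : ∀ i, ∃ i', Within A.G R (a i') (a i) := fun i => A.mem_ball_self R a i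
    have hB : ∀ i, ∃ i', Within B.G R (b i') (b i) := fun i => B.mem_ball_self R b i
    simpa [ColoredGraph.ball, hA, hB] using this
  induction q with
  | zero =>
    exact fun t => ⟨0, 0, 0, fun A B a b _ _ _ h _ _ => atom A B a b _ _ h⟩
  | succ q ih =>
    intro t
    obtain ⟨ρ, K₀, P₀, hQ⟩ := ih (t + 1)
    -- `M` is only required to exceed the lengths of all walks and tuples named below. The radius
    -- `R` leaves room for a ball of radius ρ around a vertex at distance 3(2ρ + 1).
    obtain ⟨M, hM⟩ : ∃ M, M = ρ + t + 2 * (2 * ρ + 1) + 3 * (2 * ρ + 1) + 2 + P₀ + K₀ +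
        (ρ + 4 * (2 * ρ + 1)) := ⟨_, rfl⟩
    obtain ⟨R, hR⟩ : ∃ R, R = ρ + 4 * (2 * ρ + 1) := ⟨_, rfl⟩
    have oneSide : ∀ {κ V W ι : Type} [Fintype ι] (A : ColoredGraph V κ) (B : ColoredGraph W κ)
      (a : ι → V) (b : ι → W), Fintype.card ι = t → (∀ i, a i ∈ A.D) → (∀ i, b i ∈ B.D) →
      LocalEquiv R ((K₀ + 2) * M + 1) A B a b → Scattered (M + K₀) A B → Scattered (M + K₀) B A →
      ∀ c : Fin 1 → V, (∀ j, c j ∈ A.D) → ∃ c' : Fin 1 → W, (∀ j, c' j ∈ B.D) ∧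
        BlockEquiv 1 A B q (Sum.elim a c) (Sum.elim b c') := by
      intro κ V W ι _ A B a b ht ha hb hL hS hS' c hc
      have fin : ∀ c' : Fin 1 → W, (∀ j, c' j ∈ B.D) →
          LocalEquiv ρ K₀ A B (Sum.elim a c) (Sum.elim b c') →
          BlockEquiv 1 A B q (Sum.elim a c) (Sum.elim b c') := fun c' hc' h =>
        hQ A B (Sum.elim a c) (Sum.elim b c') (by simp [ht]) (Sum.forall.2 ⟨ha, hc⟩)
          (Sum.forall.2 ⟨hb, hc'⟩) h (hS.mono (by omega)) (hS'.mono (by omega))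
      -- A near move is answered inside the ball around `b`. A far move is answered by a far
      -- counterpart, and the two local equivalences are glued.
      by_cases hnear : ∃ i, Within A.G (3 * (2 * ρ + 1)) (a i) (c 0)
      · obtain ⟨i, hi⟩ := hnear
        have hE := hL
        obtain ⟨c', hc', e⟩ := hE.2.1 c (fun j => ⟨i, by
          rw [Subsingleton.elim j 0]; exact hi.mono (by omega)⟩)
        have e' : BlockEquiv M (A.ball R a) (B.ball R b) (K₀ + 2) (Sum.elim a c)
            (Sum.elim b c') := e.block_of_single
        have hi' : Within B.G (3 * (2 * ρ + 1)) (b i) (c' 0) :=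
          (e'.within (n := 3 * (2 * ρ + 1)) (i := Sum.inl i) (j := Sum.inr 0) (by omega)
            (A.mem_ball_self _ _ _)
            (hi.ball (R := R) (Within.refl _ 0 _) (by omega))).mono_graph (B.ball_le _ _)
        refine ⟨c', fun j => ColoredGraph.ball_subset hb (hc' j), fin c' (fun j =>
          ColoredGraph.ball_subset hb (hc' j)) ?_⟩
        refine BlockEquiv.localEquiv_of_ball (N := M) (ρ := ρ) (R := R) (e'.mono_rounds (by omega))
          (by omega) ?_ ?_
        · rintro (j | j)
          · exact ⟨j, 0, Within.refl _ _ _, by omega⟩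
          · rw [Subsingleton.elim j 0]; exact ⟨i, _, hi, by omega⟩
        · rintro (j | j)
          · exact ⟨j, 0, Within.refl _ _ _, by omega⟩
          · rw [Subsingleton.elim j 0]; exact ⟨i, _, hi', by omega⟩
      · push Not at hnear
        obtain ⟨x', hx', hl, hf⟩ := exists_far_counterpart (ρ := ρ) (q := K₀) (M := M) ha
          (by omega) le_rfl (by omega) (Nat.le_succ _) hL hS (hc 0) hnear
        refine ⟨fun _ => x', fun _ => hx', fin _ (fun _ => hx') ?_⟩
        have hcc : c = fun _ => c 0 := by
          ext j; rw [Subsingleton.elim j 0]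
        have hE : BlockEquiv M (A.ball R a) (B.ball R b) (K₀ + 2) a b :=
          (BlockEquiv.mono_rounds hL (Nat.le_succ _)).block_of_single
        rw [hcc]
        refine LocalEquiv.sumElim ?_ hl (fun i _ h => hnear i (h.mono (by omega)))
          (fun i _ => hf i)
        exact BlockEquiv.localEquiv_of_ball (N := M) (ρ := ρ) (R := R)
          (hE.mono_rounds (by omega)) (by omega)
          (fun j => ⟨j, 0, Within.refl _ _ _, by omega⟩)
          (fun j => ⟨j, 0, Within.refl _ _ _, by omega⟩)
    refine ⟨R, (K₀ + 2) * M + 1, M + K₀, ?_⟩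
    intro κ V W ι _ A B a b ht ha hb hL hS hS'
    refine ⟨atom A B a b _ _ hL, oneSide A B a b ht ha hb hL hS hS', fun c' hc' => ?_⟩
    obtain ⟨c, hc, e⟩ := oneSide B A b a ht hb ha hL.symm hS' hS c' hc'
    exact ⟨c, hc, e.symm⟩

end TreeRank

namespace TreeRank

/-! ### Robust ranks of vertices -/

variable {V W κ : Type}

/-- Robust version of being the root of a subdivided tree of height `i`: a set of `M` vertices does
not separate `v` from the vertices of the previous rank in its `r`-neighborhood. -/
def HasRank (A : ColoredGraph V κ) (r M : ℕ) : ℕ → V → Prop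
  | 0, v => ∃ w, A.G.Adj v w
  | i + 1, v => ∀ F : Fin M → V, (∀ j, F j ∈ A.D) → ∃ u, u ≠ v ∧ HasRank A r M i u ∧
      ∃ p : A.G.Walk v u, p.length ≤ r ∧ ∀ x ∈ p.support, x ≠ v → ∀ j, x ≠ F j

section

variable {A : ColoredGraph V κ} {B : ColoredGraph W κ} {ι : Type} {a : ι → V} {b : ι → W}
  {r M N i : ℕ}

theorem HasRank.exists_adj {v : V} (hv : v ∈ A.D) (h : HasRank A r M i v) : ∃ w, A.G.Adj v w := by
  cases i with
  | zero => exact h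
  | succ i =>
    obtain ⟨u, hu, -, p, -⟩ := h (fun _ => v) (fun _ => hv)
    cases p with
    | nil => exact (hu rfl).elim
    | cons e p => exact ⟨_, e⟩

theorem HasRank.mono {κ' : Type} {A' : ColoredGraph V κ'} {r' : ℕ} (hG : A'.G ≤ A.G)
    (hr : r' ≤ r) {v : V} (hv : v ∈ A'.D) (h : HasRank A' r' M i v) : HasRank A r M i v := by
  classical
  induction i generalizing v with
  | zero =>
    obtain ⟨w, hw⟩ := h
    exact ⟨w, hG hw⟩
  | succ i ih =>
    intro F hF
    -- Vertices of `F` outside the smaller domain meet no walk there. They are replaced by `v`,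
    -- which blocks nothing because the start of the walk is exempt.
    obtain ⟨u, hu, hi, p, hp, hpF⟩ := h (fun j => if F j ∈ A'.D then F j else v)
      (fun j => by split_ifs with h; exacts [h, hv])
    refine ⟨u, hu, ih (A'.mem_of_mem_support p hv _ p.end_mem_support) hi, p.mapLe hG, by simpa using hp.trans hr,
      fun x hx hxv j hj => ?_⟩
    have hx' : x ∈ p.support := by simpa using hx
    have := hpF x hx' hxv j
    rw [← hj, if_pos (A'.mem_of_mem_support p hv _ hx')] at this
    exact this rfl

/-- Each level of the rank costs two rounds, a block for the separating set and a block for the walk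
that avoids it. The last round finds a neighbor. -/
theorem BlockEquiv.hasRank (hr : r + 1 ≤ N) (hM : M ≤ N)
    (h : BlockEquiv N A B (2 * i + 1) a b) {j : ι} (hj : a j ∈ A.D) (hv : HasRank A r M i (a j)) :
    HasRank B r M i (b j) := by
  induction i generalizing ι with
  | zero =>
    obtain ⟨w, hw⟩ := hv
    obtain ⟨c', -, e⟩ := h.forth (β := Fin 1) (by simp; omega) (fun _ => w)
      (fun _ => A.mem_of_adj hw.symm)
    exact ⟨c' 0, (e.atom.1 (Sum.inl j) (Sum.inr 0)).2.1 hw⟩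
  | succ i ih =>
    intro F' hF'
    obtain ⟨F, hF, e⟩ := h.back (β := Fin M) (k := 2 * i + 2) (by simpa using hM) F' hF'
    obtain ⟨u, hu, hi, p, hp, hpF⟩ := hv F hF
    obtain ⟨s, s', p', e', -, hl, hs, hp', hs'⟩ :=
      e.forth_walk (k := 2 * i + 1) (i := Sum.inl j) hr hj p hp
    have hu' : s' (Fin.last r) ≠ b j := by
      have := (e'.atom.1 (Sum.inr (Fin.last r)) (Sum.inl (Sum.inl j))).1
      simp only [Sum.elim_inr, Sum.elim_inl, hl] at this
      exact fun h => hu (this.2 h)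
    refine ⟨_, hu', ih e' (j := Sum.inr (Fin.last r)) ?_ ?_, p', hp', fun x hx hxv l hxl => ?_⟩
    · simp only [Sum.elim_inr, hl]
      exact A.mem_of_mem_support p hj _ p.end_mem_support
    · simpa only [Sum.elim_inr, hl] using hi
    · obtain ⟨m, rfl⟩ := hs' x hx
      refine hpF _ (hs m) (fun h => hxv ?_) l ?_
      · simpa using ((e'.atom.1 (Sum.inr m) (Sum.inl (Sum.inl j))).1).1 h
      · simpa using ((e'.atom.1 (Sum.inr m) (Sum.inl (Sum.inr l))).1).2 hxl

/-- If no vertex has rank `d + 1`, then balls contain boundedly many vertices of rank `d`. -/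
theorem encard_rank_le {d : ℕ} (hA : ∀ v ∈ A.D, ¬ HasRank A r M (d + 1) v) (R : ℕ) (hR : R ≤ r)
    {v : V} (hv : v ∈ A.D) :
    {u | HasRank A r M d u ∧ Within A.G R v u}.encard ≤ ((M + 1) ^ R * (R + 1) : ℕ) := by
  classical
  induction R generalizing v with
  | zero =>
    refine (Set.encard_le_encard (t := {v}) ?_).trans (by simp)
    rintro u ⟨-, p, hp⟩
    cases p with
    | nil => rfl
    | cons e p => simp at hp
  | succ R ih =>
    have := hA v hv
    simp only [HasRank] at this
    push Not at this
    obtain ⟨F, hF, hcut⟩ := this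
    -- Since `v` lacks rank d + 1, the short walks from `v` to other vertices of rank d meet the set
    -- `F` after leaving `v`, and the rest of such a walk is shorter. The bound f satisfies f(R + 1)
    -- = 1 + M f(R).
    have hsub : {u | HasRank A r M d u ∧ Within A.G (R + 1) v u} ⊆
        {v} ∪ ⋃ j, {u | HasRank A r M d u ∧ Within A.G R (F j) u} := by
      rintro u ⟨hu, p, hp⟩
      by_cases huv : u = v
      · exact Or.inl huv
      obtain ⟨x, hx, hxv, j, rfl⟩ := hcut u huv hu p (hp.trans hR)
      refine Or.inr (Set.mem_iUnion.2 ⟨j, hu, p.dropUntil _ hx, ?_⟩)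
      have h1 := congrArg SimpleGraph.Walk.length (p.take_spec hx)
      rw [SimpleGraph.Walk.length_append] at h1
      have h2 : (p.takeUntil _ hx).length ≠ 0 := fun h =>
        hxv (SimpleGraph.Walk.eq_of_length_eq_zero h).symm
      omega
    refine (Set.encard_le_encard hsub).trans ((Set.encard_union_le _ _).trans ?_)
    have hU : (⋃ j, {u | HasRank A r M d u ∧ Within A.G R (F j) u}).encard ≤
        (M * ((M + 1) ^ R * (R + 1)) : ℕ) := by
      have : ∀ s : Finset (Fin M), (⋃ j ∈ s, {u | HasRank A r M d u ∧ Within A.G R (F j) u}).encard ≤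
          (s.card * ((M + 1) ^ R * (R + 1)) : ℕ) := by
        intro s
        induction s using Finset.induction with
        | empty => simp
        | insert j s hj ih' =>
          rw [Finset.set_biUnion_insert, Finset.card_insert_of_notMem hj, Nat.succ_mul, add_comm]
          push_cast
          refine (Set.encard_union_le _ _).trans (add_le_add ?_ ?_)
          · exact_mod_cast ih (by omega) (hF j)
          · exact_mod_cast ih'
      simpa using this Finset.univ
    rw [Set.encard_singleton]
    refine (add_le_add_right hU 1).trans ?_
    norm_cast
    have h1 : 1 ≤ (M + 1) ^ R := Nat.one_le_pow _ _ (by omega)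
    rw [pow_succ]
    nlinarith

/-- Deleting the edges at the vertices of the tuple `s`, and recording them by means of colors. -/
def ColoredGraph.isolate (A : ColoredGraph V κ) {S : ℕ} (s : Fin S → V) :
    ColoredGraph V (κ × (Fin S → Prop) × (Fin S → Prop)) where
  G := { Adj := fun x y => A.G.Adj x y ∧ (∀ j, x ≠ s j) ∧ ∀ j, y ≠ s j
         symm := ⟨fun _ _ h => ⟨h.1.symm, h.2.2, h.2.1⟩⟩
         loopless := ⟨fun _ h => h.1.ne rfl⟩ }
  D := A.D
  col x := (A.col x, fun j => x = s j, fun j => A.G.Adj x (s j))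
  mem_of_adj h := A.mem_of_adj h.1

theorem ColoredGraph.isolate_le (A : ColoredGraph V κ) {S : ℕ} (s : Fin S → V) :
    (A.isolate s).G ≤ A.G := fun _ _ h => h.1

/-- The new colors retain the deleted edges, so a strategy on the isolated graphs is also one on the
original graphs. -/
theorem ColoredGraph.isolate_adj_iff {S : ℕ} (s : Fin S → V) (x y : V) :
    A.G.Adj x y ↔ (A.isolate s).G.Adj x y ∨ (∃ j, ((A.isolate s).col x).2.1 j ∧
      ((A.isolate s).col y).2.2 j) ∨
      ∃ j, ((A.isolate s).col y).2.1 j ∧ ((A.isolate s).col x).2.2 j := by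
  simp only [ColoredGraph.isolate]
  constructor
  · intro h
    by_cases hx : ∃ j, x = s j
    · obtain ⟨j, rfl⟩ := hx
      exact Or.inr (Or.inl ⟨j, rfl, h.symm⟩)
    by_cases hy : ∃ j, y = s j
    · obtain ⟨j, rfl⟩ := hy
      exact Or.inr (Or.inr ⟨j, rfl, h⟩)
    push Not at hx hy
    exact Or.inl ⟨h, hx, hy⟩
  · rintro (h | ⟨j, rfl, h⟩ | ⟨j, rfl, h⟩)
    · exact h.1
    · exact h.symm
    · exact h

theorem BlockEquiv.of_isolate {S k : ℕ} {s : Fin S → V} {s' : Fin S → W}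
    (h : BlockEquiv N (A.isolate s) (B.isolate s') k a b) : BlockEquiv N A B k a b := by
  refine BlockEquiv.of_atom (A := A.isolate s) (B := B.isolate s')
    (A' := A) (B' := B) rfl rfl (fun x y e => ⟨fun i j => ⟨(e.1 i j).1, ?_⟩, fun i => congrArg Prod.fst (e.2 i)⟩) h
  rw [ColoredGraph.isolate_adj_iff s, ColoredGraph.isolate_adj_iff s', (e.1 i j).2, e.2 i, e.2 j]

/-- The isolated ball is interpreted by means of the tuple `a` and the vertices `s`; one round
evaluates membership in the ball. -/
theorem BlockEquiv.isolate_ball {R S k : ℕ} {s : Fin S → V} {s' : Fin S → W}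
    (ha : ∀ i, a i ∈ A.D) (hb : ∀ i, b i ∈ B.D) (hR : R + 1 ≤ N)
    (h : BlockEquiv N A B (k + 1) (Sum.elim a s) (Sum.elim b s')) :
    BlockEquiv N ((A.ball R a).isolate s) ((B.ball R b).isolate s') k a b := by
  refine BlockEquiv.interpret (A := A) (B := B) (A' := (A.ball R a).isolate s)
    (B' := (B.ball R b).isolate s') (a := Sum.elim a s) (b := Sum.elim b s')
    (ColoredGraph.ball_subset ha) (ColoredGraph.ball_subset hb) ?_ ?_
  · intro J x y e
    have mem : ∀ j, (∃ i, Within A.G R (a i) (Sum.elim (Sum.elim a s) x j)) ↔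
        ∃ i, Within B.G R (b i) (Sum.elim (Sum.elim b s') y j) := fun j =>
      exists_congr fun i => e.within_iff (i := Sum.inl (Sum.inl i)) hR (ha i) (hb i)
    have adj : ∀ i j, (A.ball R a).G.Adj (Sum.elim (Sum.elim a s) x i)
        (Sum.elim (Sum.elim a s) x j) ↔ (B.ball R b).G.Adj (Sum.elim (Sum.elim b s') y i)
          (Sum.elim (Sum.elim b s') y j) := fun i j =>
      and_congr (e.atom.1 i j).2 (and_congr (mem i) (mem j))
    have eq : ∀ i j, x i = s j ↔ y i = s' j := fun i j =>
      (e.atom.1 (Sum.inr i) (Sum.inl (Sum.inr j))).1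
    refine ⟨⟨fun i j => ⟨(e.atom.1 (Sum.inr i) (Sum.inr j)).1, ?_⟩, fun i => ?_⟩,
      fun j => mem (Sum.inr j)⟩
    · exact and_congr (adj (Sum.inr i) (Sum.inr j)) (and_congr
        (forall_congr' fun l => not_congr (eq i l)) (forall_congr' fun l => not_congr (eq j l)))
    · refine Prod.ext (e.atom.2 (Sum.inr i)) (Prod.ext ?_ ?_)
      · funext j
        exact propext (eq i j)
      · funext j
        exact propext (adj (Sum.inr i) (Sum.inl (Sum.inr j)))
  · have := h.comp (Sum.elim id Sum.inl : (ι ⊕ Fin S) ⊕ ι → ι ⊕ Fin S)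
    convert this using 1 <;> ext ((i | i) | i) <;> rfl

/-- In edgeless graphs, one round with large blocks determines the usual game. -/
theorem BlockEquiv.of_edgeless (q : ℕ) (hA : ∀ v ∈ A.D, ¬ HasRank A r M 0 v)
    (hB : ∀ v ∈ B.D, ¬ HasRank B r M 0 v) (ha : ∀ i, a i ∈ A.D) (hb : ∀ i, b i ∈ B.D)
    (h : BlockEquiv q A B 1 a b) : BlockEquiv 1 A B q a b := by
  classical
  have nA : ∀ x y, ¬ A.G.Adj x y := fun x y e => hA x (A.mem_of_adj e) ⟨y, e⟩
  have nB : ∀ x y, ¬ B.G.Adj x y := fun x y e => hB x (B.mem_of_adj e) ⟨y, e⟩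
  clear hA hB
  -- Any answer `c'` of the right atomic type is good. The block consisting of `c` and `d` has an
  -- answer `z`, and the transposition of `c'` with the first entry of `z` is a color-preserving
  -- automorphism of the edgeless graph that fixes `b`.
  have oneSide : ∀ {V W : Type} {A : ColoredGraph V κ} {B : ColoredGraph W κ} {ι : Type}
      {a : ι → V} {b : ι → W} (q : ℕ), (∀ x y, ¬ A.G.Adj x y) → (∀ x y, ¬ B.G.Adj x y) →
      BlockEquiv (q + 1) A B 1 a b → ∀ (c : Fin 1 → V) (c' : Fin 1 → W), (∀ j, c j ∈ A.D) →
      (∀ j, c' j ∈ B.D) → AtomEquiv A B (Sum.elim a c) (Sum.elim b c') →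
      ∀ d : Fin q → V, (∀ j, d j ∈ A.D) → ∃ d' : Fin q → W, (∀ j, d' j ∈ B.D) ∧
        AtomEquiv A B (Sum.elim (Sum.elim a c) d) (Sum.elim (Sum.elim b c') d') := by
    intro V W A B ι a b q nA nB h c c' hc hc' e d hd
    obtain ⟨z, hz, e'⟩ := h.forth (β := Fin 1 ⊕ Fin q) (by simp; omega) (Sum.elim c d)
      (Sum.forall.2 ⟨hc, hd⟩)
    have hcol : B.col (c' 0) = B.col (z (Sum.inl 0)) :=
      (e.2 (Sum.inr 0)).symm.trans (e'.2 (Sum.inr (Sum.inl 0)))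
    have fixed : ∀ i, Equiv.swap (c' 0) (z (Sum.inl 0)) (b i) = b i := by
      intro i
      have h1 := (e.1 (Sum.inl i) (Sum.inr 0)).1
      have h2 := (e'.1 (Sum.inl i) (Sum.inr (Sum.inl 0))).1
      simp only [Sum.elim_inl, Sum.elim_inr] at h1 h2
      by_cases hi : a i = c 0
      · rw [← h1.1 hi, ← h2.1 hi, Equiv.swap_self]; rfl
      · exact Equiv.swap_apply_of_ne_of_ne (fun h => hi (h1.2 h)) (fun h => hi (h2.2 h))
    have hcolS : ∀ x, B.col (Equiv.swap (c' 0) (z (Sum.inl 0)) x) = B.col x := by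
      intro x
      rw [Equiv.swap_apply_def]
      split_ifs with h1 h2
      · rw [h1, hcol]
      · rw [h2, hcol]
      · rfl
    refine ⟨fun j => Equiv.swap (c' 0) (z (Sum.inl 0)) (z (Sum.inr j)), fun j => ?_, ?_⟩
    · dsimp only
      rw [Equiv.swap_apply_def]
      split_ifs
      · exact hz _
      · exact hc' _
      · exact hz _
    · have e'' := e'.comp (Sum.elim (Sum.map id Sum.inl) (Sum.inr ∘ Sum.inr) :
        (ι ⊕ Fin 1) ⊕ Fin q → ι ⊕ (Fin 1 ⊕ Fin q))
      have hy : (Sum.elim (Sum.elim b c')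
          (fun j => Equiv.swap (c' 0) (z (Sum.inl 0)) (z (Sum.inr j)))) =
          Equiv.swap (c' 0) (z (Sum.inl 0)) ∘ (Sum.elim b z ∘
            (Sum.elim (Sum.map id Sum.inl) (Sum.inr ∘ Sum.inr) :
              (ι ⊕ Fin 1) ⊕ Fin q → ι ⊕ (Fin 1 ⊕ Fin q))) := by
        ext ((i | i) | i)
        · simp [fixed]
        · rw [Subsingleton.elim i 0]; simp
        · simp
      have hx : (Sum.elim (Sum.elim a c) d) = Sum.elim a (Sum.elim c d) ∘
            (Sum.elim (Sum.map id Sum.inl) (Sum.inr ∘ Sum.inr) :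
              (ι ⊕ Fin 1) ⊕ Fin q → ι ⊕ (Fin 1 ⊕ Fin q)) := by
        ext ((i | i) | i) <;> rfl
      rw [hx, hy]
      refine ⟨fun i j => ⟨?_, iff_of_false (nA _ _) (nB _ _)⟩, fun i => ?_⟩
      · rw [(e''.1 i j).1]
        simp only [Function.comp_apply, EmbeddingLike.apply_eq_iff_eq]
      · rw [e''.2 i]; exact (hcolS _).symm
  induction q generalizing ι with
  | zero => exact h.atom
  | succ q ih =>
    refine ⟨h.1, fun c hc => ?_, fun c' hc' => ?_⟩
    · obtain ⟨c', hc', e⟩ := h.forth (β := Fin 1) (by simp) c hc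
      refine ⟨c', hc', ih (Sum.forall.2 ⟨ha, hc⟩) (Sum.forall.2 ⟨hb, hc'⟩)
        ⟨e, oneSide q nA nB h c c' hc hc' e, fun d hd => ?_⟩⟩
      obtain ⟨d', hd', e'⟩ := oneSide q nB nA h.symm c' c hc' hc e.symm d hd
      exact ⟨d', hd', AtomEquiv.symm e'⟩
    · obtain ⟨c, hc, e⟩ := h.back (β := Fin 1) (by simp) c' hc'
      refine ⟨c, hc, ih (Sum.forall.2 ⟨ha, hc⟩) (Sum.forall.2 ⟨hb, hc'⟩)
        ⟨e, oneSide q nA nB h c c' hc hc' e, fun d hd => ?_⟩⟩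
      obtain ⟨d', hd', e'⟩ := oneSide q nB nA h.symm c' c hc' hc e.symm d hd
      exact ⟨d', hd', AtomEquiv.symm e'⟩

end

end TreeRank

/-! ### The induction on the rank -/

namespace TreeRank

variable {V W κ : Type}

/-- Moves and separating sets are tuples of fixed length, so smaller sets are listed with
repetitions. A vertex of `D` is needed for this only if `S` is empty and `n` is not zero. -/
theorem exists_fin_cover {S D : Set V} {n : ℕ} (hS : S.encard ≤ n) (hSD : S ⊆ D)
    (hD : D.Nonempty ∨ n = 0) : ∃ s : Fin n → V, (∀ j, s j ∈ D) ∧ ∀ x ∈ S, ∃ j, x = s j := by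
  classical
  have hfin : S.Finite := Set.finite_of_encard_le_coe hS
  rcases S.eq_empty_or_nonempty with rfl | hne
  · rcases hD with ⟨x, hx⟩ | rfl
    · exact ⟨fun _ => x, fun _ => hx, fun _ h => h.elim⟩
    · exact ⟨isEmptyElim, isEmptyElim, fun _ h => h.elim⟩
  · obtain ⟨x₀, hx₀⟩ := hne
    have := hfin.fintype
    have hcard : Fintype.card S ≤ Fintype.card (Fin n) := by
      rw [Fintype.card_fin]
      rw [← Set.coe_fintypeCard] at hS
      exact_mod_cast hS
    obtain ⟨g⟩ := Function.Embedding.nonempty_of_card_le hcard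
    have : Nonempty S := ⟨⟨x₀, hx₀⟩⟩
    refine ⟨fun j => (Function.invFun g j : S), fun j => hSD (Function.invFun g j).2, fun x hx => ?_⟩
    exact ⟨g ⟨x, hx⟩,
      (congrArg Subtype.val (Function.leftInverse_invFun g.injective ⟨x, hx⟩)).symm⟩

/-- Local games on graphs without vertices of rank `d + 1` reduce to games on graphs without
vertices of rank `d`. -/
theorem exists_localEquiv {d k : ℕ} (hk : 2 * d + 2 ≤ k)
    (ih : ∀ q t : ℕ, ∃ r : ℕ, ∀ M : ℕ, ∃ N : ℕ, ∀ {κ V W ι : Type} [Fintype ι]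
      (A : ColoredGraph V κ) (B : ColoredGraph W κ) (a : ι → V) (b : ι → W), Fintype.card ι = t →
      (∀ i, a i ∈ A.D) → (∀ i, b i ∈ B.D) → (∀ v ∈ A.D, ¬ HasRank A r M d v) →
      (∀ v ∈ B.D, ¬ HasRank B r M d v) → BlockEquiv N A B k a b → BlockEquiv 1 A B q a b)
    (R q t : ℕ) : ∃ r₀ : ℕ, ∀ r ≥ r₀, ∀ M : ℕ, ∃ N₀ : ℕ, ∀ N ≥ N₀, ∀ {κ V W ι : Type} [Fintype ι]
      (A : ColoredGraph V κ) (B : ColoredGraph W κ) (a : ι → V) (b : ι → W), Fintype.card ι = t →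
      (∀ i, a i ∈ A.D) → (∀ i, b i ∈ B.D) → (∀ v ∈ A.D, ¬ HasRank A r M (d + 1) v) →
      BlockEquiv N A B (k + 2) a b → LocalEquiv R q A B a b := by
  obtain ⟨r₁, hr₁⟩ := ih q t
  -- The radius has to be at least `r₁`, for ranks in the ball to be ranks in `A`, and at least `R`,
  -- for the count of vertices of rank d in the ball.
  refine ⟨r₁ + R, fun r hr M => ?_⟩
  obtain ⟨N₁, hN₁⟩ := hr₁ M
  obtain ⟨S, hS⟩ : ∃ S : ℕ, S = t * ((M + 1) ^ R * (R + 1)) := ⟨_, rfl⟩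
  refine ⟨N₁ + R + S + r₁ + M + 1, fun N hN κ V W ι _ A B a b ht ha hb hA h => ?_⟩
  have hcov : {v | v ∈ (A.ball R a).D ∧ HasRank (A.ball R a) r₁ M d v}.encard ≤ (S : ℕ) := by
    have hsub : {v | v ∈ (A.ball R a).D ∧ HasRank (A.ball R a) r₁ M d v} ⊆
        ⋃ i, {u | HasRank A r M d u ∧ Within A.G R (a i) u} := by
      rintro v ⟨⟨i, hi⟩, hv⟩
      exact Set.mem_iUnion.2 ⟨i, hv.mono (A.ball_le R a) (by omega) ⟨i, hi⟩, hi⟩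
    refine (Set.encard_le_encard hsub).trans ?_
    classical
    have : ∀ s : Finset ι, (⋃ i ∈ s, {u | HasRank A r M d u ∧ Within A.G R (a i) u}).encard ≤
        (s.card * ((M + 1) ^ R * (R + 1)) : ℕ) := by
      intro s
      induction s using Finset.induction with
      | empty => simp
      | insert j s hj ih' =>
        rw [Finset.set_biUnion_insert, Finset.card_insert_of_notMem hj, Nat.succ_mul, add_comm]
        push_cast
        refine (Set.encard_union_le _ _).trans (add_le_add ?_ ?_)
        · exact_mod_cast encard_rank_le hA R (by omega) (ha j)
        · exact_mod_cast ih'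
    have := this Finset.univ
    rw [Finset.card_univ, ht, ← hS] at this
    simpa using this
  obtain ⟨s, hsD, hs⟩ := exists_fin_cover hcov (fun v hv => hv.1) (by
    rcases isEmpty_or_nonempty ι with hι | ⟨⟨i⟩⟩
    · right
      rw [hS, ← ht, Fintype.card_eq_zero, zero_mul]
    · exact Or.inl ⟨a i, A.mem_ball_self R a i⟩)
  obtain ⟨s', hs'D, e⟩ := h.forth (β := Fin S) (by simp; omega) s
    (fun j => ColoredGraph.ball_subset ha (hsD j))
  have e₂ := BlockEquiv.isolate_ball (R := R) ha hb (by omega) e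
  have noA : ∀ v ∈ ((A.ball R a).isolate s).D, ¬ HasRank ((A.ball R a).isolate s) r₁ M d v := by
    -- A vertex of rank d after isolation had rank d before, so it is one of the isolated vertices;
    -- but those have no neighbors left.
    intro v hv hrank
    obtain ⟨j, hj⟩ := hs v ⟨hv, hrank.mono (A := A.ball R a) ((A.ball R a).isolate_le s) le_rfl hv⟩
    obtain ⟨w, hw⟩ := hrank.exists_adj hv
    exact hw.2.1 j hj
  refine BlockEquiv.of_isolate (s := s) (s' := s') (hN₁ _ _ a b ht (A.mem_ball_self R a)
    (B.mem_ball_self R b) noA ?_ (e₂.mono_block (by omega)))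
  intro v hv hrank
  -- `B` has no bound on its ranks of its own. A vertex of rank d is moved to the other side in one
  -- round, and 2d + 1 further rounds transfer its rank; this is the reason for `hk`.
  obtain ⟨c, hc, e₃⟩ := (e₂.mono_rounds hk).back (k := 2 * d + 1) (β := Fin 1) (by simp; omega)
    (fun _ => v) (fun _ => hv)
  exact noA _ (hc 0) (e₃.symm.hasRank (j := Sum.inr 0) (by omega) (by omega) hv hrank)

/-- The order of the quantifiers matters: `k` depends on `d` only, and `r` precedes `M` because the
size of the forbidden tree, which determines `M`, depends on the radius. The colors are arbitrary
since the induction enriches them. -/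
theorem exists_rounds (d : ℕ) : ∃ k, 2 * d + 2 ≤ k ∧ ∀ q t : ℕ, ∃ r : ℕ, ∀ M : ℕ, ∃ N : ℕ,
    ∀ {κ V W ι : Type} [Fintype ι]
      (A : ColoredGraph V κ) (B : ColoredGraph W κ) (a : ι → V) (b : ι → W), Fintype.card ι = t →
      (∀ i, a i ∈ A.D) → (∀ i, b i ∈ B.D) → (∀ v ∈ A.D, ¬ HasRank A r M d v) →
      (∀ v ∈ B.D, ¬ HasRank B r M d v) → BlockEquiv N A B k a b → BlockEquiv 1 A B q a b := by
  induction d with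
  | zero =>
    exact ⟨2, le_rfl, fun q t => ⟨0, fun M => ⟨q, fun A B a b _ ha hb hA hB h =>
      BlockEquiv.of_edgeless q hA hB ha hb (h.mono_rounds (by omega))⟩⟩⟩
  | succ d ih =>
    obtain ⟨k, hk, ih⟩ := ih
    -- One round plays a scattered tuple, one names the vertices of rank d in the balls, and one
    -- evaluates the balls.
    refine ⟨k + 3, by omega, fun q t => ?_⟩
    obtain ⟨R, K, P, hloc⟩ := exists_locality q t
    obtain ⟨r₁, hr₁⟩ := exists_localEquiv hk ih R K t
    choose f hf using fun ρ q' => exists_localEquiv hk ih ρ q' 1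
    have le_sum : ∀ (g : ℕ → ℕ → ℕ) {i j : ℕ}, i ≤ P → j ≤ P →
        g i j ≤ ∑ i ∈ Finset.range (P + 1), ∑ j ∈ Finset.range (P + 1), g i j := by
      intro g i j hi hj
      refine le_trans ?_ (Finset.single_le_sum (fun _ _ => Nat.zero_le _)
        (Finset.mem_range.2 (Nat.lt_succ_of_le hi)))
      exact Finset.single_le_sum (f := fun j => g i j) (fun _ _ => Nat.zero_le _)
        (Finset.mem_range.2 (Nat.lt_succ_of_le hj))
    obtain ⟨r₂, hr₂⟩ : ∃ r₂, ∀ i ≤ P, ∀ j ≤ P, f i j ≤ r₂ := ⟨_, fun i hi j hj => le_sum f hi hj⟩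
    refine ⟨r₁ + r₂, fun M => ?_⟩
    obtain ⟨N₁, hN₁⟩ := hr₁ (r₁ + r₂) (by omega) M
    -- Scattered tuples involve all radii and numbers of rounds up to `P`. The block sizes are made
    -- a total function, so that one bound serves all these pairs.
    have : ∀ i j, ∃ N₀ : ℕ, i ≤ P → j ≤ P → ∀ N ≥ N₀, ∀ {κ V W ι : Type} [Fintype ι]
      (A : ColoredGraph V κ) (B : ColoredGraph W κ) (a : ι → V) (b : ι → W), Fintype.card ι = 1 →
      (∀ i, a i ∈ A.D) → (∀ i, b i ∈ B.D) → (∀ v ∈ A.D, ¬ HasRank A (r₁ + r₂) M (d + 1) v) →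
      BlockEquiv N A B (k + 2) a b → LocalEquiv i j A B a b := by
      intro i j
      by_cases hij : i ≤ P ∧ j ≤ P
      · obtain ⟨N₀, hN₀⟩ := hf i j (r₁ + r₂) ((hr₂ i hij.1 j hij.2).trans (by omega)) M
        exact ⟨N₀, fun _ _ => hN₀⟩
      · exact ⟨0, fun h h' => (hij ⟨h, h'⟩).elim⟩
    choose g hg using this
    obtain ⟨N₂, hN₂⟩ : ∃ N₂, ∀ i ≤ P, ∀ j ≤ P, g i j ≤ N₂ := ⟨_, fun i hi j hj => le_sum g hi hj⟩
    refine ⟨N₁ + N₂ + P + 1, fun {κ V W ι} _ A B a b ht ha hb hA hB h => ?_⟩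
    have scat : ∀ {V W : Type} (A : ColoredGraph V κ) (B : ColoredGraph W κ) (a : ι → V)
        (b : ι → W), (∀ v ∈ A.D, ¬ HasRank A (r₁ + r₂) M (d + 1) v) →
        BlockEquiv (N₁ + N₂ + P + 1) A B (k + 3) a b → Scattered P A B := by
      intro V W A B a b hA h ρ hρ q' hq' l hl y hy
      obtain ⟨y', hy', e⟩ := h.forth (β := Fin l) (by simp; omega) y hy
      refine ⟨y', hy', fun n hn i j => ?_, fun i => ?_⟩
      · exact e.within_iff (i := Sum.inr i) (j := Sum.inr j) (by omega) (hy i) (hy' i)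
      · exact hg ρ q' hρ hq' _ ((hN₂ ρ hρ q' hq').trans (by omega)) A B _ _ (by simp)
          (fun _ => hy i) (fun _ => hy' i) hA (e.comp (fun _ : Fin 1 => Sum.inr i))
    exact hloc A B a b ht ha hb
      (hN₁ _ (by omega) A B a b ht ha hb hA (h.mono_rounds (by omega)))
      (scat A B a b hA h) (scat B A b a hB h.symm)

end TreeRank

namespace TreeRank

open FirstOrder FirstOrder.Language

/-! ### Formulas of bounded alternation rank -/

section Alternation

variable {L : Language} {α : Type} {n : ℕ}

theorem alternations_le_ex_cons (w : List Quantifier) :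
    alternations w ≤ alternations (.ex :: w) := by
  rcases w with _ | ⟨_ | _, w⟩ <;> simp [alternations]

theorem alternations_ex_cons_le (w : List Quantifier) :
    alternations (.ex :: w) ≤ alternations w + 1 := by
  rcases w with _ | ⟨_ | _, w⟩ <;> simp [alternations]

/-- Exchange of the two quantifiers. -/
def Quantifier.flip : Quantifier → Quantifier
  | .all => .ex
  | .ex => .all

theorem alternations_map_flip (w : List Quantifier) :
    alternations (w.map Quantifier.flip) = alternations w := by
  induction w with
  | nil => rfl
  | cons a w ih =>
    rcases w with _ | ⟨_ | _, w⟩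
    · cases a <;> rfl
    · cases a <;> simpa [alternations, Quantifier.flip] using ih
    · cases a <;> simpa [alternations, Quantifier.flip] using ih

theorem branchWords_not (b : Bool) (φ : L.BoundedFormula α n) :
    branchWords (!b) φ = (branchWords b φ).map (List.map Quantifier.flip) := by
  induction φ generalizing b with
  | falsum => simp [branchWords]
  | equal => simp [branchWords]
  | rel => simp [branchWords]
  | imp φ ψ ih₁ ih₂ =>
    have hinv : Quantifier.flip ∘ Quantifier.flip = id := by funext a; cases a <;> rfl
    simp [branchWords, ih₁, ih₂, hinv]
  | all φ ih =>
    cases b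
    · have := ih false
      simp only [Bool.not_false] at this
      simp [branchWords, this, Quantifier.flip, Function.comp_def]
    · have := ih true
      simp only [Bool.not_true] at this
      simp [branchWords, this, Quantifier.flip, Function.comp_def]

/-- All branches of the negation normal form of `φ` (or `¬ φ`) have at most `k` alternations. -/
def AltLe (k : ℕ) (b : Bool) (φ : L.BoundedFormula α n) : Prop :=
  ∀ w ∈ branchWords b φ, alternations w ≤ k

theorem alternationRank_le_iff {k : ℕ} {φ : L.BoundedFormula α n} :
    alternationRank φ ≤ k ↔ AltLe k true φ := by
  have : ∀ l : List ℕ, l.foldr max 0 ≤ k ↔ ∀ x ∈ l, x ≤ k := by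
    intro l
    induction l with
    | nil => simp
    | cons a l ih => simp [ih]
  simp [alternationRank, this, AltLe]

theorem AltLe.flip {k : ℕ} {φ : L.BoundedFormula α n} {b b' : Bool} (h : AltLe k b φ) :
    AltLe k b' φ := by
  rcases Bool.eq_or_eq_not b' b with rfl | rfl
  · exact h
  · intro w hw
    rw [branchWords_not, List.mem_map] at hw
    obtain ⟨w, hw, rfl⟩ := hw
    rw [alternations_map_flip]
    exact h w hw

theorem AltLe.bot {k : ℕ} {b : Bool} : AltLe k b (⊥ : L.BoundedFormula α n) := by
  intro w hw
  have : w = [] := by simpa [Bot.bot, branchWords] using hw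
  simp [this, alternations]

theorem AltLe.imp {k : ℕ} {b : Bool} {φ ψ : L.BoundedFormula α n} (h : AltLe k b φ)
    (h' : AltLe k b ψ) : AltLe k b (φ.imp ψ) := by
  intro w hw
  have : w ∈ branchWords (!b) φ ++ branchWords b ψ := by cases b <;> exact hw
  rcases List.mem_append.1 this with hw | hw
  · exact h.flip w hw
  · exact h' w hw

theorem AltLe.iInf {k : ℕ} {b : Bool} {β : Type} [Finite β] {f : β → L.BoundedFormula α n}
    (h : ∀ i, AltLe k b (f i)) : AltLe k b (BoundedFormula.iInf f) := by
  have : ∀ l : List (L.BoundedFormula α n), (∀ φ ∈ l, AltLe k b φ) →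
      AltLe k b (l.foldr (· ⊓ ·) ⊤) := by
    intro l hl
    induction l with
    | nil => exact AltLe.imp AltLe.bot AltLe.bot
    | cons φ l ih =>
      rw [List.forall_mem_cons] at hl
      exact AltLe.imp (AltLe.imp hl.1 (AltLe.imp (ih hl.2) AltLe.bot)) AltLe.bot
  refine this _ fun φ hφ => ?_
  obtain ⟨i, -, rfl⟩ := List.mem_map.1 hφ
  exact h i

theorem AltLe.iSup {k : ℕ} {b : Bool} {β : Type} [Finite β] {f : β → L.BoundedFormula α n}
    (h : ∀ i, AltLe k b (f i)) : AltLe k b (BoundedFormula.iSup f) := by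
  have : ∀ l : List (L.BoundedFormula α n), (∀ φ ∈ l, AltLe k b φ) →
      AltLe k b (l.foldr (· ⊔ ·) ⊥) := by
    intro l hl
    induction l with
    | nil => exact AltLe.bot
    | cons φ l ih =>
      rw [List.forall_mem_cons] at hl
      exact AltLe.imp (AltLe.imp hl.1 AltLe.bot) (ih hl.2)
  refine this _ fun φ hφ => ?_
  obtain ⟨i, -, rfl⟩ := List.mem_map.1 hφ
  exact h i

/-- A block of existential quantifiers. -/
def exBlock : ∀ (N : ℕ) {n : ℕ}, L.BoundedFormula α (n + N) → L.BoundedFormula α n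
  | 0, _, φ => φ
  | N + 1, _, φ => exBlock N φ.ex

/-- The induction bounds the words with an additional leading ∃, which is unaffected by further
existential quantifiers; thus a whole block costs one alternation. -/
theorem AltLe.exBlock {k N : ℕ} {φ : L.BoundedFormula α (n + N)} (h : AltLe k true φ) :
    AltLe (k + 1) true (exBlock N φ) := by
  have key : ∀ (N : ℕ) {n : ℕ} (φ : L.BoundedFormula α (n + N)),
      (∀ w ∈ branchWords true φ, alternations (.ex :: w) ≤ k + 1) →
      ∀ w ∈ branchWords true (TreeRank.exBlock N φ), alternations (.ex :: w) ≤ k + 1 := by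
    intro N
    induction N with
    | zero => exact fun φ h => h
    | succ N ih =>
      intro n φ h
      refine ih (n := n) φ.ex ?_
      intro w hw
      -- The last two words stem from the two copies of ⊥ in the encoding of ∃ as ¬∀¬.
      have : (∃ v ∈ branchWords true φ, w = .ex :: v) ∨ w = [.ex] ∨ w = [] := by
        simp only [BoundedFormula.not, branchWords, Bot.bot] at hw
        simp only [Bool.not_true, Bool.not_false, List.map_append, List.mem_append, List.mem_map,
          branchWords, List.map_cons, List.map_nil, List.mem_singleton] at hw
        rcases hw with (⟨v, hv, rfl⟩ | hw) | hw
        · exact Or.inl ⟨v, hv, rfl⟩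
        · exact Or.inr (Or.inl hw)
        · exact Or.inr (Or.inr hw)
      rcases this with ⟨v, hv, rfl⟩ | rfl | rfl
      · simpa [alternations] using h v hv
      · simp [alternations]
      · simp [alternations]
  exact fun w hw => (alternations_le_ex_cons w).trans (key N φ (fun w hw =>
    (alternations_ex_cons_le w).trans (Nat.add_le_add_right (h w hw) 1)) w hw)

/-- The quantifier depth. -/
def quantifierDepth : ∀ {n : ℕ}, L.BoundedFormula α n → ℕ
  | _, .falsum => 0
  | _, .equal _ _ => 0
  | _, .rel _ _ => 0
  | _, .imp φ ψ => max (quantifierDepth φ) (quantifierDepth ψ)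
  | _, .all φ => quantifierDepth φ + 1

end Alternation

/-! ### Satisfaction in graphs and formulas that determine block games -/

section Satisfaction

variable {V W α : Type} {n : ℕ} {G : SimpleGraph V} {H : SimpleGraph W}

/-- Satisfaction of a formula in a graph. -/
def Sat (G : SimpleGraph V) (φ : Language.graph.BoundedFormula α n) (v : α → V) (xs : Fin n → V) :
    Prop :=
  letI := G.structure
  φ.Realize v xs

variable {φ ψ : Language.graph.BoundedFormula α n} {v : α → V} {xs : Fin n → V}

theorem sat_imp : Sat G (φ.imp ψ) v xs ↔ (Sat G φ v xs → Sat G ψ v xs) := Iff.rfl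

theorem sat_not : Sat G φ.not v xs ↔ ¬ Sat G φ v xs := Iff.rfl

theorem sat_all {φ : Language.graph.BoundedFormula α (n + 1)} :
    Sat G φ.all v xs ↔ ∀ x, Sat G φ v (Fin.snoc xs x) := Iff.rfl

theorem sat_ex {φ : Language.graph.BoundedFormula α (n + 1)} :
    Sat G φ.ex v xs ↔ ∃ x, Sat G φ v (Fin.snoc xs x) :=
  letI := G.structure
  BoundedFormula.realize_ex

theorem sat_iInf {β : Type} [Finite β] {f : β → Language.graph.BoundedFormula α n} :
    Sat G (BoundedFormula.iInf f) v xs ↔ ∀ i, Sat G (f i) v xs :=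
  letI := G.structure
  BoundedFormula.realize_iInf

theorem sat_iSup {β : Type} [Finite β] {f : β → Language.graph.BoundedFormula α n} :
    Sat G (BoundedFormula.iSup f) v xs ↔ ∃ i, Sat G (f i) v xs :=
  letI := G.structure
  BoundedFormula.realize_iSup

theorem sat_exBlock {N : ℕ} {φ : Language.graph.BoundedFormula α (n + N)} :
    Sat G (exBlock N φ) v xs ↔ ∃ c : Fin N → V, Sat G φ v (Fin.append xs c) := by
  induction N with
  | zero =>
    simp only [exBlock]
    refine ⟨fun h => ⟨isEmptyElim, ?_⟩, fun ⟨c, h⟩ => ?_⟩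
    · rwa [Fin.append_right_nil _ _ rfl]
    · rwa [Fin.append_right_nil _ _ rfl] at h
  | succ N ih =>
    simp only [exBlock]
    rw [ih]
    simp only [sat_ex]
    refine ⟨fun ⟨c, x, h⟩ => ⟨Fin.snoc c x, ?_⟩, fun ⟨c, h⟩ =>
      ⟨Fin.init c, c (Fin.last N), ?_⟩⟩
    · rw [Fin.append_snoc]; exact h
    · rw [← Fin.append_snoc, Fin.snoc_init_self]; exact h

theorem term_eq_var (t : Language.graph.Term (α ⊕ Fin n)) : ∃ i, t = Term.var i := by
  cases t with
  | var i => exact ⟨i, rfl⟩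
  | func f _ => exact f.elim

theorem sat_equal (i j : α ⊕ Fin n) :
    Sat G (.equal (Term.var i) (Term.var j)) v xs ↔ Sum.elim v xs i = Sum.elim v xs j := Iff.rfl

theorem sat_adj (ts : Fin 2 → Language.graph.Term (α ⊕ Fin n)) {i j : α ⊕ Fin n}
    (hi : ts 0 = Term.var i) (hj : ts 1 = Term.var j) :
    Sat G (.rel adj ts) v xs ↔ G.Adj (Sum.elim v xs i) (Sum.elim v xs j) := by
  change G.Adj (@Term.realize _ _ G.structure _ _ (ts 0)) (@Term.realize _ _ G.structure _ _ (ts 1))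
    ↔ _
  rw [hi, hj]
  rfl

/-- A graph, as a colored graph with a single color. -/
def uncolored (G : SimpleGraph V) : ColoredGraph V Unit where
  G := G
  D := Set.univ
  col _ := ()
  mem_of_adj _ := Set.mem_univ _

theorem BlockEquiv.sat_iff {q : ℕ} {v' : α → W} {xs' : Fin n → W}
    (h : BlockEquiv 1 (uncolored G) (uncolored H) q (Sum.elim v xs) (Sum.elim v' xs'))
    (hφ : quantifierDepth φ ≤ q) : Sat G φ v xs ↔ Sat H φ v' xs' := by
  induction φ generalizing q with
  | falsum => exact Iff.rfl
  | equal t₁ t₂ =>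
    obtain ⟨i, rfl⟩ := term_eq_var t₁
    obtain ⟨j, rfl⟩ := term_eq_var t₂
    exact (h.atom.1 i j).1
  | rel R ts =>
    cases R
    obtain ⟨i, hi⟩ := term_eq_var (ts 0)
    obtain ⟨j, hj⟩ := term_eq_var (ts 1)
    erw [sat_adj ts hi hj, sat_adj ts hi hj]
    exact (h.atom.1 i j).2
  | imp φ ψ ih₁ ih₂ =>
    simp only [quantifierDepth, max_le_iff] at hφ
    rw [sat_imp, sat_imp, ih₁ h hφ.1, ih₂ h hφ.2]
  | @all n φ ih =>
    obtain ⟨q, rfl⟩ : ∃ q', q = q' + 1 := ⟨q - 1, by simp only [quantifierDepth] at hφ; omega⟩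
    simp only [quantifierDepth, Nat.add_le_add_iff_right] at hφ
    have step : ∀ {x : V} {x' : W}, BlockEquiv 1 (uncolored G) (uncolored H) q
        (Sum.elim (Sum.elim v xs) (fun _ : Fin 1 => x))
        (Sum.elim (Sum.elim v' xs') (fun _ : Fin 1 => x')) →
        (Sat G φ v (Fin.snoc xs x) ↔ Sat H φ v' (Fin.snoc xs' x')) := by
      intro x x' e
      refine ih (q := q) ?_ hφ
      have := e.comp (Sum.elim (Sum.inl ∘ Sum.inl)
        (Fin.snoc (α := fun _ => (α ⊕ Fin n) ⊕ Fin 1) (Sum.inl ∘ Sum.inr) (Sum.inr 0)))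
      convert this using 1
      · ext (i | i)
        · rfl
        · refine Fin.lastCases ?_ (fun j => ?_) i <;> simp
      · ext (i | i)
        · rfl
        · refine Fin.lastCases ?_ (fun j => ?_) i <;> simp
    rw [sat_all, sat_all]
    constructor
    · intro hx x'
      obtain ⟨c, -, e⟩ := h.2.2 (fun _ => x') (fun _ => Set.mem_univ _)
      rw [show c = fun _ => c 0 from funext fun i => congrArg c (Subsingleton.elim i 0)] at e
      exact (step e).1 (hx _)
    · intro hx x
      obtain ⟨c, -, e⟩ := h.2.1 (fun _ => x) (fun _ => Set.mem_univ _)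
      rw [show c = fun _ => c 0 from funext fun i => congrArg c (Subsingleton.elim i 0)] at e
      exact (step e).2 (hx _)

/-- The conjunction of the formulas of a family, or of their negations. -/
noncomputable def signed {J : Type} [Finite J] (Φ : J → Language.graph.BoundedFormula α n)
    (s : Set J) : Language.graph.BoundedFormula α n :=
  open Classical in BoundedFormula.iInf fun j => if j ∈ s then Φ j else (Φ j).not

theorem sat_signed {J : Type} [Finite J] {Φ : J → Language.graph.BoundedFormula α n} {s : Set J} :
    Sat G (signed Φ s) v xs ↔ ∀ j, j ∈ s ↔ Sat G (Φ j) v xs := by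
  rw [signed, sat_iInf]
  refine forall_congr' fun j => ?_
  by_cases h : j ∈ s
  · simp [h]
  · rw [if_neg h, sat_not]; simp [h]

theorem AltLe.signed {J : Type} [Finite J] {Φ : J → Language.graph.BoundedFormula α n} {s : Set J}
    {k : ℕ} (h : ∀ j, AltLe k true (Φ j)) : AltLe k true (signed Φ s) := by
  classical
  refine AltLe.iInf fun j => ?_
  split_ifs
  · exact h j
  · exact AltLe.imp (h j) AltLe.bot

/-- The block game is determined by finitely many formulas of bounded alternation rank. -/
theorem exists_formulas (α : Type) [Finite α] (N k : ℕ) : ∀ n : ℕ,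
    ∃ (J : Type) (_ : Finite J) (Φ : J → Language.graph.BoundedFormula α n),
      (∀ j, AltLe k true (Φ j)) ∧ ∀ {V W : Type} (G : SimpleGraph V) (H : SimpleGraph W)
        (v : α → V) (xs : Fin n → V) (v' : α → W) (xs' : Fin n → W),
        (∀ j, Sat G (Φ j) v xs ↔ Sat H (Φ j) v' xs') →
        BlockEquiv N (uncolored G) (uncolored H) k (Sum.elim v xs) (Sum.elim v' xs') := by
  have atomic : ∀ (k n : ℕ), ∃ (J : Type) (_ : Finite J)
      (Φ : J → Language.graph.BoundedFormula α n),
      (∀ j, AltLe k true (Φ j)) ∧ ∀ {V W : Type} (G : SimpleGraph V) (H : SimpleGraph W)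
        (v : α → V) (xs : Fin n → V) (v' : α → W) (xs' : Fin n → W),
        (∀ j, Sat G (Φ j) v xs ↔ Sat H (Φ j) v' xs') →
        AtomEquiv (uncolored G) (uncolored H) (Sum.elim v xs) (Sum.elim v' xs') := by
    intro k n
    refine ⟨((α ⊕ Fin n) × (α ⊕ Fin n)) ⊕ ((α ⊕ Fin n) × (α ⊕ Fin n)), inferInstance,
      Sum.elim (fun p => .equal (Term.var p.1) (Term.var p.2))
        (fun p => .rel adj ![Term.var p.1, Term.var p.2]), ?_, ?_⟩
    · rintro (p | p) w hw
      · have : w = [] := by simpa [branchWords] using hw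
        simp [this, alternations]
      · have : w = [] := by simpa [branchWords] using hw
        simp [this, alternations]
    · intro V W G H v xs v' xs' h
      refine ⟨fun i j => ⟨h (Sum.inl (i, j)), ?_⟩, fun _ => rfl⟩
      have := h (Sum.inr (i, j))
      simp only [Sum.elim_inr] at this
      rw [sat_adj _ rfl rfl, sat_adj _ rfl rfl] at this
      exact this
  induction k with
  | zero => exact fun n => atomic 0 n
  | succ k ih =>
    intro n
    obtain ⟨J₀, _, Φ₀, hΦ₀, h₀⟩ := atomic (k + 1) n
    obtain ⟨J, _, Φ, hΦ, h⟩ := ih (n + N)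
    -- A set `s` of indices describes a complete type over the formulas for `k` rounds. The new
    -- formulas state which types are realized by extending the tuple by a block.
    refine ⟨J₀ ⊕ Set J, inferInstance, Sum.elim Φ₀ (fun s => exBlock N (signed Φ s)), ?_, ?_⟩
    · rintro (j | s)
      · exact hΦ₀ j
      · exact AltLe.exBlock (AltLe.signed hΦ)
    · intro V W G H v xs v' xs' hs
      have step : ∀ {V W : Type} {G : SimpleGraph V} {H : SimpleGraph W} {v : α → V}
          {xs : Fin n → V} {v' : α → W} {xs' : Fin n → W},
          (∀ s, Sat G (exBlock N (signed Φ s)) v xs → Sat H (exBlock N (signed Φ s)) v' xs') →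
          ∀ c : Fin N → V, ∃ c' : Fin N → W, BlockEquiv N (uncolored G) (uncolored H) k
            (Sum.elim (Sum.elim v xs) c) (Sum.elim (Sum.elim v' xs') c') := by
        intro V W G H v xs v' xs' hs c
        have := hs {j | Sat G (Φ j) v (Fin.append xs c)} (sat_exBlock.2 ⟨c, sat_signed.2
          fun j => Iff.rfl⟩)
        obtain ⟨c', hc'⟩ := sat_exBlock.1 this
        refine ⟨c', ?_⟩
        have e := (h G H v (Fin.append xs c) v' (Fin.append xs' c') (sat_signed.1 hc')).comp
          (Sum.elim (Sum.map id (Fin.castAdd N)) (Sum.inr ∘ Fin.natAdd n) :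
            (α ⊕ Fin n) ⊕ Fin N → α ⊕ Fin (n + N))
        convert e using 1 <;> ext ((i | i) | i) <;> simp
      refine ⟨h₀ G H v xs v' xs' fun j => hs (Sum.inl j), fun c _ => ?_, fun c' _ => ?_⟩
      · obtain ⟨c', e⟩ := step (fun s => (hs (Sum.inr s)).1) c
        exact ⟨c', fun _ => Set.mem_univ _, e⟩
      · obtain ⟨c, e⟩ := step (fun s => (hs (Sum.inr s)).2) c'
        exact ⟨c, fun _ => Set.mem_univ _, e.symm⟩

end Satisfaction

/-- If games with few rounds of large blocks determine the usual games on a class, then formulas of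
bounded alternation rank are sufficient. -/
theorem exists_equivalent_formula (C : GraphClass) {m k N q : ℕ}
    (φ : Language.graph.Formula (Fin m)) (hq : quantifierDepth φ ≤ q)
    (h : ∀ {V W : Type} (G : SimpleGraph V) (H : SimpleGraph W), C.Mem G → C.Mem H →
      ∀ (a : Fin m ⊕ Fin 0 → V) (b : Fin m ⊕ Fin 0 → W),
        BlockEquiv N (uncolored G) (uncolored H) k a b →
        BlockEquiv 1 (uncolored G) (uncolored H) q a b) :
    ∃ ψ : Language.graph.Formula (Fin m), alternationRank ψ ≤ k ∧ C.EquivalentOn φ ψ := by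
  obtain ⟨J, _, Φ, hΦ, hJ⟩ := exists_formulas (Fin m) N k 0
  -- The disjunction of the finitely many types that occur in the class together with `φ`. Tuples of
  -- the same type agree on `φ`.
  refine ⟨BoundedFormula.iSup (fun s : {s : Set J // ∃ (V : Type) (G : SimpleGraph V)
    (v : Fin m → V), C.Mem G ∧ Sat G φ v default ∧ Sat G (signed Φ s) v default} =>
      signed Φ s.1), ?_, ?_⟩
  · exact alternationRank_le_iff.2 (AltLe.iSup fun s => AltLe.signed hΦ)
  · intro V G hG v
    change Sat G φ v default ↔ Sat G _ v default
    rw [sat_iSup]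
    constructor
    · intro hv
      have : Sat G (signed Φ {j | Sat G (Φ j) v default}) v default :=
        sat_signed.2 fun j => Iff.rfl
      exact ⟨⟨_, V, G, v, hG, hv, this⟩, this⟩
    · rintro ⟨⟨s, W, H, w, hH, hw, hs⟩, hv⟩
      refine ((h H G hH hG _ _ (hJ H G w default v default fun j => ?_)).sat_iff hq).1 hw
      rw [← sat_signed.1 hs j, ← sat_signed.1 hv j]

end TreeRank

namespace TreeRank

/-! ### Trees as shallow topological minors -/

section

variable {V W : Type} {G : SimpleGraph W} {r M d : ℕ}

/-- Greedy construction of subdivided trees from vertices of large rank. -/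
theorem exists_tree_paths [Fintype V] [DecidableEq V] [DecidableEq W] (par : V → V) (lev : V → ℕ)
    (root : V) (hroot : lev root = 0) (hpr : par root = root)
    (hpar : ∀ v, v ≠ root → lev (par v) + 1 = lev v) (hlev : ∀ v, lev v ≤ d)
    (hM : Fintype.card V * (r + 1) ≤ M) {w₀ : W} (hw₀ : HasRank (uncolored G) r M d w₀) :
    ∃ (b : V → W) (S : V → Finset W), (∀ v, b v ∈ S v) ∧ Pairwise (Function.onFun Disjoint S) ∧
      ∀ v, ∃ p : G.Walk (b (par v)) (b v), p.IsPath ∧ p.length ≤ r ∧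
        (v ≠ root → ∀ x, x ∈ p.support ↔ x = b (par v) ∨ x ∈ S v) := by
  -- Induction over vertex sets closed under parents, by removing a vertex of maximal level. Images
  -- of vertices of level i keep rank d - i, which suffices to attach their children. `S v` is the
  -- path from the parent without its first vertex.
  have key : ∀ n (X : Finset V), X.card = n → root ∈ X → (∀ v ∈ X, par v ∈ X) →
      ∃ (b : V → W) (S : V → Finset W),
        (∀ v ∈ X, b v ∈ S v ∧ (S v).card ≤ r + 1 ∧
          HasRank (uncolored G) r M (d - lev v) (b v)) ∧
        (∀ v ∈ X, ∀ v' ∈ X, v ≠ v' → Disjoint (S v) (S v')) ∧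
        ∀ v ∈ X, ∃ p : G.Walk (b (par v)) (b v), p.IsPath ∧ p.length ≤ r ∧
          (v ≠ root → ∀ x, x ∈ p.support ↔ x = b (par v) ∨ x ∈ S v) := by
    intro n
    induction n with
    | zero =>
      intro X hX hr
      rw [Finset.card_eq_zero] at hX
      simp [hX] at hr
    | succ n ih =>
      intro X hX hr hcl
      obtain ⟨v, hvX, hmax⟩ := X.exists_max_image lev ⟨root, hr⟩
      by_cases hv : v = root
      · have hall : ∀ x ∈ X, x = root := by
          intro x hx
          by_contra hne
          have h1 := hmax x hx
          have h2 := hpar x hne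
          rw [hv, hroot] at h1
          omega
        refine ⟨fun _ => w₀, fun _ => {w₀}, fun x hx => ⟨by simp, by simp, ?_⟩,
          fun x hx y hy hne => (hne ((hall x hx).trans (hall y hy).symm)).elim,
          fun x hx => ⟨.nil, by simp, by simp, fun hne => (hne (hall x hx)).elim⟩⟩
        rw [hall x hx, hroot]
        exact hw₀
      have hpv : ∀ x ∈ X, par x ≠ v := by
        intro x hx h
        by_cases hxr : x = root
        · rw [hxr, hpr] at h
          exact hv h.symm
        · have h1 := hmax x hx
          have h2 := hpar x hxr
          rw [h] at h2
          omega
      obtain ⟨b, S, h1, h2, h3⟩ := ih (X.erase v) (by rw [Finset.card_erase_of_mem hvX, hX]; rfl)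
        (Finset.mem_erase.2 ⟨Ne.symm hv, hr⟩) (fun x hx => Finset.mem_erase.2
          ⟨hpv x (Finset.mem_of_mem_erase hx), hcl x (Finset.mem_of_mem_erase hx)⟩)
      have hpX : par v ∈ X.erase v := Finset.mem_erase.2 ⟨hpv v hvX, hcl v hvX⟩
      have hcard : (↑((X.erase v).biUnion S) : Set W).encard ≤ M := by
        rw [Set.encard_coe_eq_coe_finsetCard]
        refine Nat.cast_le.2 (le_trans (Finset.card_biUnion_le_card_mul _ _ (r + 1)
          fun x hx => (h1 x hx).2.1) (le_trans ?_ hM))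
        exact Nat.mul_le_mul_right _ (Finset.card_le_univ _)
      -- All vertices used so far are forbidden. The parent's image is among them, but as the start
      -- of the walk it is exempt.
      obtain ⟨F, -, hF⟩ := exists_fin_cover hcard (Set.subset_univ _) (Or.inl ⟨w₀, trivial⟩)
      have hrank := (h1 _ hpX).2.2
      have hlv := hlev v
      have hpl := hpar v hv
      rw [show d - lev (par v) = (d - lev v) + 1 by omega] at hrank
      obtain ⟨u, hu, hur, p, hp, hpF⟩ := hrank F (fun _ => Set.mem_univ _)
      change G.Walk (b (par v)) u at p
      have hq : ∀ x ∈ p.bypass.support, x ≠ b (par v) → ∀ y ∈ X.erase v, x ∉ S y := by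
        intro x hx hxb y hy hxy
        obtain ⟨j, hj⟩ := hF x (by
          rw [Finset.mem_coe, Finset.mem_biUnion]; exact ⟨y, hy, hxy⟩)
        exact hpF x (p.support_bypass_subset_support hx) hxb j hj
      have hqp : p.bypass.IsPath := p.bypass_isPath
      have hql : p.bypass.length ≤ r := p.length_bypass_le_length.trans hp
      refine ⟨Function.update b v u,
        Function.update S v (p.bypass.support.toFinset.erase (b (par v))), ?_, ?_, ?_⟩
      · intro x hx
        by_cases hxv : x = v
        · subst hxv
          simp only [Function.update_self]
          refine ⟨by simp [hu], ?_, hur⟩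
          refine (Finset.card_erase_le).trans ((List.toFinset_card_le _).trans ?_)
          rw [SimpleGraph.Walk.length_support]
          omega
        · simp only [Function.update_of_ne hxv]
          exact h1 x (Finset.mem_erase.2 ⟨hxv, hx⟩)
      · have hdis : ∀ y ∈ X, y ≠ v →
            Disjoint (p.bypass.support.toFinset.erase (b (par v))) (S y) := by
          intro y hy hyv
          rw [Finset.disjoint_left]
          intro x hx
          rw [Finset.mem_erase, List.mem_toFinset] at hx
          exact hq x hx.2 hx.1 y (Finset.mem_erase.2 ⟨hyv, hy⟩)
        intro x hx y hy hne
        by_cases hxv : x = v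
        · subst hxv
          rw [Function.update_self, Function.update_of_ne hne.symm]
          exact hdis y hy hne.symm
        · by_cases hyv : y = v
          · subst hyv
            rw [Function.update_self, Function.update_of_ne hne]
            exact (hdis x hx hne).symm
          · rw [Function.update_of_ne hxv, Function.update_of_ne hyv]
            exact h2 x (Finset.mem_erase.2 ⟨hxv, hx⟩) y (Finset.mem_erase.2 ⟨hyv, hy⟩) hne
      · intro x hx
        by_cases hxv : x = v
        · subst hxv
          rw [Function.update_self, Function.update_of_ne (hpv x hx), Function.update_self]
          refine ⟨p.bypass, hqp, hql, fun _ y => ?_⟩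
          rw [Finset.mem_erase, List.mem_toFinset]
          by_cases hy : y = b (par x)
          · simp [hy]
          · simp [hy]
        · rw [Function.update_of_ne hxv, Function.update_of_ne (hpv x hx),
            Function.update_of_ne hxv]
          exact h3 x (Finset.mem_erase.2 ⟨hxv, hx⟩)
  obtain ⟨b, S, h1, h2, h3⟩ := key _ Finset.univ rfl (Finset.mem_univ _) (fun _ _ => Finset.mem_univ _)
  exact ⟨b, S, fun v => (h1 v (Finset.mem_univ _)).1,
    fun v v' h => h2 v (Finset.mem_univ _) v' (Finset.mem_univ _) h, fun v => h3 v (Finset.mem_univ _)⟩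

/-- Parents in a rooted tree. -/
theorem exists_parent {T : SimpleGraph V} (hT : T.IsTree) (root : V) :
    ∃ par : V → V, par root = root ∧
      (∀ v, v ≠ root → T.dist root (par v) + 1 = T.dist root v) ∧
      ∀ u v, T.Adj u v → par u = v ∨ par v = u := by
  classical
  have ex : ∀ v, ∃ u, (v = root → u = root) ∧ (v ≠ root → T.Adj u v ∧
      T.dist root u + 1 = T.dist root v) := by
    intro v
    by_cases hv : v = root
    · exact ⟨root, fun _ => rfl, fun h => (h hv).elim⟩
    · obtain ⟨p, hp⟩ := hT.connected.exists_walk_length_eq_dist root v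
      have hnil : ¬ p.Nil := SimpleGraph.Walk.not_nil_of_ne (Ne.symm hv)
      have hadj := p.adj_penultimate hnil
      refine ⟨p.penultimate, fun h => (hv h).elim, fun _ => ⟨hadj, ?_⟩⟩
      have h1 : T.dist root p.penultimate ≤ p.dropLast.length := SimpleGraph.dist_le _
      have h2 : p.dropLast.length + 1 = p.length := by
        rw [SimpleGraph.Walk.length_dropLast_add_one hnil]
      have h3 := hT.connected.dist_triangle (u := root) (v := p.penultimate) (w := v)
      rw [SimpleGraph.dist_eq_one_iff_adj.2 hadj] at h3
      omega
  choose par hp0 hp1 using ex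
  refine ⟨par, hp0 root rfl, fun v hv => (hp1 v hv).2, ?_⟩
  -- Both `u` and the chosen parent lie next to last on a shortest path from the root to `v`, and
  -- paths in trees are unique.
  have uniq : ∀ u v, T.Adj u v → T.dist root v = T.dist root u + 1 → par v = u := by
    intro u v huv hd
    have hv : v ≠ root := by
      rintro rfl
      simp at hd
    obtain ⟨hadj, hd'⟩ := hp1 v hv
    obtain ⟨p, hp⟩ := hT.connected.exists_walk_length_eq_dist root u
    obtain ⟨q, hq⟩ := hT.connected.exists_walk_length_eq_dist root (par v)
    have hp' : (p.concat huv).IsPath :=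
      (p.concat huv).isPath_of_length_eq_dist (by simp [hp, hd])
    have hq' : (q.concat hadj).IsPath :=
      (q.concat hadj).isPath_of_length_eq_dist (by simp [hq, hd'])
    have := (hT.existsUnique_path root v).unique hp' hq'
    have h2 := congrArg SimpleGraph.Walk.penultimate this
    simpa using h2.symm
  intro u v huv
  rcases hT.dist_eq_dist_add_one_of_adj root huv with h | h
  · exact Or.inl (uniq v u huv.symm h)
  · exact Or.inr (uniq u v huv h)

theorem isShallowTopMinor_of_hasRank [Finite V] {T : SimpleGraph V} {root : V} (hT : T.IsTree)
    {D : ℕ} (hD : HasDepth T root D) (hd : D ≤ d + 1) (hM : Nat.card V * (r + 1) ≤ M) {w₀ : W}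
    (hw₀ : HasRank (uncolored G) r M d w₀) : IsShallowTopMinor r T G := by
  classical
  have := Fintype.ofFinite V
  obtain ⟨par, hpr, hpar, hadj⟩ := exists_parent hT root
  have hlev : ∀ v, T.dist root v ≤ d := by
    intro v
    obtain ⟨p, hp, hl⟩ := hT.connected.exists_path_of_dist root v
    have := hD.2 ⟨v, p, hp, rfl⟩
    rw [SimpleGraph.Walk.length_support] at this
    omega
  obtain ⟨b, S, hb, hS, hP⟩ := exists_tree_paths par (T.dist root) root (by simp) hpr hpar hlev
    (by rwa [Nat.card_eq_fintype_card] at hM) hw₀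
  choose P hP1 hP2 hP3 using hP
  have binj : Function.Injective b := by
    intro v v' h
    by_contra hne
    exact Finset.disjoint_left.1 (hS hne) (hb v) (h ▸ hb v')
  have mem_iff : ∀ v v', b v ∈ S v' ↔ v = v' := by
    intro v v'
    refine ⟨fun h => ?_, fun h => h ▸ hb v⟩
    by_contra hne
    exact Finset.disjoint_left.1 (hS hne) (hb v) h
  have notBoth : ∀ {u v}, T.Adj u v → par v = u → par u = v → False := by
    intro u v h h1 h2
    have hv : v ≠ root := by
      rintro rfl
      exact h.ne (h1.symm.trans hpr)
    have hu : u ≠ root := by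
      rintro rfl
      exact h.ne (h2.symm.trans hpr).symm
    have e1 := hpar v hv
    have e2 := hpar u hu
    rw [h1] at e1
    rw [h2] at e2
    omega
  -- Each edge joins a child to its parent; its path is the child's, reversed when the edge is read
  -- upwards.
  let path : ∀ {u v : V}, T.Adj u v → G.Walk (b u) (b v) := fun {u v} h =>
    if e : par v = u then (P v).copy (congrArg b e) rfl
    else ((P u).copy (congrArg b ((hadj u v h).resolve_right e)) rfl).reverse
  have path_spec : ∀ {u v : V} (h : T.Adj u v), (path h).IsPath ∧ (path h).length ≤ r + 1 ∧
      ∃ c, s(u, v) = s(par c, c) ∧ ∀ x, x ∈ (path h).support ↔ x = b (par c) ∨ x ∈ S c := by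
    intro u v h
    by_cases e : par v = u
    · have hv : v ≠ root := by
        rintro rfl
        exact h.ne (e.symm.trans hpr)
      refine ⟨?_, ?_, v, by rw [e], ?_⟩
      · simpa [path, e] using hP1 v
      · simpa [path, e] using (hP2 v).trans (Nat.le_succ r)
      · simpa [path, e] using hP3 v hv
    · have e' := (hadj u v h).resolve_right e
      have hu : u ≠ root := by
        rintro rfl
        exact h.ne (e'.symm.trans hpr).symm
      refine ⟨?_, ?_, u, by rw [e', Sym2.eq_swap], ?_⟩
      · simpa [path, e] using hP1 u
      · simpa [path, e] using (hP2 u).trans (Nat.le_succ r)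
      · simpa [path, e, e'] using hP3 u hu
  refine ⟨{ branch := b, branch_injective := binj, path := path,
            path_isPath := fun h => (path_spec h).1, path_symm := ?_,
            path_length_le := fun h => (path_spec h).2.1, branch_mem_path := ?_,
            path_disjoint := ?_ }⟩
  · intro u v h
    by_cases e : par v = u
    · have e' : ¬ par u = v := fun e' => notBoth h e e'
      simp [path, e, e']
    · have e' := (hadj u v h).resolve_right e
      simp [path, e, e']
  · intro u v h w hw
    obtain ⟨-, -, c, hc, hsupp⟩ := path_spec h
    have : w ∈ s(u, v) := by
      rw [hc, Sym2.mem_iff]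
      rcases (hsupp _).1 hw with h | h
      · exact Or.inl (binj h)
      · exact Or.inr ((mem_iff _ _).1 h)
    exact Sym2.mem_iff.1 this
  · intro u v u' v' h h' x hne hx hx'
    obtain ⟨-, -, c, hc, hsupp⟩ := path_spec h
    obtain ⟨-, -, c', hc', hsupp'⟩ := path_spec h'
    rcases (hsupp x).1 hx with rfl | h1
    · exact ⟨_, rfl⟩
    rcases (hsupp' x).1 hx' with rfl | h2
    · exact ⟨_, rfl⟩
    have hcc : c ≠ c' := by
      rintro rfl
      exact hne (hc.trans hc'.symm)
    exact (Finset.disjoint_left.1 (hS hcc) h1 h2).elim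

end

/-- In classes of bounded tree rank, formulas of bounded alternation rank are sufficient. -/
theorem exists_alternationRank_bound (C : GraphClass) {d : ℕ} (hd : d + 1 ∉ C.treeDepths) :
    ∃ k : ℕ, ∀ (m : ℕ) (φ : FirstOrder.Language.graph.Formula (Fin m)),
      ∃ ψ : FirstOrder.Language.graph.Formula (Fin m),
        alternationRank ψ ≤ k ∧ C.EquivalentOn φ ψ := by
  obtain ⟨k, -, hk⟩ := exists_rounds d
  refine ⟨k, fun m φ => ?_⟩
  -- The radius comes from `φ`, the forbidden tree from the radius, and the robustness from the size
  -- of the tree; only `k` has to be independent of `φ`.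
  obtain ⟨r, hr⟩ := hk (quantifierDepth φ) (m + 0)
  simp only [GraphClass.treeDepths, Set.mem_ofPred_eq] at hd
  push Not at hd
  obtain ⟨V, T, root, hV, hT, hdepth, hno⟩ := hd r
  have norank : ∀ {W : Type} (G : SimpleGraph W), C.Mem G →
      ∀ v ∈ (uncolored G).D, ¬ HasRank (uncolored G) r (Nat.card V * (r + 1)) d v :=
    fun G hG v _ h => hno ⟨_, G, hG, isShallowTopMinor_of_hasRank hT hdepth le_rfl le_rfl h⟩
  obtain ⟨N, hN⟩ := hr (Nat.card V * (r + 1))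
  refine exists_equivalent_formula C (N := N) φ le_rfl fun G H hG hH a b h => ?_
  exact hN _ _ a b (by simp) (fun _ => Set.mem_univ _) (fun _ => Set.mem_univ _) (norank G hG)
    (norank H hH) h

end TreeRank

namespace TreeRank

open FirstOrder FirstOrder.Language

/-! ### Preservation of formulas of bounded alternation rank -/

section

variable {V W X α : Type} {n : ℕ} {G : SimpleGraph V} {H : SimpleGraph W} {K : SimpleGraph X}

theorem sat_iso (σ : G ≃g H) (φ : Language.graph.BoundedFormula α n) (v : α → V) (xs : Fin n → V) :
    Sat H φ (σ ∘ v) (σ ∘ xs) ↔ Sat G φ v xs := by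
  induction φ with
  | falsum => exact Iff.rfl
  | equal t₁ t₂ =>
    obtain ⟨i, rfl⟩ := term_eq_var t₁
    obtain ⟨j, rfl⟩ := term_eq_var t₂
    erw [sat_equal, sat_equal]
    rw [← Sum.comp_elim]
    exact σ.injective.eq_iff
  | rel R ts =>
    cases R
    obtain ⟨i, hi⟩ := term_eq_var (ts 0)
    obtain ⟨j, hj⟩ := term_eq_var (ts 1)
    erw [sat_adj ts hi hj, sat_adj ts hi hj]
    rw [← Sum.comp_elim]
    exact σ.map_adj_iff
  | imp φ ψ ih₁ ih₂ => rw [sat_imp, sat_imp, ih₁, ih₂]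
  | all φ ih =>
    rw [sat_all, sat_all]
    constructor
    · intro h x
      rw [← ih, Fin.comp_snoc]
      exact h (σ x)
    · intro h y
      obtain ⟨x, rfl⟩ := σ.surjective y
      rw [← Fin.comp_snoc, ih]
      exact h x

/-- Every vertex can be moved into the image of `f` by an automorphism that fixes `n` given vertices
of this image. -/
def SwapsInto (n : ℕ) (f : G ↪g H) : Prop :=
  ∀ S : Finset V, S.card ≤ n → ∀ y : W, ∃ σ : H ≃g H, (∀ x ∈ S, σ (f x) = f x) ∧
    σ y ∈ Set.range f

/-- The Tarski–Vaught test: a witness in `H` is moved into the image by an automorphism that fixes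
the current parameters, of which there are never more than `N`. -/
theorem SwapsInto.sat_iff {N : ℕ} {f : G ↪g H} (hf : SwapsInto N f) [Fintype α]
    (φ : Language.graph.BoundedFormula α n) (hN : Fintype.card α + n + quantifierDepth φ ≤ N)
    (v : α → V) (xs : Fin n → V) : Sat H φ (f ∘ v) (f ∘ xs) ↔ Sat G φ v xs := by
  classical
  induction φ with
  | falsum => exact Iff.rfl
  | equal t₁ t₂ =>
    obtain ⟨i, rfl⟩ := term_eq_var t₁
    obtain ⟨j, rfl⟩ := term_eq_var t₂
    erw [sat_equal, sat_equal]
    rw [← Sum.comp_elim]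
    exact f.injective.eq_iff
  | rel R ts =>
    cases R
    obtain ⟨i, hi⟩ := term_eq_var (ts 0)
    obtain ⟨j, hj⟩ := term_eq_var (ts 1)
    erw [sat_adj ts hi hj, sat_adj ts hi hj]
    rw [← Sum.comp_elim]
    exact f.map_adj_iff
  | imp φ ψ ih₁ ih₂ =>
    simp only [quantifierDepth] at hN
    rw [sat_imp, sat_imp, ih₁ (by omega), ih₂ (by omega)]
  | @all n φ ih =>
    simp only [quantifierDepth] at hN
    rw [sat_all, sat_all]
    constructor
    · intro h x
      rw [← ih (by omega), Fin.comp_snoc]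
      exact h (f x)
    · intro h y
      obtain ⟨σ, hσ, x, hx⟩ := hf (Finset.univ.image (Sum.elim v xs)) (by
        refine Finset.card_image_le.trans ?_
        simp
        omega) y
      have hv : σ ∘ (f ∘ v) = f ∘ v := by
        funext i
        exact hσ _ (Finset.mem_image.2 ⟨Sum.inl i, Finset.mem_univ _, rfl⟩)
      have hxs : σ ∘ (f ∘ xs) = f ∘ xs := by
        funext i
        exact hσ _ (Finset.mem_image.2 ⟨Sum.inr i, Finset.mem_univ _, rfl⟩)
      rw [← sat_iso σ, Fin.comp_snoc, hv, hxs, ← hx, ← Fin.comp_snoc, ih (by omega)]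
      exact h x

/-- Embeddings that preserve formulas that start with an existential quantifier and have at most
`k` alternations. -/
def Preserving (N : ℕ) : ℕ → ∀ {V W : Type} {G : SimpleGraph V} {H : SimpleGraph W},
    (G ↪g H) → Prop
  | 0, _, _, _, _, _ => True
  | k + 1, _, _, _, H, f => ∃ (X : Type) (K : SimpleGraph X) (g : H ↪g K),
      SwapsInto N (f.trans g) ∧ Preserving N k g

theorem branchWords_ne_nil {L : Language} (b : Bool) (φ : L.BoundedFormula α n) :
    branchWords b φ ≠ [] := by
  induction φ generalizing b with
  | falsum => simp [branchWords]
  | equal => simp [branchWords]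
  | rel => simp [branchWords]
  | imp φ ψ ih₁ ih₂ => cases b <;> simp [branchWords, ih₁]
  | all φ ih => cases b <;> simp [branchWords, ih]

/-- Embeddings preserve atoms in both directions and existential witnesses upwards, so only
universal subformulas need `hall`. The boolean tracks polarity: for `false` it is the negation of
`φ` that is preserved. -/
theorem sat_of_sat_all [Fintype α] {N k : ℕ} (f : G ↪g H)
    (hall : ∀ {n : ℕ} (φ : Language.graph.BoundedFormula α (n + 1)) (v : α → V) (xs : Fin n → V),
      Fintype.card α + n + quantifierDepth φ.all ≤ N →
      (∀ w ∈ branchWords true φ.all, alternations (.ex :: w) ≤ k) →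
      Sat G φ.all v xs → Sat H φ.all (f ∘ v) (f ∘ xs))
    (b : Bool) (φ : Language.graph.BoundedFormula α n)
    (hN : Fintype.card α + n + quantifierDepth φ ≤ N)
    (hk : ∀ w ∈ branchWords b φ, alternations (.ex :: w) ≤ k) (v : α → V) (xs : Fin n → V)
    (h : Sat G φ v xs ↔ b = true) : Sat H φ (f ∘ v) (f ∘ xs) ↔ b = true := by
  induction φ generalizing b with
  | falsum => exact h
  | equal t₁ t₂ =>
    obtain ⟨i, rfl⟩ := term_eq_var t₁
    obtain ⟨j, rfl⟩ := term_eq_var t₂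
    erw [sat_equal] at h ⊢
    rw [← Sum.comp_elim, ← h]
    exact f.injective.eq_iff
  | rel R ts =>
    cases R
    obtain ⟨i, hi⟩ := term_eq_var (ts 0)
    obtain ⟨j, hj⟩ := term_eq_var (ts 1)
    erw [sat_adj ts hi hj] at h ⊢
    rw [← Sum.comp_elim, ← h]
    exact f.map_adj_iff
  | imp φ ψ ih₁ ih₂ =>
    simp only [quantifierDepth] at hN
    cases b
    · simp only [branchWords, List.mem_append] at hk
      simp only [sat_imp, Bool.false_eq_true, iff_false, Classical.not_imp] at h ⊢
      refine ⟨(ih₁ true (by omega) (fun w hw => hk w (Or.inl hw)) xs (by simpa using h.1)).2 rfl,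
        fun h' => ?_⟩
      simpa using (ih₂ false (by omega) (fun w hw => hk w (Or.inr hw)) xs (by simpa using h.2)).1 h'
    · simp only [branchWords, List.mem_append] at hk
      simp only [sat_imp, iff_true] at h ⊢
      intro h'
      by_cases h₁ : Sat G φ v xs
      · exact (ih₂ true (by omega) (fun w hw => hk w (Or.inr hw)) xs (by simpa using h h₁)).2 rfl
      · have := (ih₁ false (by omega) (fun w hw => hk w (Or.inl hw)) xs (by simpa using h₁)).1 h'
        simp at this
  | @all n φ ih =>
    cases b
    · simp only [branchWords, List.mem_map] at hk
      simp only [Bool.false_eq_true, iff_false] at h ⊢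
      rw [sat_all, not_forall] at h
      obtain ⟨x, hx⟩ := h
      intro h'
      rw [sat_all] at h'
      have := (ih false (by simp only [quantifierDepth] at hN; omega) (fun w hw => by
        simpa [alternations] using hk _ ⟨w, hw, rfl⟩) (Fin.snoc xs x) (by simpa using hx)).1 (by
          rw [Fin.comp_snoc]; exact h' _)
      simp at this
    · exact iff_of_true (hall φ v xs hN hk (h.2 rfl)) rfl

theorem Preserving.sat [Fintype α] {N k : ℕ} {f : G ↪g H} (hf : Preserving N k f) (b : Bool)
    (φ : Language.graph.BoundedFormula α n) (hN : Fintype.card α + n + quantifierDepth φ ≤ N)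
    (hk : ∀ w ∈ branchWords b φ, alternations (.ex :: w) ≤ k) (v : α → V) (xs : Fin n → V)
    (h : Sat G φ v xs ↔ b = true) : Sat H φ (f ∘ v) (f ∘ xs) ↔ b = true := by
  induction k generalizing V W G H b n φ with
  | zero =>
    refine sat_of_sat_all f (fun φ v xs _ hk _ => ?_) b φ hN hk v xs h
    -- Universal subformulas do not occur here: behind the leading ∃ they would cause an
    -- alternation.
    obtain ⟨w, hw⟩ := List.exists_mem_of_ne_nil _ (branchWords_ne_nil true φ)
    simpa [alternations] using hk (.all :: w) (by simpa [branchWords] using hw)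
  | succ k ih =>
    refine sat_of_sat_all f (fun φ v xs hN hk h => ?_) b φ hN hk v xs h
    obtain ⟨X, K, g, hg, hgk⟩ := hf
    -- If the universal formula fails in `H`, its negation starts with ∃ and has one alternation
    -- less, so `g` carries it to `K`. But `G` and `K` agree on the formula.
    by_contra hcon
    have := ih hgk false φ.all hN (fun w hw => ?_) (f ∘ v) (f ∘ xs) (by simpa using hcon)
    · rw [show g ∘ (f ∘ v) = (f.trans g) ∘ v from rfl, show g ∘ (f ∘ xs) = (f.trans g) ∘ xs from rfl,
        hg.sat_iff φ.all hN] at this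
      simp [h] at this
    · have hw' := hw
      rw [show false = !true from rfl, branchWords_not, List.mem_map] at hw'
      obtain ⟨w', hw', rfl⟩ := hw'
      have h1 := hk w' hw'
      simp only [branchWords, List.mem_map] at hw'
      obtain ⟨u, -, rfl⟩ := hw'
      have h2 := alternations_map_flip (.all :: u)
      simp only [alternations, List.map_cons, Quantifier.flip] at h1 h2 ⊢
      omega

end

end TreeRank

namespace TreeRank

open FirstOrder FirstOrder.Language

/-! ### Trees of lists -/

/-- The infinite tree on all lists of natural numbers, where `l ++ [c]` is a child of `l`. -/
def listTree : SimpleGraph (List ℕ) where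
  Adj l l' := (∃ c, l' = l ++ [c]) ∨ ∃ c, l = l' ++ [c]
  symm := ⟨fun _ _ h => h.symm⟩
  loopless := ⟨fun l h => by
    rcases h with ⟨c, h⟩ | ⟨c, h⟩ <;> simp at h⟩

theorem listTree_adj_nil_left {l : List ℕ} : listTree.Adj [] l ↔ ∃ c, l = [c] := by
  simp [listTree]

theorem listTree_adj_nil_right {l : List ℕ} : listTree.Adj l [] ↔ ∃ c, l = [c] := by
  rw [listTree.adj_comm, listTree_adj_nil_left]

theorem listTree_adj_cons_cons {c c' : ℕ} {l l' : List ℕ} :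
    listTree.Adj (c :: l) (c' :: l') ↔ c = c' ∧ listTree.Adj l l' := by
  simp only [listTree, List.cons_append, List.cons.injEq]
  constructor
  · rintro (⟨d, rfl, h⟩ | ⟨d, rfl, h⟩)
    · exact ⟨rfl, Or.inl ⟨d, h⟩⟩
    · exact ⟨rfl, Or.inr ⟨d, h⟩⟩
  · rintro ⟨rfl, ⟨d, h⟩ | ⟨d, h⟩⟩
    · exact Or.inl ⟨d, rfl, h⟩
    · exact Or.inr ⟨d, rfl, h⟩

/-- The automorphism of the list tree that permutes the children of the root, and applies
automorphisms to the subtrees. -/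
def nodeIso (π : Equiv.Perm ℕ) (τ : ℕ → listTree ≃g listTree) (hτ : ∀ c, τ c [] = []) :
    listTree ≃g listTree where
  toFun
    | [] => []
    | c :: l => π c :: τ c l
  invFun
    | [] => []
    | c :: l => π.symm c :: (τ (π.symm c)).symm l
  left_inv l := by cases l <;> simp
  right_inv l := by cases l <;> simp
  map_rel_iff' := by
    rintro (_ | ⟨c, l⟩) (_ | ⟨c', l'⟩)
    · simp
    · have : τ c' l' = [] ↔ l' = [] := by
        rw [← hτ c', EmbeddingLike.apply_eq_iff_eq, hτ c']
      simp [listTree_adj_nil_left, this]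
    · have : τ c l = [] ↔ l = [] := by
        rw [← hτ c, EmbeddingLike.apply_eq_iff_eq, hτ c]
      simp [listTree_adj_nil_right, this]
    · simp only [Equiv.coe_fn_mk, listTree_adj_cons_cons, EmbeddingLike.apply_eq_iff_eq]
      refine and_congr_right fun h => ?_
      subst h
      exact (τ c).map_adj_iff

/-- The tree whose root has the subtree `X` for the first `N` children, and `Y` for the next one. -/
def node (N : ℕ) (X Y : Set (List ℕ)) : Set (List ℕ) :=
  {l | l = [] ∨ ∃ c l', l = c :: l' ∧ (c < N ∧ l' ∈ X ∨ c = N ∧ l' ∈ Y)}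

theorem nil_mem_node {N : ℕ} {X Y : Set (List ℕ)} : [] ∈ node N X Y := Or.inl rfl

theorem cons_mem_node {N c : ℕ} {l : List ℕ} {X Y : Set (List ℕ)} :
    c :: l ∈ node N X Y ↔ c < N ∧ l ∈ X ∨ c = N ∧ l ∈ Y := by
  simp [node]

theorem node_mono {N : ℕ} {X X' Y Y' : Set (List ℕ)} (hX : X ⊆ X') (hY : Y ⊆ Y') :
    node N X Y ⊆ node N X' Y' := by
  rintro (_ | ⟨c, l⟩) h
  · exact nil_mem_node
  · rw [cons_mem_node] at h ⊢
    exact h.imp (And.imp_right (@hX _)) (And.imp_right (@hY _))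

/-- Every list in `t` can be moved into `s` by an automorphism of `t` that fixes `n` given
members of `s`. -/
def SetSwapsInto (n : ℕ) (s t : Set (List ℕ)) : Prop :=
  ∀ S : Finset (List ℕ), ↑S ⊆ s → S.card ≤ n → ∀ l ∈ t, ∃ σ : listTree ≃g listTree, σ [] = [] ∧
    (∀ x, σ x ∈ t ↔ x ∈ t) ∧ (∀ x ∈ S, σ x = x) ∧ σ l ∈ s

/-- Pairs of sets of lists whose inclusion preserves formulas of bounded alternation rank. -/
def SetPreserving (n : ℕ) : ℕ → Set (List ℕ) → Set (List ℕ) → Prop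
  | 0, s, t => s ⊆ t
  | k + 1, s, t => s ⊆ t ∧ ∃ u, t ⊆ u ∧ SetSwapsInto n s u ∧ SetPreserving n k t u

theorem SetPreserving.subset {n k : ℕ} {s t : Set (List ℕ)} (h : SetPreserving n k s t) : s ⊆ t := by
  cases k with
  | zero => exact h
  | succ k => exact h.1

/-- The automorphism acts inside the subtree of child `N` only, and has to fix just the tails of
those members of `S` that lie there. -/
theorem SetSwapsInto.node {n N : ℕ} {X s t : Set (List ℕ)} (h : SetSwapsInto n s t) :
    SetSwapsInto n (node N X s) (node N X t) := by
  classical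
  intro S hS hcard l hl
  by_cases hls : l ∈ TreeRank.node N X s
  · exact ⟨.refl, rfl, fun _ => Iff.rfl, fun _ _ => rfl, hls⟩
  obtain ⟨l', rfl, hl'⟩ : ∃ l', l = N :: l' ∧ l' ∈ t := by
    rcases l with _ | ⟨c, l⟩
    · exact (hls nil_mem_node).elim
    · rw [cons_mem_node] at hl hls
      rcases hl with hl | ⟨rfl, hl⟩
      · exact (hls (Or.inl hl)).elim
      · exact ⟨l, rfl, hl⟩
  have hN : ∀ x, N :: x ∈ S → x ∈ s := by
    intro x hx
    have := hS hx
    rw [cons_mem_node] at this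
    rcases this with ⟨h, -⟩ | ⟨-, h⟩
    · exact (lt_irrefl _ h).elim
    · exact h
  obtain ⟨σ, hσ, hσt, hσS, hσl⟩ := h ((S.filter (fun x => x.head? = some N)).image List.tail) (by
      intro x hx
      rw [Finset.mem_coe, Finset.mem_image] at hx
      obtain ⟨y, hy, rfl⟩ := hx
      rw [Finset.mem_filter] at hy
      rcases y with _ | ⟨c, y⟩
      · simp at hy
      · obtain rfl : c = N := by simpa using hy.2
        exact hN y hy.1)
    (Finset.card_image_le.trans ((Finset.card_filter_le _ _).trans hcard)) l' hl'
  refine ⟨nodeIso 1 (fun c => if c = N then σ else .refl) (fun c => by split_ifs; exacts [hσ, rfl]),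
    rfl, ?_, ?_, ?_⟩
  · rintro (_ | ⟨c, x⟩)
    · exact iff_of_true nil_mem_node nil_mem_node
    · change c :: _ ∈ _ ↔ _
      rw [cons_mem_node, cons_mem_node]
      by_cases hc : c = N
      · simp [hc, hσt]
      · simp [hc]
  · rintro (_ | ⟨c, x⟩) hx
    · rfl
    · change c :: _ = _
      by_cases hc : c = N
      · subst hc
        simp only [if_true]
        rw [hσS x]
        exact Finset.mem_image.2 ⟨c :: x, Finset.mem_filter.2 ⟨hx, rfl⟩, rfl⟩
      · simp [hc]
  · change N :: _ ∈ _
    rw [cons_mem_node]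
    simpa using hσl

/-- Among `N` copies of `X`, the `n` given lists leave one untouched, which is swapped with the
additional copy. -/
theorem setSwapsInto_node_empty {n N : ℕ} (hn : n < N) {X : Set (List ℕ)} :
    SetSwapsInto n (node N X ∅) (node N X X) := by
  classical
  intro S hS hcard l hl
  by_cases hls : l ∈ TreeRank.node N X ∅
  · exact ⟨.refl, rfl, fun _ => Iff.rfl, fun _ _ => rfl, hls⟩
  obtain ⟨l', rfl, hl'⟩ : ∃ l', l = N :: l' ∧ l' ∈ X := by
    rcases l with _ | ⟨c, l⟩
    · exact (hls nil_mem_node).elim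
    · rw [cons_mem_node] at hl hls
      rcases hl with hl | ⟨rfl, hl⟩
      · exact (hls (Or.inl hl)).elim
      · exact ⟨l, rfl, hl⟩
  -- The default 0 for the empty list may needlessly exclude child 0, but the image still has at
  -- most `n` elements.
  obtain ⟨d, hd, hdS⟩ : ∃ d ∈ Finset.range N, d ∉ S.image (fun x => x.headD 0) :=
    Finset.exists_mem_notMem_of_card_lt_card
      (Finset.card_image_le.trans_lt (by rw [Finset.card_range]; omega))
  rw [Finset.mem_range] at hd
  refine ⟨nodeIso (Equiv.swap d N) (fun _ => .refl) (fun _ => rfl), rfl, ?_, ?_, ?_⟩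
  · have mem : ∀ {c : ℕ} {x : List ℕ}, c :: x ∈ TreeRank.node N X X ↔ c ≤ N ∧ x ∈ X := by
      intro c x
      rw [cons_mem_node, ← or_and_right, le_iff_lt_or_eq]
    rintro (_ | ⟨c, x⟩)
    · exact iff_of_true nil_mem_node nil_mem_node
    · change (Equiv.swap d N c) :: x ∈ _ ↔ _
      rw [mem, mem, Equiv.swap_apply_def]
      split_ifs <;> simp <;> omega
  · rintro (_ | ⟨c, x⟩) hx
    · rfl
    · change (Equiv.swap d N c) :: x = _
      have h1 : c ≠ d := by
        rintro rfl
        exact hdS (Finset.mem_image.2 ⟨_, hx, rfl⟩)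
      have h2 : c ≠ N := by
        rintro rfl
        have := hS hx
        simp [cons_mem_node] at this
      rw [Equiv.swap_apply_of_ne_of_ne h1 h2]
  · change (Equiv.swap d N N) :: l' ∈ _
    rw [Equiv.swap_apply_right, cons_mem_node]
    exact Or.inl ⟨hd, hl'⟩

theorem SetPreserving.node {n N k : ℕ} {X s t : Set (List ℕ)} (h : SetPreserving n k s t) :
    SetPreserving n k (node N X s) (node N X t) := by
  induction k generalizing s t with
  | zero => exact node_mono le_rfl h
  | succ k ih =>
    obtain ⟨hst, u, htu, hs, hk⟩ := h
    exact ⟨node_mono le_rfl hst, _, node_mono le_rfl htu, hs.node, ih hk⟩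

/-- The pairs of trees that are hard to distinguish. The list of booleans describes their levels:
the root of each tree has many children (`true`) or at most one child (`false`). -/
def hardTree (N : ℕ) : Bool → List Bool → Set (List ℕ)
  | true, [] => {l | l = [] ∨ l = [N]}
  | false, [] => {[]}
  | true, true :: σ => node N (hardTree N true σ) (hardTree N false σ)
  | false, true :: σ => node N (hardTree N true σ) ∅
  | b, false :: σ => node N ∅ (hardTree N b σ)

/-- At a branching level the losing tree has `N` winning children, the winning tree has an
additional losing one, and the third tree of the sandwich makes that child winning as well. The two
latter trees differ in one subtree, by the pair of the next level. Levels without branching cost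
nothing. -/
theorem setPreserving_hardTree {n N : ℕ} (hn : n < N) (σ : List Bool) :
    SetPreserving n (σ.count true) (hardTree N false σ) (hardTree N true σ) := by
  induction σ with
  | nil =>
    rintro _ rfl
    exact Or.inl rfl
  | cons b σ ih =>
    cases b
    · simpa [hardTree] using ih.node
    · simp only [List.count_cons_self, hardTree]
      exact ⟨node_mono le_rfl (Set.empty_subset _), _, node_mono le_rfl ih.subset,
        setSwapsInto_node_empty hn, ih.node⟩

theorem nil_mem_hardTree {N : ℕ} (b : Bool) (σ : List Bool) : [] ∈ hardTree N b σ := by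
  rcases σ with _ | ⟨_ | _, σ⟩ <;> cases b <;> first | exact nil_mem_node | simp [hardTree]

theorem SetPreserving.preserving {n k : ℕ} {s t : Set (List ℕ)} (h : SetPreserving n k s t) :
    Preserving n k (SimpleGraph.induceHomOfLE listTree h.subset) := by
  classical
  induction k generalizing s t with
  | zero => trivial
  | succ k ih =>
    obtain ⟨hst, u, htu, hs, hk⟩ := h
    refine ⟨u, listTree.induce u, SimpleGraph.induceHomOfLE listTree hk.subset, ?_, ih hk⟩
    rintro S hS ⟨y, hy⟩
    obtain ⟨σ, -, hu, hfix, hσ⟩ := hs (S.image Subtype.val) (by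
        intro x hx
        rw [Finset.mem_coe, Finset.mem_image] at hx
        obtain ⟨x, -, rfl⟩ := hx
        exact x.2) (Finset.card_image_le.trans hS) y hy
    refine ⟨⟨σ.toEquiv.subtypeEquiv fun x => (hu x).symm, ?_⟩, fun x hx => ?_, ⟨σ y, hσ⟩, rfl⟩
    · intro a b
      exact σ.map_adj_iff
    · exact Subtype.ext (hfix _ (Finset.mem_image.2 ⟨x, hx, rfl⟩))

/-! ### The formula that distinguishes hard trees -/

/-- The property that distinguishes the hard trees from each other. -/
def Winning {V : Type} (G : SimpleGraph V) : List Bool → V → V → Prop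
  | [], p, v => ∃ w, w ≠ p ∧ G.Adj v w
  | true :: σ, p, v => ∃ w, w ≠ p ∧ G.Adj v w ∧ ¬ Winning G σ v w
  | false :: σ, p, v => ∃ w, w ≠ p ∧ G.Adj v w ∧ Winning G σ v w

theorem exists_winning_formula (α : Type) (σ : List Bool) : ∀ (n : ℕ) (i j : α ⊕ Fin n),
    ∃ φ : Language.graph.BoundedFormula α n, ∀ {V : Type} (G : SimpleGraph V) (v : α → V)
      (xs : Fin n → V), Sat G φ v xs ↔ Winning G σ (Sum.elim v xs i) (Sum.elim v xs j) := by
  have base : ∀ (n : ℕ) (i j : α ⊕ Fin n) (ψ : Language.graph.BoundedFormula α (n + 1)),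
      ∃ φ : Language.graph.BoundedFormula α n, ∀ {V : Type} (G : SimpleGraph V) (v : α → V)
        (xs : Fin n → V), Sat G φ v xs ↔ ∃ w, w ≠ Sum.elim v xs i ∧ G.Adj (Sum.elim v xs j) w ∧
          Sat G ψ v (Fin.snoc xs w) := by
    intro n i j ψ
    refine ⟨(BoundedFormula.not (BoundedFormula.imp (BoundedFormula.not (.equal (Term.var (Sum.inr
      (Fin.last n))) (Term.var (Sum.map id Fin.castSucc i)))) (BoundedFormula.imp (.rel adj
      ![Term.var (Sum.map id Fin.castSucc j), Term.var (Sum.inr (Fin.last n))]) ψ.not))).ex, ?_⟩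
    intro V G v xs
    have hs : ∀ (w : V) (i : α ⊕ Fin n), Sum.elim v (Fin.snoc xs w : Fin (n + 1) → V)
        (Sum.map id Fin.castSucc i) = Sum.elim v xs i := by
      rintro w (i | i) <;> simp
    rw [sat_ex]
    refine exists_congr fun w => ?_
    rw [sat_not, sat_imp, sat_not, sat_equal, sat_imp, sat_adj _ rfl rfl, sat_not, hs, hs]
    simp only [Sum.elim_inr, Fin.snoc_last]
    tauto
  induction σ with
  | nil =>
    intro n i j
    obtain ⟨φ, hφ⟩ := base n i j (BoundedFormula.not ⊥)
    refine ⟨φ, fun G v xs => ?_⟩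
    rw [hφ]
    simp only [Winning, sat_not]
    refine exists_congr fun w => and_congr_right fun _ => and_iff_left id
  | cons b σ ih =>
    intro n i j
    obtain ⟨ψ, hψ⟩ := ih (n + 1) (Sum.map id Fin.castSucc j) (Sum.inr (Fin.last n))
    have hψ' : ∀ {V : Type} (G : SimpleGraph V) (v : α → V) (xs : Fin n → V) (w : V),
        Sat G ψ v (Fin.snoc xs w) ↔ Winning G σ (Sum.elim v xs j) w := by
      intro V G v xs w
      rw [hψ]
      rcases j with j | j <;> simp
    cases b
    · obtain ⟨φ, hφ⟩ := base n i j ψ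
      refine ⟨φ, fun G v xs => ?_⟩
      rw [hφ]
      simp only [hψ', Winning]
    · obtain ⟨φ, hφ⟩ := base n i j ψ.not
      refine ⟨φ, fun G v xs => ?_⟩
      rw [hφ]
      simp only [sat_not, hψ', Winning]

theorem winning_hardTree {N : ℕ} (b : Bool) (σ : List Bool) {t : Set (List ℕ)}
    {l p : t} (hl : ∀ x, l.1 ++ x ∈ t ↔ x ∈ hardTree N b σ)
    (hp : ∀ x c, l.1 = x ++ [c] → p.1 = x) (hpl : ∀ c, p.1 ≠ l.1 ++ [c]) :
    Winning (listTree.induce t) σ p l ↔ b = true := by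
  have child : ∀ {l p : t}, (∀ x c, l.1 = x ++ [c] → p.1 = x) → (∀ c, p.1 ≠ l.1 ++ [c]) →
      ∀ P : t → Prop, (∃ w, w ≠ p ∧ (listTree.induce t).Adj l w ∧ P w) ↔
        ∃ c, ∃ h : l.1 ++ [c] ∈ t, P ⟨_, h⟩ := by
    intro l p hp hpl P
    constructor
    · rintro ⟨w, hw, ⟨c, hc⟩ | ⟨c, hc⟩, hP⟩
      · exact ⟨c, hc ▸ w.2, by convert hP; exact Subtype.ext hc.symm⟩
      · exact (hw (Subtype.ext (hp _ _ hc).symm)).elim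
    · rintro ⟨c, h, hP⟩
      exact ⟨⟨_, h⟩, fun e => hpl c (congrArg Subtype.val e).symm, Or.inl ⟨c, rfl⟩, hP⟩
  induction σ generalizing b l p with
  | nil =>
    have := child hp hpl (fun _ => True)
    simp only [and_true] at this
    rw [Winning, this]
    cases b
    · simp [hl, hardTree]
    · simp [hl, hardTree]
  | cons a σ ih =>
    have step : ∀ (c : ℕ) (b' : Bool) (h : l.1 ++ [c] ∈ t),
        (∀ x, c :: x ∈ hardTree N b (a :: σ) ↔ x ∈ hardTree N b' σ) →
        (Winning (listTree.induce t) σ l ⟨_, h⟩ ↔ b' = true) := by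
      intro c b' h hx
      have hp' : ∀ x d, l.1 ++ [c] = x ++ [d] → l.1 = x := fun x d e => by
        simpa using (List.append_inj' e rfl).1
      have hpl' : ∀ d, l.1 ≠ (l.1 ++ [c]) ++ [d] := fun d e => by
        have := congrArg List.length e
        simp at this
      refine ih b' (l := ⟨_, h⟩) (p := l) (fun x => ?_) hp' hpl'
      rw [← hx, ← hl, List.append_assoc]
      rfl
    have mem : ∀ c, l.1 ++ [c] ∈ t ↔ [c] ∈ hardTree N b (a :: σ) := fun c => hl [c]
    cases a
    · rw [Winning, child hp hpl]
      constructor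
      · rintro ⟨c, h, hw⟩
        have hc := (mem c).1 h
        simp only [hardTree, cons_mem_node, Set.mem_empty_iff_false, and_false, false_or] at hc
        exact (step c b h fun x => by simp [hardTree, cons_mem_node, hc.1]).1 hw
      · intro hb
        have h : l.1 ++ [N] ∈ t := (mem N).2 (by simp [hardTree, cons_mem_node, nil_mem_hardTree])
        exact ⟨N, h, (step N b h fun x => by simp [hardTree, cons_mem_node]).2 hb⟩
    · rw [Winning, child hp hpl]
      constructor
      · rintro ⟨c, h, hw⟩
        by_contra hb
        rw [Bool.not_eq_true] at hb
        subst hb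
        have hc := (mem c).1 h
        simp only [hardTree, cons_mem_node, Set.mem_empty_iff_false, and_false, or_false] at hc
        exact hw ((step c true h fun x => by simp [hardTree, cons_mem_node, hc.1]).2 rfl)
      · rintro rfl
        have h : l.1 ++ [N] ∈ t := (mem N).2 (by simp [hardTree, cons_mem_node, nil_mem_hardTree])
        refine ⟨N, h, fun hw => ?_⟩
        have := (step N false h fun x => by simp [hardTree, cons_mem_node]).1 hw
        simp at this

end TreeRank

namespace TreeRank

/-! ### Finding hard trees in graphs with vertices of large rank -/

section

variable {W : Type} {G : SimpleGraph W}

/-- Vertices outside of `F` that robustly are roots of trees with the levels `σ`. -/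
def HasLevels [DecidableEq W] (G : SimpleGraph W) (M : ℕ) : List Bool → Finset W → W → Prop
  | [], F, v => v ∉ F ∧ ∀ F' : Finset W, F'.card ≤ M → ∃ w, w ∉ F' ∧ G.Adj v w
  | true :: σ, F, v => v ∉ F ∧ ∀ F' : Finset W, F'.card ≤ M →
      ∃ w, G.Adj v w ∧ HasLevels G M σ F' w
  | false :: σ, F, v => v ∉ F ∧ ∃ w, G.Adj v w ∧ HasLevels G M σ (insert v F) w

theorem HasLevels.notMem [DecidableEq W] {M : ℕ} {σ : List Bool} {F : Finset W} {v : W}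
    (h : HasLevels G M σ F v) : v ∉ F := by
  rcases σ with _ | ⟨_ | _, σ⟩ <;> exact h.1

theorem HasLevels.anti [DecidableEq W] {M M' : ℕ} (hM : M' ≤ M) {σ : List Bool} {F : Finset W}
    {v : W} (h : HasLevels G M σ F v) : HasLevels G M' σ F v := by
  induction σ generalizing F v with
  | nil => exact ⟨h.1, fun F' hF' => h.2 F' (hF'.trans hM)⟩
  | cons b σ ih =>
    cases b
    · obtain ⟨hv, w, hw, h⟩ := h
      exact ⟨hv, w, hw, ih h⟩
    · refine ⟨h.1, fun F' hF' => ?_⟩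
      obtain ⟨w, hw, h⟩ := h.2 F' (hF'.trans hM)
      exact ⟨w, hw, ih h⟩

/-- The tree whose root has children `c ∈ K`, each with the subtree `t`. -/
def branching (K : Finset ℕ) (t : Set (List ℕ)) : Set (List ℕ) :=
  {l | l = [] ∨ ∃ c ∈ K, ∃ l' ∈ t, l = c :: l'}

/-- A tree that contains both hard trees. -/
def fullTree (N : ℕ) : List Bool → Set (List ℕ)
  | [] => branching {N} {[]}
  | true :: σ => branching (Finset.range (N + 1)) (fullTree N σ)
  | false :: σ => branching {N} (fullTree N σ)

theorem hardTree_subset_fullTree (N : ℕ) (b : Bool) (σ : List Bool) :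
    hardTree N b σ ⊆ fullTree N σ := by
  induction σ generalizing b with
  | nil =>
    cases b
    · rintro _ rfl
      exact Or.inl rfl
    · rintro _ (rfl | rfl)
      · exact Or.inl rfl
      · exact Or.inr ⟨N, by simp, [], rfl, rfl⟩
  | cons a σ ih =>
    have key : ∀ {X Y : Set (List ℕ)}, X ⊆ fullTree N σ → Y ⊆ fullTree N σ →
        node N X Y ⊆ branching (Finset.range (N + 1)) (fullTree N σ) := by
      rintro X Y hX hY l (rfl | ⟨c, l, rfl, ⟨hc, hl⟩ | ⟨rfl, hl⟩⟩)
      · exact Or.inl rfl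
      · exact Or.inr ⟨c, Finset.mem_range.2 (by omega), l, hX hl, rfl⟩
      · exact Or.inr ⟨c, Finset.mem_range.2 (by omega), l, hY hl, rfl⟩
    cases a
    · simp only [hardTree, fullTree]
      rintro l (rfl | ⟨c, l, rfl, ⟨-, hl⟩ | ⟨rfl, hl⟩⟩)
      · exact Or.inl rfl
      · exact hl.elim
      · exact Or.inr ⟨c, by simp, l, ih b hl, rfl⟩
    · cases b
      · exact key (ih true) (Set.empty_subset _)
      · exact key (ih true) (ih false)

/-- A bound for the number of vertices of the full tree. -/
def fullSize (N : ℕ) : List Bool → ℕ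
  | [] => 2
  | true :: σ => (N + 1) * fullSize N σ + 1
  | false :: σ => fullSize N σ + 1

/-- An embedding of a set of lists with the root `v`, whose image is contained in `I` and avoids
`F`. -/
structure IsListEmbedding (G : SimpleGraph W) (s : Set (List ℕ)) (F : Finset W) (v : W)
    (f : List ℕ → W) (I : Finset W) : Prop where
  root : f [] = v
  injOn : Set.InjOn f s
  mem : ∀ l ∈ s, f l ∈ I
  disj : Disjoint I F
  adj : ∀ l ∈ s, ∀ l' ∈ s, listTree.Adj l l' → G.Adj (f l) (f l')

/-- The subtrees are attached one by one, each avoiding `F` and everything embedded before. For a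
single child the bound in `hext` leaves only `insert v F` as the set to avoid, which is all that a
level without branching can offer. -/
theorem exists_isListEmbedding_branching [DecidableEq W] {F : Finset W} {v : W} (hv : v ∉ F)
    {t : Set (List ℕ)} {B : ℕ} (K : Finset ℕ)
    (hext : ∀ F' : Finset W, insert v F ⊆ F' → F'.card + B ≤ F.card + K.card * B + 1 →
      ∃ w f I, G.Adj v w ∧ IsListEmbedding G t F' w f I ∧ I.card ≤ B) :
    ∃ f I, IsListEmbedding G (branching K t) F v f I ∧ I.card ≤ K.card * B + 1 := by
  induction K using Finset.induction with
  | empty =>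
    have hnil : ∀ l ∈ branching ∅ t, l = [] := by
      rintro l (rfl | ⟨c, hc, -⟩)
      · rfl
      · simp at hc
    refine ⟨fun _ => v, {v}, ⟨rfl, ?_, by simp, by simpa using hv, ?_⟩, by simp⟩
    · intro l hl l' hl' _
      rw [hnil l hl, hnil l' hl']
    · intro l hl l' hl' h
      rw [hnil l hl, hnil l' hl'] at h
      exact (h.ne rfl).elim
  | insert c K hc ih =>
    rw [Finset.card_insert_of_notMem hc, Nat.succ_mul] at hext ⊢
    obtain ⟨f, I, hf, hI⟩ := ih fun F' h hF' => hext F' h (by omega)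
    have hvI : v ∈ I := hf.root ▸ hf.mem [] (Or.inl rfl)
    obtain ⟨w, g, I', hw, hg, hI'⟩ := hext (F ∪ I)
      (Finset.insert_subset (Finset.mem_union_right _ hvI) Finset.subset_union_left)
      (by have := Finset.card_union_le F I; omega)
    have hgI : Disjoint I' F ∧ Disjoint I' I := Finset.disjoint_union_right.1 hg.disj
    let f' : List ℕ → W := fun l => if l.head? = some c then g l.tail else f l
    have hf'c : ∀ l, f' (c :: l) = g l := fun l => by simp [f']
    have hcases : ∀ l ∈ branching (insert c K) t, (l ∈ branching K t ∧ f' l = f l) ∨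
        ∃ l' ∈ t, l = c :: l' := by
      rintro l (rfl | ⟨d, hd, l, hl, rfl⟩)
      · exact Or.inl ⟨Or.inl rfl, by simp [f']⟩
      · rcases Finset.mem_insert.1 hd with rfl | hd
        · exact Or.inr ⟨l, hl, rfl⟩
        · have hdc : d ≠ c := fun h => hc (h ▸ hd)
          exact Or.inl ⟨Or.inr ⟨d, hd, l, hl, rfl⟩, by simp [f', hdc]⟩
    have hne : ∀ l ∈ branching K t, ∀ l' ∈ t, f l ≠ g l' := fun l hl l' hl' h =>
      Finset.disjoint_left.1 hgI.2 (hg.mem l' hl') (h ▸ hf.mem l hl)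
    have hadj : ∀ l ∈ branching K t, ∀ l', listTree.Adj l (c :: l') → l = [] ∧ l' = [] := by
      rintro l (rfl | ⟨d, hd, l, hl, rfl⟩) l' h
      · rw [listTree_adj_nil_left] at h
        simpa using h
      · rw [listTree_adj_cons_cons] at h
        exact (hc (h.1 ▸ hd)).elim
    refine ⟨f', I ∪ I', ⟨by simpa [f'] using hf.root, ?_, ?_, ?_, ?_⟩,
      (Finset.card_union_le _ _).trans (by omega)⟩
    · intro l hl l' hl' h
      rcases hcases l hl with ⟨h1, h2⟩ | ⟨l, h1, rfl⟩ <;>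
        rcases hcases l' hl' with ⟨h1', h2'⟩ | ⟨l', h1', rfl⟩
      · rw [h2, h2'] at h
        exact hf.injOn h1 h1' h
      · rw [h2, hf'c] at h
        exact (hne _ h1 _ h1' h).elim
      · rw [h2', hf'c] at h
        exact (hne _ h1' _ h1 h.symm).elim
      · rw [hf'c, hf'c] at h
        rw [hg.injOn h1 h1' h]
    · intro l hl
      rcases hcases l hl with ⟨h1, h2⟩ | ⟨l, h1, rfl⟩
      · rw [h2]
        exact Finset.mem_union_left _ (hf.mem l h1)
      · rw [hf'c]
        exact Finset.mem_union_right _ (hg.mem l h1)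
    · exact Finset.disjoint_union_left.2 ⟨hf.disj, hgI.1⟩
    · intro l hl l' hl' h
      rcases hcases l hl with ⟨h1, h2⟩ | ⟨l, h1, rfl⟩ <;>
        rcases hcases l' hl' with ⟨h1', h2'⟩ | ⟨l', h1', rfl⟩
      · rw [h2, h2']
        exact hf.adj l h1 l' h1' h
      · obtain ⟨rfl, rfl⟩ := hadj l h1 l' h
        rw [h2, hf'c, hf.root, hg.root]
        exact hw
      · obtain ⟨rfl, rfl⟩ := hadj l' h1' l h.symm
        rw [h2', hf'c, hf.root, hg.root]
        exact hw.symm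
      · rw [hf'c, hf'c]
        exact hg.adj l h1 l' h1' (listTree_adj_cons_cons.1 h).2

theorem HasLevels.exists_isListEmbedding [DecidableEq W] {M N : ℕ} {σ : List Bool} {F : Finset W}
    {v : W} (h : HasLevels G M σ F v) (hM : F.card + fullSize N σ ≤ M) :
    ∃ f I, IsListEmbedding G (fullTree N σ) F v f I ∧ I.card ≤ fullSize N σ := by
  induction σ generalizing F v with
  | nil =>
    refine exists_isListEmbedding_branching h.notMem (B := 1) {N} fun F' _ hF' => ?_
    simp only [fullSize, Finset.card_singleton] at hM hF'
    obtain ⟨w, hw, hvw⟩ := h.2 F' (by omega)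
    refine ⟨w, fun _ => w, {w}, hvw, ⟨rfl, ?_, by simp, by simpa using hw, ?_⟩, by simp⟩
    · rintro _ rfl _ rfl _
      rfl
    · rintro _ rfl _ rfl h
      exact (h.ne rfl).elim
  | cons b σ ih =>
    cases b
    · have := exists_isListEmbedding_branching (G := G) h.notMem (t := fullTree N σ)
        (B := fullSize N σ) {N} fun F' hsub hF' => ?_
      · simpa [fullSize, fullTree] using this
      · obtain ⟨hv, w, hw, hl⟩ := h
        rw [Finset.card_singleton, one_mul] at hF'
        rw [← Finset.eq_of_subset_of_card_le hsub
          (by rw [Finset.card_insert_of_notMem hv]; omega)]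
        obtain ⟨f, I, hf, hI⟩ := ih hl (by
          rw [Finset.card_insert_of_notMem hv]
          simp only [fullSize] at hM
          omega)
        exact ⟨w, f, I, hw, hf, hI⟩
    · have := exists_isListEmbedding_branching (G := G) h.notMem (t := fullTree N σ)
        (B := fullSize N σ) (Finset.range (N + 1)) fun F' _ hF' => ?_
      · simpa [fullSize, fullTree] using this
      · simp only [fullSize, Finset.card_range] at hM hF'
        obtain ⟨w, hw, hl⟩ := h.2 F' (by omega)
        obtain ⟨f, I, hf, hI⟩ := ih hl (by omega)
        exact ⟨w, f, I, hw, hf, hI⟩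

/-- The edges of a subdivided path become levels without branching. That `q` is a path allows each
vertex to be forbidden for the rest. -/
theorem hasLevels_replicate_append [DecidableEq W] {M : ℕ} {σ : List Bool} {x u : W}
    (hu : ∀ F : Finset W, u ∉ F → HasLevels G M σ F u) (q : G.Walk x u) (hq : q.IsPath)
    {F : Finset W} (hF : ∀ y ∈ q.support, y ∉ F) :
    HasLevels G M (List.replicate q.length false ++ σ) F x := by
  induction q generalizing F with
  | nil => exact hu F (hF _ (by simp))
  | @cons x y u h q ih =>
    rw [SimpleGraph.Walk.cons_isPath_iff] at hq
    refine ⟨hF x (by simp), y, h, ih hu hq.1 fun z hz => ?_⟩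
    rw [Finset.mem_insert, not_or]
    exact ⟨fun e => hq.2 (e ▸ hz), hF z (by simp [hz])⟩

/-- Vertices of large rank are roots of trees with uniform levels. -/
theorem exists_hasLevels_of_hasRank [DecidableEq W] {r M M' i : ℕ} {v : W}
    (L : Finset (List Bool)) (hL : ∀ σ : List Bool, σ.length ≤ i * r → σ ∈ L)
    (hM : L.card * M + 1 ≤ M') (h : HasRank (uncolored G) r M' (i + 1) v) :
    ∃ σ : List Bool, σ.length ≤ i * r ∧ σ.count true = i ∧
      ∀ F : Finset W, v ∉ F → HasLevels G M σ F v := by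
  induction i generalizing v with
  | zero =>
    refine ⟨[], by simp, by simp, fun F hv => ⟨hv, fun F' hF' => ?_⟩⟩
    have hL' : 1 ≤ L.card := Finset.card_pos.2 ⟨[], hL [] (by simp)⟩
    have hcard : (↑F' : Set W).encard ≤ M' := by
      rw [Set.encard_coe_eq_coe_finsetCard]
      exact Nat.cast_le.2 (hF'.trans (by nlinarith))
    obtain ⟨F, -, hF⟩ := exists_fin_cover hcard (Set.subset_univ _) (Or.inl ⟨v, trivial⟩)
    obtain ⟨u, hu, -, p, -, hpF⟩ := h F (fun _ => Set.mem_univ _)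
    cases p with
    | nil => exact (hu rfl).elim
    | @cons _ w _ e p =>
      refine ⟨w, fun hw => ?_, e⟩
      obtain ⟨j, hj⟩ := hF w hw
      exact hpF w (by simp) e.ne' j hj
  | succ i ih =>
    have hil : i * r ≤ (i + 1) * r := Nat.mul_le_mul_right _ (Nat.le_succ i)
    by_contra! hcon
    -- If no pattern works for `v`, each candidate τ for the levels below `v` is blocked by some set
    -- of at most `M` vertices. The union of these sets over `L` is too small to separate `v` from
    -- the vertices of the previous rank.
    have : ∀ τ : List Bool, ∃ F : Finset W, F.card ≤ M ∧ (τ.length + 1 ≤ (i + 1) * r →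
        τ.count true = i → ∀ w, G.Adj v w → ¬ HasLevels G M τ F w) := by
      intro τ
      by_cases hτ : τ.length + 1 ≤ (i + 1) * r ∧ τ.count true = i
      · obtain ⟨F, hv, hF⟩ := hcon (true :: τ) (by simpa using hτ.1) (by simpa using hτ.2)
        simp only [HasLevels, not_and, not_forall, not_exists] at hF
        obtain ⟨F', hF', h'⟩ := hF hv
        exact ⟨F', hF', fun _ _ => h'⟩
      · exact ⟨∅, by simp, fun h1 h2 => (hτ ⟨h1, h2⟩).elim⟩
    choose B hB hBlock using this
    have hcard : (↑(L.biUnion B) : Set W).encard ≤ M' := by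
      rw [Set.encard_coe_eq_coe_finsetCard]
      exact Nat.cast_le.2 ((Finset.card_biUnion_le_card_mul _ _ M fun x _ => hB x).trans (by omega))
    obtain ⟨F, -, hF⟩ := exists_fin_cover hcard (Set.subset_univ _) (Or.inl ⟨v, trivial⟩)
    obtain ⟨u, hu, hur, p, hp, hpF⟩ := h F (fun _ => Set.mem_univ _)
    change G.Walk v u at p
    obtain ⟨σ, hσ, hσc, hσL⟩ := ih (fun σ hσ => hL σ (hσ.trans hil)) hur
    have hqp : p.bypass.IsPath := p.bypass_isPath
    have hql : p.bypass.length ≤ r := p.length_bypass_le_length.trans hp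
    have hqs : ∀ x ∈ p.bypass.support, x ≠ v → ∀ j, x ≠ F j := fun x hx =>
      hpF x (p.support_bypass_subset_support hx)
    revert hqp hql hqs
    generalize p.bypass = q
    intro hqp hql hqs
    cases q with
    | nil => exact hu rfl
    | @cons _ w _ e q =>
      rw [SimpleGraph.Walk.cons_isPath_iff] at hqp
      rw [SimpleGraph.Walk.length_cons] at hql
      have hlen : (List.replicate q.length false ++ σ).length + 1 ≤ (i + 1) * r := by
        rw [List.length_append, List.length_replicate, Nat.succ_mul]
        omega
      refine hBlock (List.replicate q.length false ++ σ) hlen (by simpa [List.count_replicate]) w e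
        (hasLevels_replicate_append hσL q hqp.1 fun y hy hyB => ?_)
      obtain ⟨j, hj⟩ := hF y (by
        rw [Finset.mem_coe, Finset.mem_biUnion]
        exact ⟨_, hL _ (by omega), hyB⟩)
      exact hqs y (by simp [hy]) (fun e => hqp.2 (e ▸ hy)) j hj

end

end TreeRank

namespace TreeRank

open FirstOrder FirstOrder.Language

/-! ### Complete trees -/

/-- Every edge is a bridge: only the edge between `l` and `l ++ [c]` changes whether `l ++ [c]` is a
prefix. -/
theorem isAcyclic_listTree : listTree.IsAcyclic := by
  have key : ∀ l c, listTree.IsBridge s(l, l ++ [c]) := by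
    intro l c
    rw [SimpleGraph.isBridge_iff]
    rintro ⟨p⟩
    have step : ∀ x d, s(x, x ++ [d]) ≠ s(l, l ++ [c]) →
        (l ++ [c] <+: x ↔ l ++ [c] <+: x ++ [d]) := by
      intro x d hne
      rw [List.prefix_concat_iff]
      refine (or_iff_right fun h => hne ?_).symm
      obtain ⟨h1, h2⟩ := List.append_inj' h rfl
      rw [h1, h2]
    have : ∀ {x y} (_ : (listTree.deleteEdges {s(l, l ++ [c])}).Walk x y),
        l ++ [c] <+: x ↔ l ++ [c] <+: y := by
      intro x y p
      induction p with
      | nil => rfl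
      | cons e p ih =>
        rw [SimpleGraph.deleteEdges_adj, Set.mem_singleton_iff] at e
        obtain ⟨⟨d, rfl⟩ | ⟨d, rfl⟩, hne⟩ := e
        · exact (step _ d hne).trans ih
        · exact (step _ d (Sym2.eq_swap.trans_ne hne)).symm.trans ih
    have h := ((this p).2 List.prefix_rfl).length_le
    simp at h
  refine SimpleGraph.isAcyclic_iff_forall_adj_isBridge.2 fun l l' h => ?_
  rcases h with ⟨c, rfl⟩ | ⟨c, rfl⟩
  · exact key _ _
  · rw [Sym2.eq_swap]
    exact key _ _

/-- The vertices of the complete `m`-ary tree of height `h`. -/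
def completeTree (m h : ℕ) : Set (List ℕ) :=
  {l | l.length ≤ h ∧ ∀ c ∈ l, c < m}

theorem nil_mem_completeTree {m h : ℕ} : [] ∈ completeTree m h := by
  simp [completeTree]

theorem append_mem_completeTree {m h c : ℕ} {l : List ℕ} :
    l ++ [c] ∈ completeTree m h ↔ l ∈ completeTree m h ∧ l.length < h ∧ c < m := by
  simp only [completeTree, Set.mem_ofPred_eq, List.length_append, List.length_singleton,
    List.forall_mem_append, List.forall_mem_singleton]
  constructor
  · rintro ⟨h1, h2, h3⟩
    exact ⟨⟨by omega, h2⟩, h1, h3⟩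
  · rintro ⟨⟨_, h2⟩, h1, h3⟩
    exact ⟨h1, h2, h3⟩

theorem finite_completeTree (m h : ℕ) : (completeTree m h).Finite := by
  induction h with
  | zero =>
    refine (Set.finite_singleton []).subset fun l hl => ?_
    exact List.length_eq_zero_iff.1 (Nat.le_zero.1 hl.1)
  | succ h ih =>
    refine ((Set.finite_singleton []).union
      ((ih.prod (Set.finite_lt_nat m)).image fun p => p.1 ++ [p.2])).subset fun l hl => ?_
    induction l using List.reverseRecOn with
    | nil => exact Or.inl rfl
    | append_singleton l c =>
      rw [append_mem_completeTree] at hl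
      exact Or.inr ⟨(l, c), ⟨⟨Nat.lt_succ_iff.1 hl.2.1, hl.1.2⟩, hl.2.2⟩, rfl⟩

theorem exists_walk_completeTree {m h : ℕ} (l : List ℕ) (hl : l ∈ completeTree m h) :
    ∃ p : (listTree.induce (completeTree m h)).Walk ⟨[], nil_mem_completeTree⟩ ⟨l, hl⟩,
      p.length = l.length := by
  induction l using List.reverseRecOn with
  | nil => exact ⟨.nil, rfl⟩
  | append_singleton l c ih =>
    obtain ⟨p, hp⟩ := ih (append_mem_completeTree.1 hl).1
    exact ⟨p.concat (Or.inl ⟨c, rfl⟩), (p.length_concat _).trans (by simp [hp])⟩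

theorem isTree_completeTree (m h : ℕ) : (listTree.induce (completeTree m h)).IsTree := by
  refine ⟨?_, isAcyclic_listTree.induce _⟩
  rw [SimpleGraph.connected_iff_exists_forall_reachable]
  exact ⟨⟨[], nil_mem_completeTree⟩, fun l => ⟨(exists_walk_completeTree l.1 l.2).choose⟩⟩

theorem length_le_of_walk {s : Set (List ℕ)} {x y : s} (p : (listTree.induce s).Walk x y) :
    y.1.length ≤ x.1.length + p.length := by
  induction p with
  | nil => simp
  | cons e p ih =>
    rw [SimpleGraph.Walk.length_cons]
    rcases e with ⟨c, e⟩ | ⟨c, e⟩ <;> replace e := congrArg List.length e <;>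
      simp only [Function.Embedding.subtype_apply, List.length_append, List.length_singleton] at e <;>
      omega

theorem hasDepth_completeTree {m h : ℕ} (hm : 0 < m) :
    HasDepth (listTree.induce (completeTree m h)) ⟨[], nil_mem_completeTree⟩ (h + 1) := by
  classical
  have key : ∀ (v : completeTree m h)
      (p : (listTree.induce (completeTree m h)).Walk ⟨[], nil_mem_completeTree⟩ v),
      p.IsPath → p.length ≤ v.1.length := by
    intro v p hp
    obtain ⟨q, hq⟩ := exists_walk_completeTree v.1 v.2
    rw [((isTree_completeTree m h).existsUnique_path _ _).unique hp q.bypass_isPath, ← hq]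
    exact q.length_bypass_le_length
  constructor
  · have hv : List.replicate h 0 ∈ completeTree m h :=
      ⟨by simp, fun c hc => by rwa [List.eq_of_mem_replicate hc]⟩
    obtain ⟨q, -⟩ := exists_walk_completeTree _ hv
    refine ⟨_, q.bypass, q.bypass_isPath, ?_⟩
    have h1 := key _ q.bypass q.bypass_isPath
    have h2 := length_le_of_walk q.bypass
    simp only [List.length_replicate, List.length_nil] at h1 h2
    rw [SimpleGraph.Walk.length_support]
    omega
  · rintro _ ⟨v, p, hp, rfl⟩
    rw [SimpleGraph.Walk.length_support]
    exact Nat.succ_le_succ ((key v p hp).trans v.2.1)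

/-- The vertices of subdivided complete trees have large rank. -/
theorem hasRank_branch {W : Type} {G : SimpleGraph W} {r m h M : ℕ} (hM : M < m)
    (S : SubdivisionIn r (listTree.induce (completeTree m h)) G) (i : ℕ) (l : completeTree m h)
    (hl : l.1.length + i + 1 ≤ h) : HasRank (uncolored G) (r + 1) M i (S.branch l) := by
  have mem : ∀ c : Fin m, l.1 ++ [c.1] ∈ completeTree m h := fun c =>
    append_mem_completeTree.2 ⟨l.2, by omega, c.2⟩
  have hadj : ∀ c, (listTree.induce (completeTree m h)).Adj l ⟨_, mem c⟩ :=
    fun c => Or.inl ⟨c, rfl⟩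
  induction i generalizing l with
  | zero =>
    have := S.path (hadj ⟨0, by omega⟩)
    obtain ⟨w, e, -⟩ := this.exists_eq_cons_of_ne
      (fun e => (hadj ⟨0, by omega⟩).ne (S.branch_injective e))
    exact ⟨w, e⟩
  | succ i ih =>
    intro F _
    by_contra! hcon
    have : ∀ c : Fin m, ∃ j, F j ∈ (S.path (hadj c)).support ∧ F j ≠ S.branch l := by
      intro c
      obtain ⟨x, hx, hxl, j, rfl⟩ := hcon (S.branch ⟨_, mem c⟩)
        (fun e => (hadj c).ne (S.branch_injective e).symm)
        (ih _ (by simp only [List.length_append, List.length_singleton]; omega)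
          (fun d => append_mem_completeTree.2 ⟨mem c, by simp; omega, d.2⟩)
          fun d => Or.inl ⟨d, rfl⟩)
        (S.path (hadj c)) (S.path_length_le _)
      exact ⟨j, hx, hxl⟩
    choose j hj hjl using this
    -- A set of `M` vertices that meets the paths to all `m` children meets two of them in the same
    -- vertex. This vertex is a branch vertex by disjointness, yet it is not the image of `l`.
    obtain ⟨c, c', hc, hcc⟩ := Fintype.exists_ne_map_eq_of_card_lt j (by simpa using hM)
    have hne : l.1 ++ [c.1] ≠ l.1 ++ [c'.1] := fun e => hc (by simpa [Fin.ext_iff] using e)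
    obtain ⟨w, hw⟩ := S.path_disjoint (hadj c) (hadj c') (F (j c)) (by
      intro e
      rcases Sym2.eq_iff.1 e with ⟨-, e⟩ | ⟨e, -⟩
      · exact hne (congrArg Subtype.val e)
      · exact (hadj c').ne e) (hj c) (hcc ▸ hj c')
    have hl' : w ≠ l := fun e => hjl c (e ▸ hw.symm)
    have h1 := (S.branch_mem_path (hadj c) w (hw ▸ hj c)).resolve_left hl'
    have h2 := (S.branch_mem_path (hadj c') w (by rw [hw, hcc]; exact hj c')).resolve_left hl'
    exact hne (congrArg Subtype.val (h1.symm.trans h2))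

/-- Classes of large tree rank contain graphs with many levels, with a uniform pattern. -/
theorem exists_hasLevels (C : GraphClass) {D e : ℕ} (hD : D ∈ C.treeDepths) (he : e + 3 ≤ D) :
    ∃ σ : List Bool, σ.count true = e ∧ ∀ M, ∃ (W : Type) (_ : DecidableEq W) (G : SimpleGraph W)
      (v : W), C.Mem G ∧ HasLevels G M σ ∅ v := by
  classical
  obtain ⟨r, hr⟩ := hD
  let L : Finset (List Bool) := (List.finite_length_le Bool (e * (r + 1))).toFinset
  by_contra! hcon
  have : ∀ σ : List Bool, ∃ M, σ.count true = e → ∀ (W : Type) (_ : DecidableEq W)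
      (G : SimpleGraph W) (v : W), C.Mem G → ¬ HasLevels G M σ ∅ v := by
    intro σ
    by_cases hσ : σ.count true = e
    · obtain ⟨M, h⟩ := hcon σ hσ
      exact ⟨M, fun _ => h⟩
    · exact ⟨0, fun h => (hσ h).elim⟩
  choose B hB using this
  obtain ⟨D, rfl⟩ : ∃ h, D = h + 1 := ⟨D - 1, by omega⟩
  -- If every pattern σ fails for some `B σ`, a tree that is bushy enough for all of the finitely
  -- many patterns in `L` at once gives a contradiction. The number of children exceeds the
  -- robustness by one.
  obtain ⟨W, G, hG, ⟨S⟩⟩ := hr (completeTree (L.card * L.sup B + 1 + 1) D) _ _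
    (finite_completeTree _ _) (isTree_completeTree _ _) (hasDepth_completeTree (Nat.succ_pos _))
  have hrank := hasRank_branch (Nat.lt_succ_self _) S (e + 1) ⟨[], nil_mem_completeTree⟩
    (by simp only [List.length_nil]; omega)
  have hL : ∀ σ : List Bool, σ.length ≤ e * (r + 1) → σ ∈ L := fun σ hσ => by simpa [L] using hσ
  obtain ⟨σ, hσ, hσe, h⟩ := exists_hasLevels_of_hasRank L hL le_rfl hrank
  exact hB σ hσe W _ G _ hG ((h ∅ (by simp)).anti (Finset.le_sup (hL σ hσ)))

/-- Every class of unbounded tree rank needs formulas of unbounded alternation rank. -/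
theorem exists_formula (C : GraphClass) (hC : C.Monotone) {D k : ℕ} (hD : D ∈ C.treeDepths)
    (hk : k + 4 ≤ D) : ∃ φ : Language.graph.Formula (Fin 1), ∀ ψ : Language.graph.Formula (Fin 1),
      alternationRank ψ ≤ k → ¬ C.EquivalentOn φ ψ := by
  classical
  obtain ⟨σ, hσ, hlev⟩ := exists_hasLevels C hD (e := k + 1) (by omega)
  -- At the root the vertex serves as its own parent, which excludes none of its neighbors. The
  -- negation of this formula is used below, since truth is preserved from the losing tree to the
  -- winning one.
  obtain ⟨φ, hφ⟩ := exists_winning_formula (Fin 1) σ 0 (Sum.inl 0) (Sum.inl 0)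
  refine ⟨φ.not, fun ψ hψ heq => ?_⟩
  -- The number of vertices that swaps have to fix: the free variable and the quantified ones. The
  -- trees have branching parameter n + 1.
  let n := 1 + 0 + quantifierDepth ψ
  obtain ⟨W, _, G, v, hG, hv⟩ := hlev (fullSize (n + 1) σ)
  obtain ⟨f, I, hf, -⟩ := hv.exists_isListEmbedding (N := n + 1) (by simp)
  have hmem : ∀ b, C.Mem (listTree.induce (hardTree (n + 1) b σ)) := by
    intro b
    have hsub := hardTree_subset_fullTree (n + 1) b σ
    exact hC G _ hG ⟨⟨⟨fun l => f l, fun {l l'} h => hf.adj _ (hsub l.2) _ (hsub l'.2) h⟩,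
      fun l l' h => Subtype.ext (hf.injOn (hsub l.2) (hsub l'.2) h)⟩⟩
  have hpres := setPreserving_hardTree (Nat.lt_succ_self n) σ
  have hψφ : ∀ b, Sat (listTree.induce (hardTree (n + 1) b σ)) ψ
      (fun _ => ⟨[], nil_mem_hardTree b σ⟩) default ↔ b = false := by
    intro b
    have h1 := heq _ (hmem b) (fun _ => ⟨[], nil_mem_hardTree b σ⟩)
    change Sat _ φ.not _ default ↔ Sat _ ψ _ default at h1
    rw [← h1, sat_not, hφ]
    simp only [Sum.elim_inl]
    rw [winning_hardTree b σ (fun x => Iff.rfl) (by simp) (by simp), Bool.not_eq_true]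
  -- The additional leading ∃ may raise the `k` alternations of `ψ` to k + 1, the number of
  -- branching levels of σ.
  have h := hpres.preserving.sat true ψ (by simp [n]) (fun w hw =>
    (alternations_ex_cons_le w).trans (by
      rw [hσ]
      exact Nat.succ_le_succ ((alternationRank_le_iff.1 hψ) w hw)))
    _ _ (iff_of_true ((hψφ false).2 rfl) rfl)
  have h2 := hψφ true
  simp only [Bool.true_eq_false, iff_false] at h2
  refine h2 ?_
  convert h.2 rfl using 1
  rfl

/-- Vacuous, as walks have at least one vertex. It makes the set of depths nonempty even for the
empty class. -/
theorem zero_mem_treeDepths (C : GraphClass) : 0 ∈ C.treeDepths := by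
  refine ⟨0, fun V T root _ _ h => ?_⟩
  obtain ⟨v, p, -, hp⟩ := h.1
  simp at hp

end TreeRank

/-! ### The main theorem -/

theorem mainTheorem4 (C : TreeRank.GraphClass) (hC : C.Monotone) :
    C.HasBoundedTreeRank ↔
      ∃ k : ℕ, ∀ (m : ℕ) (φ : FirstOrder.Language.graph.Formula (Fin m)),
        ∃ ψ : FirstOrder.Language.graph.Formula (Fin m),
          TreeRank.alternationRank ψ ≤ k ∧ C.EquivalentOn φ ψ := by
  constructor
  · rintro ⟨d, hd⟩
    exact TreeRank.exists_alternationRank_bound C fun h =>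
      absurd (hd.2 h) (Nat.not_succ_le_self d)
  · rintro ⟨k, hk⟩
    -- A nonempty bounded set of natural numbers has a maximum, so the tree rank exists as soon as
    -- the depths are bounded.
    have hbdd : BddAbove C.treeDepths := by
      refine ⟨k + 4, fun D hD => ?_⟩
      by_contra! hlt
      obtain ⟨φ, hφ⟩ := TreeRank.exists_formula C hC hD hlt.le
      obtain ⟨ψ, hψ, heq⟩ := hk 1 φ
      exact hφ ψ hψ heq
    exact ⟨_, Nat.sSup_mem ⟨0, TreeRank.zero_mem_treeDepths C⟩ hbdd, fun D hD => le_csSup hbdd hD⟩
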